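/- Let $k\ge 2$ be a fixed integer. The supersaturation conjecture for $2k$-cycles says: there are constants $C,c>0$, depending only on $k$, such that every finite bipartite graph $G=(A\cup B,E)$ with $m$ edges and $m\ge C\,k\bigl(|A|+|B|+(|A||B|)^{(k+1)/(2k)}\bigr)$ contains at least $c\,m^{2k}/(|A|^k|B|^k)$ cycles of length $2k$ (cycles are counted as subgraphs). Proposition. If the supersaturation conjecture holds for $2k$-cycles, then there is a deterministic algorithm that, given the edge list of a finite simple undirected graph $G$ with $m$ edges, lists all $2k$-cycles of $G$, each exactly once, in time $\tilde O\bigl(m^{2k/(k+1)}+t\bigr)$, where $t$ is the number of $2k$-cycles of $G$. In detail: there are a word-RAM program $P$ and constants $C',d,q$, all depending only on $k$, such that for every $n$, every simple graph $G$ on the vertex set $\{0,\dots,n-1\}$ with $m$ edges, every edge list of $G$ (each edge once, in any order and orientation) and every word length $w$ with $2^w\ge (n+m+2)^q$, the program $P$ on the input consisting of $n$, $m$ and the edge list (stored in the first cells of an otherwise zero memory) halts after at most $$C'\,\bigl(m^{2k/(k+1)}+t+1\bigr)\,\bigl(\log(m+2)\bigr)^{d}$$ steps, and its output is a concatenation of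 $2k$-tuples of vertices, each of which traverses a $2k$-cycle of $G$, such that every $2k$-cycle of $G$ is traversed by exactly one of the tuples. Each arithmetic operation ($+$, cut-off $-$, $\times$, integer $/$, mod) or comparison of words, register access, memory access, output of a word and branch counts as one step. -/

import Mathlib

namespace EvenCycles

/-! ### Cycles of a fixed length -/

/-- `v = (v 0, …, v (ℓ-1))` traverses a cycle of length `ℓ` of `G` (for `3 ≤ ℓ`): the vertices are
pairwise distinct, and cyclically consecutive ones are adjacent. -/
structure IsCycleTuple {V : Type} (G : SimpleGraph V) {ℓ : ℕ} (v : Fin ℓ → V) : Prop where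
  injective : Function.Injective v
  adj : ∀ i, G.Adj (v i) (v (finRotate ℓ i))

/-- The edge set of the cycle traversed by `v`. For `3 ≤ ℓ`, two tuples traverse the same cycle
(as a subgraph) if and only if they have the same edge set. -/
def cycleEdges {V : Type} {ℓ : ℕ} (v : Fin ℓ → V) : Set (Sym2 V) :=
  Set.range fun i => s(v i, v (finRotate ℓ i))

/-- The number of cycles of length `ℓ` in `G`, counted as subgraphs (not as tuples). -/
noncomputable def cycleCount {V : Type} (G : SimpleGraph V) (ℓ : ℕ) : ℕ :=
  Set.ncard {S : Set (Sym2 V) | ∃ v : Fin ℓ → V, IsCycleTuple G v ∧ S = cycleEdges v}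

/-! ### The supersaturation conjecture -/

/-- The supersaturation conjecture for `2k`-cycles in bipartite graphs; the constants hidden in the
two `Ω`'s may depend on `k`. -/
def SupersaturationConjecture (k : ℕ) : Prop :=
  ∃ C c : ℝ, 0 < C ∧ 0 < c ∧
    ∀ (V : Type) [Fintype V] (G : SimpleGraph V) (A B : Finset V),
      G.IsBipartiteWith (A : Set V) (B : Set V) →
      C * (k * ((A.card : ℝ) + B.card +
          ((A.card : ℝ) * B.card) ^ (((k : ℝ) + 1) / (2 * k)))) ≤ (G.edgeSet.ncard : ℝ) →
      c * ((G.edgeSet.ncard : ℝ) ^ (2 * k) / ((A.card : ℝ) ^ k * (B.card : ℝ) ^ k)) ≤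
        (cycleCount G (2 * k) : ℝ)

end EvenCycles

/-! ### The word RAM

Words are the natural numbers below `2 ^ w`. A program is a fixed finite piece of code over
registers, a random-access memory whose cells are addressed by words, and a write-only output
stream. Every arithmetic operation, comparison, register access, memory access, output and branch
costs one step. -/

namespace WordRAM

/-- Binary word operations. -/
inductive Op where
  | add | sub | mul | div | mod | lt | eq

/-- The value of an operation; results are truncated to `w` bits. Subtraction is cut off at `0`,
comparisons return `0` or `1`. -/
def Op.apply (w : ℕ) : Op → ℕ → ℕ → ℕ
  | .add, a, b => (a + b) % 2 ^ w
  | .sub, a, b => (a - b) % 2 ^ w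
  | .mul, a, b => (a * b) % 2 ^ w
  | .div, a, b => (a / b) % 2 ^ w
  | .mod, a, b => (a % b) % 2 ^ w
  | .lt, a, b => (if a < b then 1 else 0) % 2 ^ w
  | .eq, a, b => (if a = b then 1 else 0) % 2 ^ w

/-- Expressions: literals, registers, memory reads (at a computed address), binary operations. -/
inductive Expr where
  | lit (c : ℕ)
  | reg (r : ℕ)
  | load (addr : Expr)
  | bin (o : Op) (e₁ e₂ : Expr)

/-- A machine state: register contents, memory contents, and the words output so far. -/
structure State where
  reg : ℕ → ℕ
  mem : ℕ → ℕ
  out : List ℕ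

/-- The value of an expression. -/
def Expr.eval (w : ℕ) (s : State) : Expr → ℕ
  | .lit c => c % 2 ^ w
  | .reg r => s.reg r
  | .load e => s.mem (e.eval w s)
  | .bin o e₁ e₂ => o.apply w (e₁.eval w s) (e₂.eval w s)

/-- The number of steps for evaluating an expression: one for each node. -/
def Expr.cost : Expr → ℕ
  | .lit _ => 1
  | .reg _ => 1
  | .load e => e.cost + 1
  | .bin _ e₁ e₂ => e₁.cost + e₂.cost + 1

/-- Programs. A guard `e` is true if its value is nonzero. -/
inductive Program where
  | skip
  | assign (r : ℕ) (e : Expr)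
  | store (addr e : Expr)
  | emit (e : Expr)
  | seq (p q : Program)
  | ite (e : Expr) (p q : Program)
  | loop (e : Expr) (p : Program)

/-- `Exec w p s T s'`: with word length `w`, program `p` started in state `s` halts in state `s'`
after exactly `T` steps. -/
inductive Exec (w : ℕ) : Program → State → ℕ → State → Prop where
  | skip (s : State) : Exec w .skip s 1 s
  | assign (r : ℕ) (e : Expr) (s : State) :
      Exec w (.assign r e) s (e.cost + 1)
        { s with reg := Function.update s.reg r (e.eval w s) }
  | store (a e : Expr) (s : State) :
      Exec w (.store a e) s (a.cost + e.cost + 1)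
        { s with mem := Function.update s.mem (a.eval w s) (e.eval w s) }
  | emit (e : Expr) (s : State) :
      Exec w (.emit e) s (e.cost + 1) { s with out := s.out ++ [e.eval w s] }
  | seq {p q : Program} {s s₁ s₂ : State} {T₁ T₂ : ℕ} :
      Exec w p s T₁ s₁ → Exec w q s₁ T₂ s₂ → Exec w (.seq p q) s (T₁ + T₂) s₂
  | ite_true {e : Expr} {p q : Program} {s s₁ : State} {T : ℕ} :
      e.eval w s ≠ 0 → Exec w p s T s₁ → Exec w (.ite e p q) s (e.cost + 1 + T) s₁
  | ite_false {e : Expr} {p q : Program} {s s₁ : State} {T : ℕ} :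
      e.eval w s = 0 → Exec w q s T s₁ → Exec w (.ite e p q) s (e.cost + 1 + T) s₁
  | loop_false {e : Expr} {p : Program} {s : State} :
      e.eval w s = 0 → Exec w (.loop e p) s (e.cost + 1) s
  | loop_true {e : Expr} {p : Program} {s s₁ s₂ : State} {T₁ T₂ : ℕ} :
      e.eval w s ≠ 0 → Exec w p s T₁ s₁ → Exec w (.loop e p) s₁ T₂ s₂ →
      Exec w (.loop e p) s (e.cost + 1 + T₁ + T₂) s₂

/-- The initial state on input words `I`: they fill the first memory cells, in order; the
registers and all other cells are `0`, and nothing has been output. -/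
def State.init (I : List ℕ) : State where
  reg := fun _ => 0
  mem := fun a => I.getD a 0
  out := []

end WordRAM

namespace EvenCycles

/-! ### Input and output of the listing problem -/

/-- `L` is an edge list of `G`: every edge occurs exactly once, in one of its two orientations; the
order of the list is arbitrary. -/
def IsEdgeList {n : ℕ} (G : SimpleGraph (Fin n)) (L : List (Fin n × Fin n)) : Prop :=
  (L.map fun e => s(e.1, e.2)).Nodup ∧
    ∀ u v : Fin n, s(u, v) ∈ (L.map fun e => s(e.1, e.2)) ↔ G.Adj u v

/-- The input words: the number of vertices, the number of edges, then the endpoints of the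
edges. -/
def encodeInput {n : ℕ} (L : List (Fin n × Fin n)) : List ℕ :=
  n :: L.length :: L.flatMap fun e => [(e.1 : ℕ), (e.2 : ℕ)]

/-- The output words list all cycles of length `ℓ` of `G`: they are the concatenation of tuples of
`ℓ` vertices, each of which traverses a cycle, and every cycle is traversed by exactly one of
them. -/
def ListsAllCycles {n : ℕ} (G : SimpleGraph (Fin n)) (ℓ : ℕ) (out : List ℕ) : Prop :=
  ∃ cs : List (Fin ℓ → Fin n),
    (∀ v ∈ cs, IsCycleTuple G v) ∧
    (cs.map cycleEdges).Nodup ∧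
    (∀ v : Fin ℓ → Fin n, IsCycleTuple G v → cycleEdges v ∈ cs.map cycleEdges) ∧
    out = cs.flatMap fun v => List.ofFn fun i => (v i : ℕ)

end EvenCycles

/-!
The algorithm searches, from every vertex `x₀`, for the `2k`-cycles in which `x₀` is the vertex with
the largest key, where keys order the vertices by degree, then by number. A vertex `u` may be used at
position `i` of the cycle only if its key is below that of `x₀` and it has the colour of position
`i`. Breadth-first search with these restrictions is made from `x₀` in both directions around the
cycle, `k` layers each, and in the last layer of the second side only vertices that the first side
has reached are kept. The lists of predecessors that the two sides record are then followed back
from the vertices at position `k`. No branch of this enumeration is a dead end, so it takes time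
proportional to the number of closed walks found, and these are cycles, because distinct positions
have distinct colours (`Tri.search`, `lists_search`).

*Colours.* Vertices are numbered by the rank of their first arc, and the colour of a vertex is its
rank modulo `p`. For a given cycle, `p` separates the ranks if it does not divide the product of
their differences. This product is polynomial in the number `m` of edges, and a number that is
divisible by `1, …, p - 1` is exponentially large in `p` (`two_pow_leastNonDvd_le`), so that some `p`
of size `O(log m)` does. All these `p` are tried, with all `p ^ (2 * k)` choices of the colours of the
positions. A cycle may be found for several `p`; it is put out only if `p` is the least
non-divisor, and only in one of its two directions. Thus each canonical tuple is put out once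
(`Tri.main`), and every cycle is traversed by exactly one canonical tuple
(`Lists.listsAllCycles`). Since each cycle is traversed by a bounded number of tuples, all
enumerations together take time `O(t)` up to logarithms (`sum_tupleCount_le`).

*The size of the layers.* Put `σ ^ (2 * k) = m ^ (2k/(k+1)) + t + 1`, so that `m ≤ σ ^ (k + 1)`. There
are at most `2 m / σ ^ 2` vertices of degree more than `σ ^ 2`, and the searches from them take time
`O(m ^ 2 / σ ^ 2) = O(σ ^ (2 * k))`. A search from any other vertex uses only vertices of degree at
most `σ ^ 2`. For disjoint sets `A` and `B` of such vertices, the supersaturation conjecture, applied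
to the graph between them, shows together with `t ≤ σ ^ (2 * k)`, `m ≤ σ ^ (k + 1)` and the bound for
the degrees that there are `O(σ √(|A| |B|))` edges between them (`exists_edgesBetween_le`). By a dyadic decomposition, the bilinear form of the
edges between two colour classes has norm `O(σ log m)` (`sum_adj_mul_le`). Let `r j u` be the number of
start vertices whose search reaches `u` in layer `j`. As `r (j + 1) u` is at most the sum of `r j v` over
the neighbours `v` of `u`, the euclidean norm of `r j` grows by at most that factor in each layer
(`sum_sq_reachCount_le`). If all start vertices have degree about `δ`, there are `O(m / δ)` of them,
and no vertex of the search has a larger degree than about `δ`; so the Cauchy–Schwarz inequality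
bounds the total degree of the layers, `∑ u, r j u * deg u`, by `O(√(m / δ) √(m δ)) = O(m)` times the
factors for the layers `1, …, j` (`sum_layerCost_level_le`). As only the degrees of the layers
`0, …, k - 1` matter, the sum is at most `m σ ^ (k - 1) ≤ σ ^ (2 * k)` up to logarithms
(`sum_layerCost_le`, `colouringWork_le`).

*The machine.* The memory is used as a family of lists with keys `(t, r, u)`: the cell for entry `i` of
such a list has the address with the digits `t, r, u, i` in a base `B` that is polynomial in the size
of the input. Each search has a number `r` of its own, so that its lists are empty at the beginning and
never have to be cleared. `Tri P a c Q` is a total correctness assertion with the time bound `c`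
for states in which the memory is abstracted to these lists.

Register `0` holds `B`, register `1` the modulus `p`, register `2` the power `2 ^ p`, register `3` the
number that encodes the colours of the positions, register `4` the number of the search, register
`5` the number of an edge or arc, register `6` the key of `x₀`, and the registers `7, …, 12` are for
local use. The registers `20 + 3 * i`, `21 + 3 * i` and `22 + 3 * i` belong to position `i`: they hold
its vertex, its colour and a loop counter. The lists with tag `t = 1` hold the neighbours of the
vertices, those with tag `2` their arcs, and those with larger tags the layers of the searches.
-/


namespace WordRAM

/-! ### Machines whose memory holds lists -/

/-- The number of steps of a program without loops is at most its `size`; for a program with loops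
the size bounds the steps of one passage through the code. -/
def Program.size : Program → ℕ
  | .skip => 1
  | .assign _ e => e.cost + 1
  | .store a e => a.cost + e.cost + 1
  | .emit e => e.cost + 1
  | .seq p q => p.size + q.size
  | .ite e p q => e.cost + 1 + p.size + q.size
  | .loop e p => e.cost + 1 + p.size

/-- The memory cell that holds entry `i` of the list with key `(t, r, u)`, in base `B`. -/
def cell (B t r u i : ℕ) : ℕ := ((t * B + r) * B + u) * B + i

/-- A family of lists indexed by keys `(t, r, u)`. -/
abbrev Store := ℕ → ℕ → ℕ → List ℕ

/-- Append `x` to the list with key `(t, r, u)`. -/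
def Store.push (st : Store) (t r u x : ℕ) : Store := fun t' r' u' =>
  if t' = t ∧ r' = r ∧ u' = u then st t r u ++ [x] else st t' r' u'

/-- The data fixed during a run: the word length `w`, the base `B` of the addresses, and the input,
`len` words `inp 0, …, inp (len - 1)`. -/
structure Machine where
  w : ℕ
  B : ℕ
  len : ℕ
  inp : ℕ → ℕ
  two_le : 2 ≤ B
  len_le : len ≤ B
  pow_le : B ^ 4 ≤ 2 ^ w

namespace Machine

/-- The memory `mem` represents the lists `st`: the cell with index `0` of a key holds the length of
the list, the following ones its entries. The cells below `M.len` still hold the input. -/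
structure Rep (M : Machine) (mem : ℕ → ℕ) (st : Store) : Prop where
  input : ∀ a < M.len, mem a = M.inp a
  length_lt : ∀ t r u, (st t r u).length + 1 < M.B
  count : ∀ t r u, 1 ≤ t → t < M.B → r < M.B → u < M.B →
    mem (cell M.B t r u 0) = (st t r u).length
  item : ∀ t r u, 1 ≤ t → t < M.B → r < M.B → u < M.B → ∀ i (h : i < (st t r u).length),
    mem (cell M.B t r u (i + 1)) = (st t r u)[i]

end Machine

/-- A machine state in which the memory is replaced by the lists it represents. -/
structure AState where
  reg : ℕ → ℕ
  st : Store
  out : List ℕ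

namespace Machine

variable (M : Machine)

/-- In every machine state represented by `a`, the expression `e` has the value `v`. -/
def Evals (e : Expr) (a : AState) (v : ℕ) : Prop :=
  ∀ mem, M.Rep mem a.st → e.eval M.w ⟨a.reg, mem, a.out⟩ = v

/-- The program `P` leads from `a` to `a'` in at most `c` steps. -/
def Runs (P : Program) (a : AState) (c : ℕ) (a' : AState) : Prop :=
  ∀ mem, M.Rep mem a.st → ∃ mem' T, T ≤ c ∧ M.Rep mem' a'.st ∧
    Exec M.w P ⟨a.reg, mem, a.out⟩ T ⟨a'.reg, mem', a'.out⟩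

/-- The program `P`, started in `a`, halts after at most `c` steps in a state with property `Q`. -/
def Tri (P : Program) (a : AState) (c : ℕ) (Q : AState → Prop) : Prop :=
  ∃ a', M.Runs P a c a' ∧ Q a'

variable {M}

theorem lt_two_pow {x : ℕ} (h : x < M.B) : x < 2 ^ M.w :=
  h.trans_le ((Nat.le_self_pow (by norm_num) _).trans M.pow_le)

theorem le_two_pow {x : ℕ} (h : x ≤ M.B) : x < 2 ^ M.w := by
  have h2 := M.two_le
  have : M.B < M.B ^ 4 := by
    calc M.B = M.B ^ 1 := (pow_one _).symm
      _ < M.B ^ 4 := Nat.pow_lt_pow_right (by omega) (by norm_num)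
  exact h.trans_lt (this.trans_le M.pow_le)

/-! ### Values of expressions -/

section eval

variable {a : AState} {e e₁ e₂ : Expr} {x y : ℕ}

theorem Evals.lit {c : ℕ} (h : c < 2 ^ M.w) : M.Evals (.lit c) a c :=
  fun _ _ => Nat.mod_eq_of_lt h

theorem Evals.reg (r : ℕ) : M.Evals (.reg r) a (a.reg r) := fun _ _ => rfl

theorem Evals.reg' {r v : ℕ} (h : a.reg r = v) : M.Evals (.reg r) a v := fun _ _ => h

theorem Evals.add (h₁ : M.Evals e₁ a x) (h₂ : M.Evals e₂ a y) (h : x + y < 2 ^ M.w) :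
    M.Evals (.bin .add e₁ e₂) a (x + y) := fun mem hm => by
  simp only [Expr.eval, h₁ mem hm, h₂ mem hm, Op.apply, Nat.mod_eq_of_lt h]

theorem Evals.mul (h₁ : M.Evals e₁ a x) (h₂ : M.Evals e₂ a y) (h : x * y < 2 ^ M.w) :
    M.Evals (.bin .mul e₁ e₂) a (x * y) := fun mem hm => by
  simp only [Expr.eval, h₁ mem hm, h₂ mem hm, Op.apply, Nat.mod_eq_of_lt h]

theorem Evals.sub (h₁ : M.Evals e₁ a x) (h₂ : M.Evals e₂ a y) (h : x < 2 ^ M.w) :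
    M.Evals (.bin .sub e₁ e₂) a (x - y) := fun mem hm => by
  simp only [Expr.eval, h₁ mem hm, h₂ mem hm, Op.apply,
    Nat.mod_eq_of_lt ((Nat.sub_le x y).trans_lt h)]

theorem Evals.div (h₁ : M.Evals e₁ a x) (h₂ : M.Evals e₂ a y) (h : x < 2 ^ M.w) :
    M.Evals (.bin .div e₁ e₂) a (x / y) := fun mem hm => by
  simp only [Expr.eval, h₁ mem hm, h₂ mem hm, Op.apply,
    Nat.mod_eq_of_lt ((Nat.div_le_self x y).trans_lt h)]

theorem Evals.mod (h₁ : M.Evals e₁ a x) (h₂ : M.Evals e₂ a y) (h : x < 2 ^ M.w) :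
    M.Evals (.bin .mod e₁ e₂) a (x % y) := fun mem hm => by
  simp only [Expr.eval, h₁ mem hm, h₂ mem hm, Op.apply,
    Nat.mod_eq_of_lt ((Nat.mod_le x y).trans_lt h)]

theorem one_lt_two_pow : 1 < 2 ^ M.w := le_two_pow (by have := M.two_le; omega)

theorem Evals.lt (h₁ : M.Evals e₁ a x) (h₂ : M.Evals e₂ a y) :
    M.Evals (.bin .lt e₁ e₂) a (if x < y then 1 else 0) := fun mem hm => by
  simp only [Expr.eval, h₁ mem hm, h₂ mem hm, Op.apply]
  exact Nat.mod_eq_of_lt (by have := one_lt_two_pow (M := M); split_ifs <;> omega)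

theorem Evals.eq (h₁ : M.Evals e₁ a x) (h₂ : M.Evals e₂ a y) :
    M.Evals (.bin .eq e₁ e₂) a (if x = y then 1 else 0) := fun mem hm => by
  simp only [Expr.eval, h₁ mem hm, h₂ mem hm, Op.apply]
  exact Nat.mod_eq_of_lt (by have := one_lt_two_pow (M := M); split_ifs <;> omega)

theorem Evals.input (h : M.Evals e a x) (hx : x < M.len) :
    M.Evals (.load e) a (M.inp x) := fun mem hm => by
  simp only [Expr.eval, h mem hm, hm.input x hx]

theorem Evals.congr {v v' : ℕ} (h : M.Evals e a v) (hv : v = v') : M.Evals e a v' := hv ▸ h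

end eval

/-! ### Addresses -/

theorem cell_lt {B t r u i : ℕ} (ht : t < B) (hr : r < B) (hu : u < B) (hi : i < B) :
    cell B t r u i < B ^ 4 := by
  have key : ∀ x y c : ℕ, x < c → y < B → x * B + y < c * B := fun x y c hx hy => by
    calc x * B + y < x * B + B := by omega
      _ = (x + 1) * B := by ring
      _ ≤ c * B := Nat.mul_le_mul_right _ hx
  have := key _ _ _ (key _ _ _ (key _ _ _ ht hr) hu) hi
  calc cell B t r u i < B * B * B * B := this
    _ = B ^ 4 := by ring

theorem le_cell {B t r u i : ℕ} (hB : 1 ≤ B) (ht : 1 ≤ t) : B ≤ cell B t r u i := by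
  unfold cell
  have h1 : 1 ≤ t * B + r := by nlinarith
  have h2 : 1 ≤ (t * B + r) * B + u := by nlinarith
  nlinarith

theorem cell_inj {B t r u i t' r' u' i' : ℕ} (hr : r < B) (hu : u < B) (hi : i < B)
    (hr' : r' < B) (hu' : u' < B) (hi' : i' < B) (h : cell B t r u i = cell B t' r' u' i') :
    t = t' ∧ r = r' ∧ u = u' ∧ i = i' := by
  have key : ∀ x y x' y' : ℕ, y < B → y' < B → x * B + y = x' * B + y' → x = x' ∧ y = y' := by
    intro x y x' y' hy hy' h
    have hB : 0 < B := by omega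
    have h1 := congrArg (· / B) h
    have h2 := congrArg (· % B) h
    simp only [Nat.mul_add_mod_self_right, Nat.mod_eq_of_lt hy, Nat.mod_eq_of_lt hy'] at h2
    rw [h2] at h
    exact ⟨Nat.eq_of_mul_eq_mul_right hB (by omega), h2⟩
  obtain ⟨h1, h2⟩ := key _ _ _ _ hi hi' h
  obtain ⟨h3, h4⟩ := key _ _ _ _ hu hu' h1
  obtain ⟨h5, h6⟩ := key _ _ _ _ hr hr' h3
  exact ⟨h5, h6, h4, h2⟩

end Machine

/-- The address of entry `i` of the list `(t, r, u)`; the base is kept in register `0`. -/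
def cellE (t : ℕ) (r u i : Expr) : Expr :=
  .bin .add (.bin .mul (.bin .add (.bin .mul (.bin .add (.bin .mul (.lit t) (.reg 0)) r)
    (.reg 0)) u) (.reg 0)) i

/-- The length of the list `(t, r, u)`. -/
def lenE (t : ℕ) (r u : Expr) : Expr := .load (cellE t r u (.lit 0))

/-- Entry `i` of the list `(t, r, u)`. -/
def getE (t : ℕ) (r u i : Expr) : Expr := .load (cellE t r u (.bin .add i (.lit 1)))

/-- Append the value of `e` to the list `(t, r, u)`. -/
def pushP (t : ℕ) (r u e : Expr) : Program :=
  .seq (.store (cellE t r u (.bin .add (lenE t r u) (.lit 1))) e)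
    (.store (cellE t r u (.lit 0)) (.bin .add (lenE t r u) (.lit 1)))

/-- Execute `p` with register `i` running through the numbers below `bound`. -/
def forP (i : ℕ) (bound : Expr) (p : Program) : Program :=
  .seq (.assign i (.lit 0))
    (.loop (.bin .lt (.reg i) bound) (.seq p (.assign i (.bin .add (.reg i) (.lit 1)))))

/-- Execute the programs of a list one after the other. -/
def seqP (l : List Program) : Program := l.foldr .seq .skip

namespace Machine

variable {M : Machine} {a : AState}

theorem Evals.cell {t r u i : ℕ} {er eu ei : Expr} (h0 : a.reg 0 = M.B) (ht : t < M.B)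
    (hr : M.Evals er a r) (hu : M.Evals eu a u) (hi : M.Evals ei a i)
    (hr' : r < M.B) (hu' : u < M.B) (hi' : i < M.B) :
    M.Evals (cellE t er eu ei) a (cell M.B t r u i) := by
  have hc := (cell_lt ht hr' hu' hi').trans_le M.pow_le
  have hB := M.two_le
  unfold WordRAM.cell at hc ⊢
  have h1 : ((t * M.B + r) * M.B + u) * M.B < 2 ^ M.w := by omega
  have h2 : (t * M.B + r) * M.B + u < 2 ^ M.w :=
    (Nat.le_mul_of_pos_right _ (by omega)).trans_lt h1
  have h3 : (t * M.B + r) * M.B < 2 ^ M.w := by omega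
  have h4 : t * M.B + r < 2 ^ M.w := (Nat.le_mul_of_pos_right _ (by omega)).trans_lt h3
  have h5 : t * M.B < 2 ^ M.w := by omega
  exact ((((((Evals.lit (lt_two_pow ht)).mul (.reg' h0) h5).add hr h4).mul (.reg' h0) h3).add hu
    h2).mul (.reg' h0) h1).add hi hc

theorem Evals.len {t r u : ℕ} {er eu : Expr} (h0 : a.reg 0 = M.B) (ht1 : 1 ≤ t) (ht : t < M.B)
    (hr : M.Evals er a r) (hu : M.Evals eu a u) (hr' : r < M.B) (hu' : u < M.B) :
    M.Evals (lenE t er eu) a (a.st t r u).length := fun mem hm => by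
  have hB := M.two_le
  have := Evals.cell h0 ht hr hu (Evals.lit (c := 0) (lt_two_pow (by omega))) hr' hu' (by omega)
  rw [lenE, Expr.eval, this mem hm]
  exact hm.count t r u ht1 ht hr' hu'

theorem Evals.get {t r u i : ℕ} {er eu ei : Expr} (h0 : a.reg 0 = M.B) (ht1 : 1 ≤ t)
    (ht : t < M.B) (hr : M.Evals er a r) (hu : M.Evals eu a u) (hi : M.Evals ei a i)
    (hr' : r < M.B) (hu' : u < M.B) (hi' : i < (a.st t r u).length) :
    M.Evals (getE t er eu ei) a (a.st t r u)[i] := fun mem hm => by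
  have hB := M.two_le
  have hl := hm.length_lt t r u
  have := Evals.cell h0 ht hr hu (hi.add (Evals.lit (c := 1) (lt_two_pow (by omega)))
    (lt_two_pow (by omega))) hr' hu' (by omega)
  rw [getE, Expr.eval, this mem hm]
  exact hm.item t r u ht1 ht hr' hu' i hi'

/-! ### Rules for programs -/

section rules

variable {P P₁ P₂ : Program} {c c₁ c₂ : ℕ} {Q Q' : AState → Prop} {e : Expr} {v : ℕ}

theorem Tri.mono (h : M.Tri P a c₁ Q) (hc : c₁ ≤ c₂) (hQ : ∀ b, Q b → Q' b) :
    M.Tri P a c₂ Q' := by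
  obtain ⟨a', hr, hq⟩ := h
  refine ⟨a', fun mem hm => ?_, hQ _ hq⟩
  obtain ⟨mem', T, hT, h⟩ := hr mem hm
  exact ⟨mem', T, hT.trans hc, h⟩

theorem Tri.cost_le (h : M.Tri P a c₁ Q) (hc : c₁ ≤ c₂) : M.Tri P a c₂ Q := h.mono hc fun _ => id

theorem Tri.skip (h : Q a) : M.Tri .skip a (Program.size .skip) Q :=
  ⟨a, fun mem hm => ⟨mem, 1, le_rfl, hm, .skip _⟩, h⟩

theorem Tri.assign {r : ℕ} (he : M.Evals e a v) (h : Q { a with reg := Function.update a.reg r v }) :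
    M.Tri (.assign r e) a (Program.size (.assign r e)) Q :=
  ⟨{ a with reg := Function.update a.reg r v }, fun mem hm => ⟨mem, _, le_rfl, hm, by
    have := Exec.assign (w := M.w) r e ⟨a.reg, mem, a.out⟩
    rwa [he mem hm] at this⟩, h⟩

theorem Tri.emit (he : M.Evals e a v) (h : Q { a with out := a.out ++ [v] }) :
    M.Tri (.emit e) a (Program.size (.emit e)) Q :=
  ⟨{ a with out := a.out ++ [v] }, fun mem hm => ⟨mem, _, le_rfl, hm, by
    have := Exec.emit (w := M.w) e ⟨a.reg, mem, a.out⟩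
    rwa [he mem hm] at this⟩, h⟩

theorem Tri.seq (h : M.Tri P₁ a c₁ fun b => M.Tri P₂ b c₂ Q) :
    M.Tri (.seq P₁ P₂) a (c₁ + c₂) Q := by
  obtain ⟨a₁, h₁, a₂, h₂, hQ⟩ := h
  refine ⟨a₂, fun mem hm => ?_, hQ⟩
  obtain ⟨mem₁, T₁, hT₁, hm₁, hx₁⟩ := h₁ mem hm
  obtain ⟨mem₂, T₂, hT₂, hm₂, hx₂⟩ := h₂ mem₁ hm₁
  exact ⟨mem₂, _, by omega, hm₂, .seq hx₁ hx₂⟩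

theorem Tri.ite (he : M.Evals e a v) (h₁ : v ≠ 0 → M.Tri P₁ a c Q)
    (h₂ : v = 0 → M.Tri P₂ a c Q) : M.Tri (.ite e P₁ P₂) a (e.cost + 1 + c) Q := by
  by_cases hv : v = 0
  · obtain ⟨a', h, hQ⟩ := h₂ hv
    refine ⟨a', fun mem hm => ?_, hQ⟩
    obtain ⟨mem', T, hT, hm', hx⟩ := h mem hm
    exact ⟨mem', _, by omega, hm', .ite_false ((he mem hm).trans hv) hx⟩
  · obtain ⟨a', h, hQ⟩ := h₁ hv
    refine ⟨a', fun mem hm => ?_, hQ⟩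
    obtain ⟨mem', T, hT, hm', hx⟩ := h mem hm
    exact ⟨mem', _, by omega, hm', .ite_true (by rwa [he mem hm]) hx⟩

/-- A loop with exactly `N` passages: `Inv t` is the invariant after `t` of them, and `c t` bounds the
steps of the body in the next one. -/
theorem Tri.loop (N : ℕ) (c : ℕ → ℕ) (Inv : ℕ → AState → Prop) (h0 : Inv 0 a)
    (hcond : ∀ t b, t ≤ N → Inv t b → ∃ v, M.Evals e b v ∧ (v ≠ 0 ↔ t < N))
    (step : ∀ t b, t < N → Inv t b → M.Tri P b (c t) (Inv (t + 1))) :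
    M.Tri (.loop e P) a (∑ t ∈ Finset.range N, (c t + (e.cost + 1)) + (e.cost + 1)) (Inv N) := by
  have key : ∀ d t b, t + d = N → Inv t b →
      M.Tri (.loop e P) b (∑ i ∈ Finset.range d, (c (t + i) + (e.cost + 1)) + (e.cost + 1))
        (Inv N) := by
    intro d
    induction d with
    | zero =>
      intro t b ht hb
      obtain ⟨v, hv, hv'⟩ := hcond t b (by omega) hb
      have hv0 : v = 0 := by by_contra h; have := hv'.1 h; omega
      refine ⟨b, fun mem hm => ⟨mem, _, ?_, hm, .loop_false ((hv mem hm).trans hv0)⟩, ?_⟩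
      · simp
      · simpa [← ht] using hb
    | succ d ih =>
      intro t b ht hb
      obtain ⟨v, hv, hv'⟩ := hcond t b (by omega) hb
      obtain ⟨b₁, h₁, hI₁⟩ := step t b (by omega) hb
      obtain ⟨b₂, h₂, hI₂⟩ := ih (t + 1) b₁ (by omega) hI₁
      refine ⟨b₂, fun mem hm => ?_, hI₂⟩
      obtain ⟨mem₁, T₁, hT₁, hm₁, hx₁⟩ := h₁ mem hm
      obtain ⟨mem₂, T₂, hT₂, hm₂, hx₂⟩ := h₂ mem₁ hm₁
      refine ⟨mem₂, _, ?_, hm₂,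
        .loop_true (by rw [hv mem hm]; exact hv'.2 (by omega)) hx₁ hx₂⟩
      rw [Finset.sum_range_succ']
      have : ∀ i, t + 1 + i = t + (i + 1) := fun i => by omega
      simp only [this] at hT₂
      simp only [add_zero]
      omega
  have := key N 0 a (by omega) h0
  simpa using this

/-- The `for` loop: `Inv t` is the invariant before the passage with counter `t`. -/
theorem Tri.for {i : ℕ} {bound : Expr} (N : ℕ) (c : ℕ → ℕ) (Inv : ℕ → AState → Prop)
    (hN : N < 2 ^ M.w) (h0 : Inv 0 { a with reg := Function.update a.reg i 0 })
    (hcond : ∀ t b, t ≤ N → b.reg i = t → Inv t b → M.Evals bound b N)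
    (step : ∀ t b, t < N → b.reg i = t → Inv t b → M.Tri P b (c t) fun b' => b'.reg i = t ∧
      Inv (t + 1) { b' with reg := Function.update b'.reg i (t + 1) }) :
    M.Tri (forP i bound P) a
      (∑ t ∈ Finset.range N, (c t + (bound.cost + 7)) + (bound.cost + 5)) (Inv N) := by
  have h := Tri.loop (M := M) (e := .bin .lt (.reg i) bound)
    (P := .seq P (.assign i (.bin .add (.reg i) (.lit 1)))) (a := { a with reg := Function.update a.reg i 0 })
    N (fun t => c t + 4) (fun t b => b.reg i = t ∧ Inv t b) ⟨by simp, h0⟩ ?_ ?_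
  · refine (Tri.seq (Tri.assign (Evals.lit (by positivity)) (h.mono le_rfl fun b hb => hb.2))).cost_le ?_
    simp only [Program.size, Expr.cost]
    have : ∀ t, c t + 4 + (1 + bound.cost + 1 + 1) = c t + (bound.cost + 7) := fun t => by omega
    simp only [this]
    omega
  · rintro t b ht ⟨hi, hb⟩
    refine ⟨_, (Evals.reg' hi).lt (hcond t b ht hi hb), ?_⟩
    split_ifs <;> simp [*]
  · rintro t b ht ⟨hi, hb⟩
    refine Tri.seq ((step t b ht hi hb).mono le_rfl ?_)
    rintro b' ⟨hi', hb'⟩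
    refine (Tri.assign ((Evals.reg' hi').add (Evals.lit one_lt_two_pow) (by omega)) ?_)
    exact ⟨by simp, hb'⟩

/-- Appending to a list means writing the new entry and then the new length. No other list is
affected, since distinct keys and indices have distinct addresses. -/
theorem Rep.push {mem : ℕ → ℕ} {st : Store} {t r u x : ℕ} (hm : M.Rep mem st) (ht1 : 1 ≤ t)
    (hr' : r < M.B) (hu' : u < M.B)
    (hl : (st t r u).length + 2 < M.B) :
    M.Rep (Function.update (Function.update mem (WordRAM.cell M.B t r u ((st t r u).length + 1)) x)
      (WordRAM.cell M.B t r u 0) ((st t r u).length + 1)) (st.push t r u x) := by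
  have hB := M.two_le
  refine ⟨fun b hb => ?_, fun t' r' u' => ?_, fun t' r' u' h1 h2 h3 h4 => ?_,
    fun t' r' u' h1 h2 h3 h4 i hi => ?_⟩
  · have hne : ∀ i, b ≠ WordRAM.cell M.B t r u i := fun i h => by
      have := le_cell (B := M.B) (t := t) (r := r) (u := u) (i := i) (by omega) ht1
      have := M.len_le
      omega
    rw [Function.update_of_ne (hne _), Function.update_of_ne (hne _), hm.input b hb]
  · unfold Store.push
    split_ifs with h
    · simp; omega
    · exact hm.length_lt t' r' u'
  · by_cases h : t' = t ∧ r' = r ∧ u' = u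
    · obtain ⟨rfl, rfl, rfl⟩ := h
      simp [Store.push]
    · have hne : ∀ i, i < M.B →
          WordRAM.cell M.B t' r' u' 0 ≠ WordRAM.cell M.B t r u i := fun i hi he => by
        have := cell_inj h3 h4 (by omega) hr' hu' hi he
        tauto
      rw [Function.update_of_ne (hne _ (by omega)), Function.update_of_ne (hne _ (by omega)),
        hm.count t' r' u' h1 h2 h3 h4, Store.push, if_neg h]
  · by_cases h : t' = t ∧ r' = r ∧ u' = u
    · obtain ⟨rfl, rfl, rfl⟩ := h
      simp only [Store.push, and_self, if_true, List.length_append, List.length_singleton] at hi ⊢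
      rw [Function.update_of_ne]
      · by_cases hil : i = (st t' r' u').length
        · subst hil
          simp
        · rw [Function.update_of_ne, hm.item t' r' u' h1 h2 h3 h4 i (by omega),
            List.getElem_append_left]
          intro he
          have := cell_inj hr' hu' (by omega) hr' hu' (by omega) he
          omega
      · intro he
        have := cell_inj hr' hu' (by omega) hr' hu' (by omega) he
        omega
    · have hi' : i < (st t' r' u').length := by simpa [Store.push, h] using hi
      have := hm.length_lt t' r' u'
      have hne : ∀ j, j < M.B →
          WordRAM.cell M.B t' r' u' (i + 1) ≠ WordRAM.cell M.B t r u j := fun j hj he => by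
        have := cell_inj h3 h4 (by omega) hr' hu' hj he
        tauto
      rw [Function.update_of_ne (hne _ (by omega)), Function.update_of_ne (hne _ (by omega)),
        hm.item t' r' u' h1 h2 h3 h4 i hi']
      simp only [Store.push, if_neg h]

theorem Tri.push {t r u x : ℕ} {er eu : Expr} (h0 : a.reg 0 = M.B) (ht1 : 1 ≤ t) (ht : t < M.B)
    (hr : M.Evals er a r) (hu : M.Evals eu a u) (he : M.Evals e a x)
    (hr' : r < M.B) (hu' : u < M.B) (hl : (a.st t r u).length + 2 < M.B)
    (h : Q { a with st := a.st.push t r u x }) :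
    M.Tri (pushP t er eu e) a (pushP t er eu e).size Q := by
  have hB := M.two_le
  have hlen := Evals.len h0 ht1 ht hr hu hr' hu'
  have hlen1 := hlen.add (Evals.lit one_lt_two_pow) (lt_two_pow (by omega))
  refine ⟨_, fun mem hm => ?_, h⟩
  have h1 := Exec.store (w := M.w) (cellE t er eu (.bin .add (lenE t er eu) (.lit 1))) e
    ⟨a.reg, mem, a.out⟩
  rw [(Evals.cell h0 ht hr hu hlen1 hr' hu' (by omega)) mem hm, he mem hm] at h1
  set mem₁ := Function.update mem (WordRAM.cell M.B t r u ((a.st t r u).length + 1)) x with hmem₁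
  -- the first store writes beyond the end of the list, so the same lists are represented
  have hm₁ : M.Rep mem₁ a.st := by
    refine ⟨fun b hb => ?_, hm.length_lt, fun t' r' u' h1 h2 h3 h4 => ?_,
      fun t' r' u' h1 h2 h3 h4 i hi => ?_⟩
    · rw [hmem₁, Function.update_of_ne, hm.input b hb]
      intro h
      have := le_cell (B := M.B) (t := t) (r := r) (u := u) (i := (a.st t r u).length + 1)
        (by omega) ht1
      have := M.len_le
      omega
    · rw [hmem₁, Function.update_of_ne, hm.count t' r' u' h1 h2 h3 h4]
      intro he
      have := cell_inj h3 h4 (by omega) hr' hu' (by omega) he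
      omega
    · rw [hmem₁, Function.update_of_ne, hm.item t' r' u' h1 h2 h3 h4 i hi]
      intro he
      have := hm.length_lt t' r' u'
      obtain ⟨rfl, rfl, rfl, h'⟩ := cell_inj h3 h4 (by omega) hr' hu' (by omega) he
      omega
  have h2 := Exec.store (w := M.w) (cellE t er eu (.lit 0)) (.bin .add (lenE t er eu) (.lit 1))
    ⟨a.reg, mem₁, a.out⟩
  rw [(Evals.cell h0 ht hr hu (Evals.lit (c := 0) (by positivity)) hr' hu' (by omega)) mem₁ hm₁,
    hlen1 mem₁ hm₁] at h2
  exact ⟨_, _, le_rfl, hm.push (x := x) ht1 hr' hu' hl, Exec.seq h1 h2⟩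

/-- Any list of programs, each of which can be run within its size from any state that the previous
ones may leave. -/
theorem Tri.seqP {l : List Program} (Inv : ℕ → AState → Prop) (h0 : Inv 0 a)
    (step : ∀ i (h : i < l.length) b, Inv i b → M.Tri l[i] b l[i].size (Inv (i + 1))) :
    M.Tri (seqP l) a (seqP l).size (Inv l.length) := by
  induction l generalizing a Inv with
  | nil => exact Tri.skip h0
  | cons p l ih =>
    refine Tri.seq ((step 0 (by simp) a h0).mono le_rfl fun b hb => ?_)
    exact ih (fun i => Inv (i + 1)) hb fun i hi b hb => step (i + 1) (by simpa using hi) b hb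

end rules

end Machine

end WordRAM

namespace WordRAM

/-! ### Loops over lists -/

theorem sum_range_getD (l : List ℕ) (g : ℕ → ℕ) :
    ∑ t ∈ Finset.range l.length, g (l.getD t 0) = (l.map g).sum := by
  induction l using List.reverseRecOn with
  | nil => simp
  | append_singleton l x ih =>
    rw [List.length_append, List.length_singleton, Finset.sum_range_succ, List.map_append,
      List.sum_append, ← ih]
    congr 1
    · refine Finset.sum_congr rfl fun t ht => ?_
      rw [List.getD_append _ _ _ _ (Finset.mem_range.1 ht)]
    · simp

namespace Machine

variable {M : Machine} {a : AState}

/-- A loop over the entries of a list `l`: the invariant depends on the part already treated. -/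
theorem Tri.forList {P : Program} {i : ℕ} {bound : Expr} (l : List ℕ) (c : ℕ → ℕ)
    (Inv : List ℕ → AState → Prop) (hN : l.length < 2 ^ M.w)
    (h0 : Inv [] { a with reg := Function.update a.reg i 0 })
    (hcond : ∀ pre b, pre <+: l → b.reg i = pre.length → Inv pre b → M.Evals bound b l.length)
    (step : ∀ pre x post b, l = pre ++ x :: post → b.reg i = pre.length → Inv pre b →
      M.Tri P b (c x) fun b' => b'.reg i = pre.length ∧
        Inv (pre ++ [x]) { b' with reg := Function.update b'.reg i (pre.length + 1) }) :
    M.Tri (forP i bound P) a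
      ((l.map fun x => c x + (bound.cost + 7)).sum + (bound.cost + 5)) (Inv l) := by
  have h := Tri.for (M := M) (a := a) (P := P) (i := i) (bound := bound) l.length
    (fun t => c (l.getD t 0)) (fun t b => Inv (l.take t) b) hN (by simpa using h0) ?_ ?_
  · rw [sum_range_getD l fun x => c x + (bound.cost + 7)] at h
    simpa using h
  · intro t b ht hi hb
    exact hcond _ b (List.take_prefix _ _) (by simp [hi, ht]) hb
  · intro t b ht hi hb
    have hl : l = l.take t ++ l[t] :: l.drop (t + 1) := by simp
    have hlen : (l.take t).length = t := by simp; omega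
    have hs := step (l.take t) l[t] (l.drop (t + 1)) b hl (by rw [hi, hlen]) hb
    rw [hlen] at hs
    rw [List.getD_eq_getElem _ _ ht]
    refine hs.mono le_rfl ?_
    rintro b' ⟨h1, h2⟩
    refine ⟨h1, ?_⟩
    rwa [List.take_add_one, List.getElem?_eq_getElem ht, Option.toList_some]

end Machine

end WordRAM

namespace EvenCycles

open WordRAM Machine

/-! ### Breadth-first search -/

/-- The number of neighbours of the vertex `e`. -/
def degE (e : Expr) : Expr := lenE 1 (.lit 0) e

/-- One layer of breadth-first search from the vertex in register `20`, in the run with the number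
in register `4`. For every vertex `v` in the list `tq` and every neighbour `u` of `v` that satisfies
`cond`, `v` is appended to the list `tf` of `u`, and `u` is appended to the list `tq'` when it is met
for the first time. -/
def bfsStep (tq tq' tf : ℕ) (cond : Expr) : Program :=
  forP 7 (lenE tq (.reg 4) (.reg 20)) <|
    .seq (.assign 9 (getE tq (.reg 4) (.reg 20) (.reg 7))) <|
    forP 8 (degE (.reg 9)) <|
      .seq (.assign 10 (getE 1 (.lit 0) (.reg 9) (.reg 8))) <|
      .ite cond
        (.seq (.ite (lenE tf (.reg 4) (.reg 10)) .skip (pushP tq' (.reg 4) (.reg 20) (.reg 10)))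
          (pushP tf (.reg 4) (.reg 10) (.reg 9)))
        .skip

/-- The registers that the breadth-first search does not use are the same. -/
def SameRegs (a b : AState) : Prop := ∀ r, r < 7 ∨ 20 ≤ r → b.reg r = a.reg r

/-- The lists are the same, except those with tag `tq` or `tf` of the given run. -/
def SameLists (tq tf run : ℕ) (a b : AState) : Prop :=
  ∀ t r u, ¬ ((t = tq ∨ t = tf) ∧ r = run) → b.st t r u = a.st t r u

/-- The state of the breadth-first search after the arcs `ps` out of the last layer. -/
structure BfsInv (tq tf run x₀ : ℕ) (ok : ℕ → Prop) [DecidablePred ok] (a : AState)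
    (ps : List (ℕ × ℕ)) (b : AState) : Prop where
  regs : SameRegs a b
  lists : SameLists tq tf run a b
  out : b.out = a.out
  pred : ∀ u, b.st tf run u = if ok u then (ps.filter (·.2 = u)).map Prod.fst else []
  nodup : (b.st tq run x₀).Nodup
  mem : ∀ u, u ∈ b.st tq run x₀ ↔ b.st tf run u ≠ []

variable {M : Machine} {a : AState}

theorem BfsInv.update {tq tf run x₀ : ℕ} {ok : ℕ → Prop} [DecidablePred ok]
    {ps : List (ℕ × ℕ)} {b : AState} (h : BfsInv tq tf run x₀ ok a ps b) {r v : ℕ}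
    (hr : 7 ≤ r) (hr' : r < 20) :
    BfsInv tq tf run x₀ ok a ps { b with reg := Function.update b.reg r v } := by
  refine ⟨fun r' hr'' => ?_, h.lists, h.out, h.pred, h.nodup, h.mem⟩
  rw [← h.regs r' hr'']
  exact Function.update_of_ne (by omega) _ _

theorem list_length_le_of_nodup {l : List ℕ} {n : ℕ} (h : l.Nodup) (hl : ∀ x ∈ l, x < n) :
    l.length ≤ n := by
  have : l.toFinset ⊆ Finset.range n := fun x hx => by simpa using hl x (by simpa using hx)
  simpa [List.toFinset_card_of_nodup h] using Finset.card_le_card this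

/-- A layer of breadth-first search takes time proportional to the number of vertices of the last
layer plus the sum of their degrees, and records for every vertex of the new layer its neighbours in
the last one. -/
theorem Tri.bfsStep {tq tq' tf : ℕ} {cond : Expr} {n run x₀ : ℕ} {nb : ℕ → List ℕ}
    {ok : ℕ → Prop} [DecidablePred ok]
    (h0 : a.reg 0 = M.B) (h4 : a.reg 4 = run) (h20 : a.reg 20 = x₀)
    (htq : 2 ≤ tq) (htq' : 2 ≤ tq') (htf : 2 ≤ tf) (hB : tq < M.B) (hB' : tq' < M.B)
    (hBf : tf < M.B) (hne : tq ≠ tq') (hne' : tq ≠ tf) (hne'' : tq' ≠ tf)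
    (hrun : run < M.B) (hx₀ : x₀ < n) (hn : n * n + n + 2 < M.B)
    (hst : ∀ v < n, a.st 1 0 v = nb v) (hnd : ∀ v, (nb v).Nodup) (hnb : ∀ v, ∀ u ∈ nb v, u < n)
    (hQ : (a.st tq run x₀).Nodup) (hQn : ∀ v ∈ a.st tq run x₀, v < n)
    (hq' : a.st tq' run x₀ = []) (hf : ∀ u, a.st tf run u = [])
    (hcond : ∀ b v, SameRegs a b → SameLists tq' tf run a b → b.reg 10 ∈ nb v → v < n →
      ∃ z, M.Evals cond b z ∧ (z ≠ 0 ↔ ok (b.reg 10))) :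
    M.Tri (bfsStep tq tq' tf cond) a ((bfsStep tq tq' tf cond).size *
      (1 + ((a.st tq run x₀).map fun v => 1 + (nb v).length).sum)) fun b =>
      SameRegs a b ∧ SameLists tq' tf run a b ∧ b.out = a.out ∧
      (∀ u, (b.st tf run u).Nodup) ∧
      (∀ u v, v ∈ b.st tf run u ↔ ok u ∧ v ∈ a.st tq run x₀ ∧ u ∈ nb v) ∧
      (b.st tq' run x₀).Nodup ∧ (∀ u, u ∈ b.st tq' run x₀ ↔ b.st tf run u ≠ []) := by
  set Q := a.st tq run x₀ with hQdef
  set full : List ℕ → List (ℕ × ℕ) := fun l => l.flatMap fun v => (nb v).map fun u => (v, u)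
    with hfull
  have hlen_full : ∀ l : List ℕ, (full l).length ≤ l.length * n := by
    intro l
    induction l with
    | nil => simp [hfull]
    | cons v l ih =>
      simp only [hfull, List.flatMap_cons, List.length_append, List.length_map,
        List.length_cons] at ih ⊢
      have := list_length_le_of_nodup (hnd v) (hnb v)
      nlinarith
  have hQlen : Q.length ≤ n := list_length_le_of_nodup hQ hQn
  set bodyIn : Program := .seq (.assign 10 (getE 1 (.lit 0) (.reg 9) (.reg 8))) <|
      .ite cond
        (.seq (.ite (lenE tf (.reg 4) (.reg 10)) .skip (pushP tq' (.reg 4) (.reg 20) (.reg 10)))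
          (pushP tf (.reg 4) (.reg 10) (.reg 9)))
        .skip with hbodyIn
  have hreg : ∀ ps b, BfsInv tq' tf run x₀ ok a ps b →
      b.reg 0 = M.B ∧ b.reg 4 = run ∧ b.reg 20 = x₀ := fun ps b hb =>
    ⟨(hb.regs 0 (by omega)).trans h0, (hb.regs 4 (by omega)).trans h4,
      (hb.regs 20 (by omega)).trans h20⟩
  have hstb : ∀ ps b, BfsInv tq' tf run x₀ ok a ps b → ∀ v < n, b.st 1 0 v = nb v :=
    fun ps b hb v hv => (hb.lists 1 0 v (by omega)).trans (hst v hv)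
  have hmem : ∀ ps b, BfsInv tq' tf run x₀ ok a ps b →
      ∀ u, b.st tf run u ≠ [] → ok u ∧ ∃ v, (v, u) ∈ ps := by
    intro ps b hb u hu
    rw [hb.pred] at hu
    split_ifs at hu with h
    · refine ⟨h, ?_⟩
      obtain ⟨x, hx⟩ := List.exists_mem_of_ne_nil _ hu
      obtain ⟨y, hy, rfl⟩ := List.mem_map.1 hx
      obtain ⟨hy1, hy2⟩ := List.mem_filter.1 hy
      exact ⟨y.1, by simp only [decide_eq_true_eq] at hy2; rw [← hy2]; exact hy1⟩
    · exact absurd rfl hu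
  -- one arc `(v, u)`
  have hin : ∀ pre v post pre' u post' b, Q = pre ++ v :: post → nb v = pre' ++ u :: post' →
      b.reg 9 = v → b.reg 8 = pre'.length →
      BfsInv tq' tf run x₀ ok a (full pre ++ pre'.map fun u => (v, u)) b →
      M.Tri bodyIn b bodyIn.size fun b' =>
        b'.reg 7 = b.reg 7 ∧ b'.reg 8 = pre'.length ∧ b'.reg 9 = v ∧
        BfsInv tq' tf run x₀ ok a (full pre ++ (pre' ++ [u]).map fun u => (v, u)) b' := by
    intro pre v post pre' u post' b hpre hpre' h9 h8 hb
    obtain ⟨hb0, hb4, hb20⟩ := hreg _ _ hb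
    have hv : v < n := hQn v (by rw [hpre]; simp)
    have hu : u ∈ nb v := by rw [hpre']; simp
    have hun := hnb v u hu
    have hps : ∀ p ∈ full pre ++ pre'.map fun u => (v, u), p.1 < n ∧ p.2 ∈ nb p.1 := by
      intro p hp
      simp only [hfull, List.mem_append, List.mem_flatMap, List.mem_map] at hp
      rcases hp with ⟨v', hv', u', hu', rfl⟩ | ⟨u', hu', rfl⟩
      · exact ⟨hQn v' (by rw [hpre]; simp [hv']), hu'⟩
      · exact ⟨hv, by rw [hpre']; simp [hu']⟩
    have hpslen : (full pre ++ pre'.map fun u => (v, u)).length ≤ n * n := by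
      have h1 := hlen_full Q
      have h2 : (full Q).length = (full pre).length + (nb v).length + (full post).length := by
        simp [hfull, hpre, add_assoc]
      have h3 : pre'.length ≤ (nb v).length := by rw [hpre']; simp
      rw [List.length_append, List.length_map]
      nlinarith
    have hget : M.Evals (getE 1 (.lit 0) (.reg 9) (.reg 8)) b u := by
      have hl := hstb _ _ hb v hv
      have hlt : pre'.length < (b.st 1 0 v).length := by rw [hl, hpre']; simp
      refine (Evals.get hb0 le_rfl (by omega) (Evals.lit (by positivity)) (.reg' h9) (.reg' h8)
        (by omega) (by omega) hlt).congr ?_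
      simp [hl, hpre']
    set b₁ : AState := { b with reg := Function.update b.reg 10 u } with hb₁def
    have hb₁ : BfsInv tq' tf run x₀ ok a (full pre ++ pre'.map fun u => (v, u)) b₁ :=
      hb.update (by norm_num) (by norm_num)
    obtain ⟨hc0, hc4, hc20⟩ := hreg _ _ hb₁
    have hc10 : b₁.reg 10 = u := by simp [hb₁def]
    have hc9 : b₁.reg 9 = v := by simp [hb₁def, h9]
    have hc7 : b₁.reg 7 = b.reg 7 := by simp [hb₁def]
    have hc8 : b₁.reg 8 = pre'.length := by simp [hb₁def, h8]
    obtain ⟨z, hz, hzok⟩ := hcond b₁ v hb₁.regs hb₁.lists (by rwa [hc10]) hv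
    rw [hc10] at hzok
    have hsz : bodyIn.size = (Program.assign 10 (getE 1 (.lit 0) (.reg 9) (.reg 8))).size +
        (cond.cost + 1 + (((lenE tf (.reg 4) (.reg 10)).cost + 1 + (Program.skip.size +
          (pushP tq' (.reg 4) (.reg 20) (.reg 10)).size)) +
          (pushP tf (.reg 4) (.reg 10) (.reg 9)).size + Program.skip.size)) := by
      simp only [hbodyIn, Program.size]
      omega
    rw [hsz]
    refine Tri.seq (Tri.assign hget (Tri.ite hz (fun hz' => ?_) (fun hz' => ?_)))
    · have hok := hzok.1 hz'
      -- the state after the queue is updated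
      refine (Tri.seq (c₂ := (pushP tf (.reg 4) (.reg 10) (.reg 9)).size) (Tri.ite
        (c := Program.skip.size + (pushP tq' (.reg 4) (.reg 20) (.reg 10)).size)
        (Evals.len hc0 (by omega) hBf (.reg' hc4) (.reg' hc10) hrun (by omega)) (fun hl => ?_)
        (fun hl => ?_))).cost_le (by omega)
      rotate_left
      all_goals
        have hfl : (b₁.st tf run u).length ≤ n * n := by
          rw [hb₁.pred, if_pos hok, List.length_map]
          exact (List.length_filter_le _ _).trans hpslen
        have hpred' : ∀ u', (if u' = u then b₁.st tf run u ++ [v] else b₁.st tf run u') =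
            if ok u' then ((full pre ++ (pre' ++ [u]).map fun u => (v, u)).filter
              (·.2 = u')).map Prod.fst else [] := by
          intro u'
          by_cases huu : u' = u
          · subst huu
            rw [if_pos rfl, if_pos hok, hb₁.pred, if_pos hok]
            simp
          · rw [if_neg huu, hb₁.pred]
            have : ¬ u = u' := fun h => huu h.symm
            simp [this]
      · have hnil : b₁.st tf run u = [] := List.length_eq_zero_iff.1 hl
        have hq : (b₁.st tq' run x₀).length ≤ n := by
          refine list_length_le_of_nodup hb₁.nodup fun w hw => ?_
          obtain ⟨-, v', hv'⟩ := hmem _ _ hb₁ w ((hb₁.mem w).1 hw)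
          exact hnb v' w (hps _ hv').2
        refine (Tri.push hc0 (by omega) hB' (.reg' hc4) (.reg' hc20) (.reg' hc10) hrun (by omega)
          (by omega) ?_).cost_le (by omega)
        refine Tri.push hc0 (by omega) hBf (.reg' hc4) (.reg' hc10) (.reg' hc9) hrun (by omega)
          ?_ ?_
        · simp only [Store.push, hne''.symm, false_and, if_false]; omega
        · have hF : ∀ u', ((b₁.st.push tq' run x₀ u).push tf run u v) tf run u' =
              if u' = u then b₁.st tf run u ++ [v] else b₁.st tf run u' := by
            intro u'
            simp [Store.push, hne''.symm]
          have hQ' : ((b₁.st.push tq' run x₀ u).push tf run u v) tq' run x₀ =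
              b₁.st tq' run x₀ ++ [u] := by
            simp [Store.push, hne'']
          refine ⟨hc7, hc8, hc9, hb₁.regs, fun t r w htr => ?_, hb₁.out, fun u' => ?_, ?_, fun u' => ?_⟩
          · rw [← hb₁.lists t r w htr]
            have h1 : ¬ (t = tf ∧ r = run ∧ w = u) := by tauto
            have h2 : ¬ (t = tq' ∧ r = run ∧ w = x₀) := by tauto
            simp [Store.push, h1, h2]
          · exact (hF u').trans (hpred' u')
          · change (((b₁.st.push tq' run x₀ u).push tf run u v) tq' run x₀).Nodup
            rw [hQ', List.nodup_append]
            refine ⟨hb₁.nodup, by simp, ?_⟩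
            intro x hx y hy hxy
            rw [List.mem_singleton] at hy
            subst hxy hy
            exact (hb₁.mem _).1 hx hnil
          · change u' ∈ ((b₁.st.push tq' run x₀ u).push tf run u v) tq' run x₀ ↔
              ((b₁.st.push tq' run x₀ u).push tf run u v) tf run u' ≠ []
            rw [hQ', hF, List.mem_append, hb₁.mem]
            by_cases huu : u' = u <;> simp [huu]
      · refine (Tri.skip ?_).cost_le (by omega)
        refine Tri.push hc0 (by omega) hBf (.reg' hc4) (.reg' hc10) (.reg' hc9) hrun (by omega)
          (by omega) ?_
        have hnil : b₁.st tf run u ≠ [] := fun h => hl (by rw [h]; rfl)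
        have hF : ∀ u', (b₁.st.push tf run u v) tf run u' =
            if u' = u then b₁.st tf run u ++ [v] else b₁.st tf run u' := by
          intro u'
          simp [Store.push]
        have hQ' : (b₁.st.push tf run u v) tq' run x₀ = b₁.st tq' run x₀ := by
          simp [Store.push, hne'']
        refine ⟨hc7, hc8, hc9, hb₁.regs, fun t r w htr => ?_, hb₁.out, fun u' => ?_, ?_, fun u' => ?_⟩
        · rw [← hb₁.lists t r w htr]
          have h1 : ¬ (t = tf ∧ r = run ∧ w = u) := by tauto
          simp [Store.push, h1]
        · exact (hF u').trans (hpred' u')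
        · change ((b₁.st.push tf run u v) tq' run x₀).Nodup
          rw [hQ']
          exact hb₁.nodup
        · change u' ∈ (b₁.st.push tf run u v) tq' run x₀ ↔ (b₁.st.push tf run u v) tf run u' ≠ []
          rw [hQ', hF, hb₁.mem]
          by_cases huu : u' = u <;> simp [huu, hnil]
    · have hok : ¬ ok u := fun h => hzok.2 h hz'
      refine (Tri.skip ?_).cost_le (by simp only [Program.size]; omega)
      refine ⟨hc7, hc8, hc9, hb₁.regs, hb₁.lists, hb₁.out, fun u' => ?_, hb₁.nodup, hb₁.mem⟩
      rw [hb₁.pred]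
      by_cases hu' : ok u'
      · have : ¬ u = u' := fun h => hok (h ▸ hu')
        simp [this]
      · simp [hu']
  have hK : (EvenCycles.bfsStep tq tq' tf cond).size =
      2 + ((lenE tq (.reg 4) (.reg 20)).cost + 2 + 1 + ((Program.assign 9 (getE tq (.reg 4)
        (.reg 20) (.reg 7))).size + (2 + ((degE (.reg 9)).cost + 2 + 1 + (bodyIn.size + 4))) + 4))
      := by
    simp only [EvenCycles.bfsStep, forP, Program.size, Expr.cost, hbodyIn]
    omega
  set K := (EvenCycles.bfsStep tq tq' tf cond).size with hKdef
  refine Tri.mono (Tri.forList (M := M) Q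
    (fun v => (Program.assign 9 (getE tq (.reg 4) (.reg 20) (.reg 7))).size +
      (((nb v).map fun _ => bodyIn.size + ((degE (.reg 9)).cost + 7)).sum +
        ((degE (.reg 9)).cost + 5)))
    (fun pre b => BfsInv tq' tf run x₀ ok a (full pre) b) (lt_two_pow (by omega)) ?_ ?_ ?_)
    (c₂ := K * (1 + (Q.map fun v => 1 + (nb v).length).sum)) ?_ ?_
  · refine ⟨fun r hr => Function.update_of_ne (by omega) _ _, fun _ _ _ _ => rfl, rfl, fun u => ?_,
      ?_, fun u => ?_⟩
    · simp [hfull, hf]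
    · simp [hq']
    · simp [hq', hf]
  · intro pre b _ hi hb
    obtain ⟨hb0, hb4, hb20⟩ := hreg _ _ hb
    refine (Evals.len hb0 (by omega) hB (.reg' hb4) (.reg' hb20) hrun (by omega)).congr ?_
    rw [hb.lists tq run x₀ (by tauto)]
  · intro pre v post b hpre hi hb
    obtain ⟨hb0, hb4, hb20⟩ := hreg _ _ hb
    have hv : v < n := hQn v (by rw [hpre]; simp)
    have hl : b.st tq run x₀ = Q := hb.lists tq run x₀ (by tauto)
    have hlt : pre.length < (b.st tq run x₀).length := by rw [hl, hpre]; simp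
    refine Tri.seq (Tri.assign ((Evals.get hb0 (by omega) hB (.reg' hb4) (.reg' hb20) (.reg' hi)
      hrun (by omega) hlt).congr (show _ = v by simp [hl, hpre])) ?_)
    refine Tri.mono (Tri.forList (M := M) (nb v) (fun _ => bodyIn.size)
      (fun pre' b => b.reg 7 = pre.length ∧ b.reg 9 = v ∧
        BfsInv tq' tf run x₀ ok a (full pre ++ pre'.map fun u => (v, u)) b) ?_ ?_ ?_ ?_) le_rfl ?_
    · have := list_length_le_of_nodup (hnd v) (hnb v)
      exact lt_two_pow (by omega)
    · refine ⟨by simp [hi], by simp, ?_⟩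
      have := (hb.update (r := 9) (v := v) (by norm_num) (by norm_num)).update (r := 8) (v := 0)
        (by norm_num) (by norm_num)
      simpa using this
    · rintro pre' b' _ h8 ⟨h7, h9, hb'⟩
      refine (Evals.len (hreg _ _ hb').1 le_rfl (by omega) (.lit (by positivity)) (.reg' h9)
        (by omega) (by omega)).congr ?_
      rw [hstb _ _ hb' v hv]
    · rintro pre' u post' b' hpre' h8 ⟨h7, h9, hb'⟩
      refine (hin pre v post pre' u post' b' hpre hpre' h9 h8 hb').mono le_rfl ?_
      rintro b'' ⟨h7', h8', h9', hb''⟩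
      exact ⟨h8', by simp [h7', h7], by simp [h9'], hb''.update (by norm_num) (by norm_num)⟩
    · rintro b' ⟨h7, h9, hb'⟩
      refine ⟨h7, ?_⟩
      have := hb'.update (r := 7) (v := pre.length + 1) (by norm_num) (by norm_num)
      simpa [hfull] using this
  · have : ∀ (l : List ℕ) , (l.map fun _ => bodyIn.size + ((degE (.reg 9)).cost + 7)).sum =
        l.length * (bodyIn.size + ((degE (.reg 9)).cost + 7)) := fun l => by simp
    simp only [this]
    have hstep : ∀ l : List ℕ, (l.map fun v => (Program.assign 9 (getE tq (.reg 4) (.reg 20)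
        (.reg 7))).size + ((nb v).length * (bodyIn.size + ((degE (.reg 9)).cost + 7)) +
        ((degE (.reg 9)).cost + 5)) + ((lenE tq (.reg 4) (.reg 20)).cost + 7)).sum ≤
        K * (l.map fun v => 1 + (nb v).length).sum := by
      intro l
      induction l with
      | nil => simp
      | cons v l ih =>
        simp only [List.map_cons, List.sum_cons]
        have h1 : (nb v).length * (bodyIn.size + ((degE (.reg 9)).cost + 7)) ≤
            (nb v).length * K := Nat.mul_le_mul_left _ (by omega)
        nlinarith
    have := hstep Q
    rw [mul_add, mul_one]
    omega
  · intro b hb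
    refine ⟨hb.regs, hb.lists, hb.out, fun u => ?_, fun u v => ?_, hb.nodup, hb.mem⟩
    · rw [hb.pred]
      split_ifs
      · have : ((full Q).filter (·.2 = u)).map Prod.fst =
            Q.flatMap fun v => ((nb v).filter (· = u)).map fun _ => v := by
          simp only [hfull, List.filter_flatMap, List.map_flatMap, List.filter_map, List.map_map]
          rfl
        rw [this, List.nodup_flatMap]
        refine ⟨fun v _ => ?_, hQ.imp fun hvw x hx hx' => ?_⟩
        · rw [List.map_const']
          have h1 : ((nb v).filter (· = u)).length ≤ 1 := by
            have := List.nodup_iff_count_le_one.1 (hnd v) u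
            rwa [List.count_eq_length_filter] at this
          interval_cases ((nb v).filter (· = u)).length <;> simp
        · simp only [List.map_const', List.mem_replicate] at hx hx'
          exact hvw (hx.2.symm.trans hx'.2)
      · exact List.nodup_nil
    · rw [hb.pred]
      split_ifs with h
      · simp [hfull, h]
      · simp [h]

end EvenCycles

namespace EvenCycles

open WordRAM Machine

/-! ### Enumeration along lists -/

/-- A step of the enumeration: position `dst` runs through the list with tag `tag` of the entry at
position `src`. -/
structure Link where
  src : ℕ
  dst : ℕ
  tag : ℕ

/-- The positions filled by the links. -/
def dsts (ls : List Link) : List ℕ := ls.map Link.dst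

/-- No link overwrites a position that it or an earlier link has read or filled. -/
def Linked : List Link → Prop
  | [] => True
  | p :: ls => p.src ≠ p.dst ∧ p.src ∉ dsts ls ∧ p.dst ∉ dsts ls ∧ Linked ls

/-- The tuples that arise from `x` when the links are followed through the lists `T`. -/
def walks (T : ℕ → ℕ → List ℕ) : List Link → (ℕ → ℕ) → List (ℕ → ℕ)
  | [], x => [x]
  | p :: ls, x => (T p.tag (x p.src)).flatMap fun v => walks T ls (Function.update x p.dst v)

/-- Nested loops that follow the links; `leaf` is executed for each tuple. Entry `i` of the tuple is
in register `20 + 3 * i`, and the counter of the loop that fills it in register `22 + 3 * i`. -/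
def enumP (leaf : Program) : List Link → Program
  | [] => leaf
  | p :: ls => forP (22 + 3 * p.dst) (lenE p.tag (.reg 4) (.reg (20 + 3 * p.src))) <|
      .seq (.assign (20 + 3 * p.dst)
        (getE p.tag (.reg 4) (.reg (20 + 3 * p.src)) (.reg (22 + 3 * p.dst))))
      (enumP leaf ls)

section walks

variable {T : ℕ → ℕ → List ℕ} {ls : List Link}

theorem walks_congr {x y : ℕ → ℕ} (hls : Linked ls) (h : ∀ i, i ∉ dsts ls → x i = y i) :
    walks T ls x = walks T ls y := by
  induction ls generalizing x y with
  | nil => rw [funext fun i => h i (by simp [dsts])]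
  | cons p ls ih =>
    obtain ⟨h1, h2, h3, h4⟩ := hls
    have hs : x p.src = y p.src := h _ (by simpa [dsts] using ⟨h1, by simpa [dsts] using h2⟩)
    rw [walks, walks, hs]
    congr 1
    funext v
    refine ih h4 fun i hi => ?_
    by_cases hid : i = p.dst
    · simp [hid]
    · rw [Function.update_of_ne hid, Function.update_of_ne hid]
      exact h i (by simpa [dsts] using ⟨hid, by simpa [dsts] using hi⟩)

theorem mem_walks {x y : ℕ → ℕ} (hls : Linked ls) :
    y ∈ walks T ls x ↔ (∀ i, i ∉ dsts ls → y i = x i) ∧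
      ∀ p ∈ ls, y p.dst ∈ T p.tag (y p.src) := by
  induction ls generalizing x with
  | nil => simp [walks, dsts, funext_iff]
  | cons p ls ih =>
    obtain ⟨h1, h2, h3, h4⟩ := hls
    simp only [walks, List.mem_flatMap, ih h4, List.forall_mem_cons]
    have hd : ∀ i, i ∉ dsts (p :: ls) ↔ i ≠ p.dst ∧ i ∉ dsts ls := fun i => by simp [dsts]
    constructor
    · rintro ⟨v, hv, hy, hl⟩
      refine ⟨fun i hi => ?_, ?_, hl⟩
      · obtain ⟨hi1, hi2⟩ := (hd i).1 hi
        rw [hy i hi2, Function.update_of_ne hi1]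
      · rw [hy _ h3, hy _ h2, Function.update_self, Function.update_of_ne h1]
        exact hv
    · rintro ⟨hy, hv, hl⟩
      refine ⟨y p.dst, ?_, fun i hi => ?_, hl⟩
      · rwa [← hy p.src ((hd _).2 ⟨h1, h2⟩)]
      · by_cases hid : i = p.dst
        · simp [hid]
        · rw [Function.update_of_ne hid]
          exact hy i ((hd i).2 ⟨hid, hi⟩)

theorem nodup_walks {x : ℕ → ℕ} {Z : ℕ → Set ℕ}
    (hZ : ∀ p ∈ ls, ∀ u ∈ Z p.src, ∀ v ∈ T p.tag u, v ∈ Z p.dst)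
    (hT : ∀ p ∈ ls, ∀ u ∈ Z p.src, (T p.tag u).Nodup)
    (hx : ∀ p ∈ ls, x p.src ∈ Z p.src ∨ p.src ∈ dsts ls) (hls : Linked ls) :
    (walks T ls x).Nodup := by
  induction ls generalizing x with
  | nil => simp [walks]
  | cons p ls ih =>
    obtain ⟨h1, h2, h3, h4⟩ := hls
    have hs : x p.src ∈ Z p.src := (hx p List.mem_cons_self).resolve_right
      (by simpa [dsts] using ⟨h1, by simpa [dsts] using h2⟩)
    rw [walks, List.nodup_flatMap]
    refine ⟨fun v hv => ih (fun q hq => hZ q (List.mem_cons_of_mem _ hq))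
      (fun q hq => hT q (List.mem_cons_of_mem _ hq)) (fun q hq => ?_) h4, ?_⟩
    · by_cases hqd : q.src = p.dst
      · left; rw [hqd]; simpa using hZ p List.mem_cons_self _ hs v hv
      · rw [Function.update_of_ne hqd]
        refine (hx q (List.mem_cons_of_mem _ hq)).imp_right fun h => ?_
        simpa [dsts, hqd] using h
    refine (hT p List.mem_cons_self _ hs).imp fun {v w} hvw y hy hy' => hvw ?_
    have e1 := ((mem_walks h4).1 hy).1 p.dst h3
    have e2 := ((mem_walks h4).1 hy').1 p.dst h3
    simpa [e1] using e2

/-- If every list met on the way is nonempty, then so is the list of all tuples. Here `Z i` holds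
the possible entries at position `i`. -/
theorem walks_ne_nil {x : ℕ → ℕ} {Z : ℕ → Set ℕ}
    (hZ : ∀ p ∈ ls, ∀ u ∈ Z p.src, ∀ v ∈ T p.tag u, v ∈ Z p.dst)
    (hne : ∀ p ∈ ls, ∀ u ∈ Z p.src, T p.tag u ≠ [])
    (hx : ∀ p ∈ ls, x p.src ∈ Z p.src ∨ p.src ∈ dsts ls) (hls : Linked ls) :
    walks T ls x ≠ [] := by
  induction ls generalizing x with
  | nil => simp [walks]
  | cons p ls ih =>
    obtain ⟨h1, h2, h3, h4⟩ := hls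
    have hs : x p.src ∈ Z p.src := (hx p List.mem_cons_self).resolve_right
      (by simpa [dsts] using ⟨h1, by simpa [dsts] using h2⟩)
    obtain ⟨v, hv⟩ := List.exists_mem_of_ne_nil _ (hne p List.mem_cons_self _ hs)
    have hvd := hZ p List.mem_cons_self _ hs v hv
    intro h
    rw [walks, List.flatMap_eq_nil_iff] at h
    refine ih (fun q hq => hZ q (List.mem_cons_of_mem _ hq))
      (fun q hq => hne q (List.mem_cons_of_mem _ hq)) (fun q hq => ?_) h4 (h v hv)
    by_cases hqd : q.src = p.dst
    · left; rw [hqd]; simpa using hvd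
    · rw [Function.update_of_ne hqd]
      refine (hx q (List.mem_cons_of_mem _ hq)).imp_right fun h => ?_
      simpa [dsts, hqd] using h

end walks

/-- The lists and the registers that the enumeration does not use are the same. -/
structure SameCore (a b : AState) : Prop where
  st : b.st = a.st
  low : ∀ r < 11, b.reg r = a.reg r
  col : ∀ i, b.reg (21 + 3 * i) = a.reg (21 + 3 * i)

theorem SameCore.trans {a b c : AState} (h : SameCore a b) (h' : SameCore b c) : SameCore a c :=
  ⟨h'.st.trans h.st, fun r hr => (h'.low r hr).trans (h.low r hr),
    fun i => (h'.col i).trans (h.col i)⟩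

/-- The tuple kept in the registers. -/
def tuple (a : AState) : ℕ → ℕ := fun i => a.reg (20 + 3 * i)

variable {M : Machine} {a : AState}

/-- An upper bound for the overhead of one passage through one loop of an enumeration. -/
def linkCost : ℕ :=
  (Program.assign 0 (getE 0 (.reg 0) (.reg 0) (.reg 0))).size +
    2 * (lenE 0 (.reg 0) (.reg 0)).cost + 12

/-- The enumeration runs the program `leaf` once for each tuple in `walks T ls (tuple a)`. Here `Z i`
contains all possible entries at position `i`. Except for the first link, the lists that are followed
are not empty (`hne`), so every passage through a loop leads to a tuple, and the time is proportional
to the number of tuples. -/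
theorem Tri.enum {leaf : Program} {cl run : ℕ} {f : (ℕ → ℕ) → List ℕ} {T : ℕ → ℕ → List ℕ}
    {Z : ℕ → Set ℕ} {ls : List Link} (h0 : a.reg 0 = M.B) (h4 : a.reg 4 = run) (hrun : run < M.B)
    (hT : ∀ t u, a.st t run u = T t u) (htag : ∀ p ∈ ls, 1 ≤ p.tag ∧ p.tag < M.B)
    (hZB : ∀ i, ∀ u ∈ Z i, u < M.B)
    (hTB : ∀ p ∈ ls, ∀ u ∈ Z p.src, (T p.tag u).length < M.B)
    (hZ : ∀ p ∈ ls, ∀ u ∈ Z p.src, ∀ v ∈ T p.tag u, v ∈ Z p.dst)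
    (hne : ∀ p ∈ ls.tail, ∀ u ∈ Z p.src, T p.tag u ≠ [])
    (hx : ∀ p ∈ ls, tuple a p.src ∈ Z p.src ∨ p.src ∈ dsts ls) (hls : Linked ls)
    (hleaf : ∀ b, SameCore a b → tuple b ∈ walks T ls (tuple a) →
      M.Tri leaf b cl fun b' => SameCore b b' ∧ (∀ r, 20 ≤ r → b'.reg r = b.reg r) ∧
        b'.out = b.out ++ f (tuple b)) :
    M.Tri (enumP leaf ls) a
      ((cl + 2 * linkCost * ls.length) * (walks T ls (tuple a)).length + linkCost) fun b =>
      SameCore a b ∧ (∀ i, i ∉ dsts ls → b.reg (20 + 3 * i) = a.reg (20 + 3 * i) ∧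
        b.reg (22 + 3 * i) = a.reg (22 + 3 * i)) ∧
      b.out = a.out ++ (walks T ls (tuple a)).flatMap f := by
  induction ls generalizing a with
  | nil =>
    refine (hleaf a ⟨rfl, fun _ _ => rfl, fun _ => rfl⟩ (by simp [walks])).mono ?_ ?_
    · simp [walks]
    · rintro b ⟨h1, h2, h3⟩
      exact ⟨h1, fun i _ => ⟨h2 _ (by omega), h2 _ (by omega)⟩, by simpa [walks] using h3⟩
  | cons p ls ih =>
    obtain ⟨g1, g2, g3, g4⟩ := hls
    obtain ⟨s, d, t⟩ := p
    simp only at g1 g2 g3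
    have hd : ∀ i, i ∉ dsts (⟨s, d, t⟩ :: ls) ↔ i ≠ d ∧ i ∉ dsts ls := fun i => by simp [dsts]
    have hxs : tuple a s ∈ Z s := (hx _ List.mem_cons_self).resolve_right ((hd s).2 ⟨g1, g2⟩)
    obtain ⟨ht1, htB⟩ := htag _ List.mem_cons_self
    simp only at ht1 htB
    set l := T t (tuple a s) with hl
    set W : ℕ → List (ℕ → ℕ) := fun v => walks T ls (Function.update (tuple a) d v) with hW
    have hWne : ∀ v ∈ l, W v ≠ [] := by
      intro v hv
      refine walks_ne_nil (Z := Z) (fun q hq => hZ q (List.mem_cons_of_mem _ hq)) hne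
        (fun q hq => ?_) g4
      by_cases hqd : q.src = d
      · left
        rw [hqd, Function.update_self]
        exact hZ _ List.mem_cons_self _ hxs v hv
      · rw [Function.update_of_ne hqd]
        refine (hx q (List.mem_cons_of_mem _ hq)).imp_right fun h => ?_
        by_contra hc
        exact (hd _).2 ⟨hqd, hc⟩ h
    set Inv : List ℕ → AState → Prop := fun pre b => SameCore a b ∧
      (∀ i, i ∉ dsts ls → i ≠ d → b.reg (20 + 3 * i) = a.reg (20 + 3 * i) ∧
        b.reg (22 + 3 * i) = a.reg (22 + 3 * i)) ∧
      b.out = a.out ++ (pre.flatMap W).flatMap f with hInv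
    have hupd : ∀ pre b v, Inv pre b →
        Inv pre { b with reg := Function.update b.reg (22 + 3 * d) v } := by
      rintro pre b v ⟨⟨h1, h2, h3⟩, h4', h5⟩
      refine ⟨⟨h1, fun r hr => ?_, fun i => ?_⟩, fun i hi hid => ⟨?_, ?_⟩, h5⟩
      · exact (Function.update_of_ne (by omega) _ _).trans (h2 r hr)
      · exact (Function.update_of_ne (by omega) _ _).trans (h3 i)
      · exact (Function.update_of_ne (by omega) _ _).trans (h4' i hi hid).1
      · exact (Function.update_of_ne (by omega) _ _).trans (h4' i hi hid).2
    have hbase : ∀ pre b, Inv pre b → b.reg 0 = M.B ∧ b.reg 4 = run ∧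
        b.reg (20 + 3 * s) = tuple a s ∧ b.st t run (tuple a s) = l := by
      rintro pre b ⟨⟨h1, h2, h3⟩, h4', h5⟩
      exact ⟨(h2 0 (by norm_num)).trans h0, (h2 4 (by norm_num)).trans h4, (h4' s g2 g1).1,
        by rw [h1, hT]⟩
    refine Tri.mono (Tri.forList (M := M) l
      (fun v => (Program.assign (20 + 3 * d)
        (getE t (.reg 4) (.reg (20 + 3 * s)) (.reg (22 + 3 * d)))).size +
          ((cl + 2 * linkCost * ls.length) * (W v).length + linkCost)) Inv
      (lt_two_pow (hTB _ List.mem_cons_self _ hxs)) ?_ ?_ ?_) ?_ ?_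
    · exact hupd _ _ _ ⟨⟨rfl, fun _ _ => rfl, fun _ => rfl⟩, fun _ _ _ => ⟨rfl, rfl⟩, by simp⟩
    · intro pre b _ hi hb
      obtain ⟨b0, b4, bs, bl⟩ := hbase pre b hb
      exact (Evals.len b0 ht1 htB (.reg' b4) (.reg' bs) hrun (hZB _ _ hxs)).congr (by rw [bl])
    · intro pre v post b hpre hi hb
      obtain ⟨b0, b4, bs, bl⟩ := hbase pre b hb
      have hvl : v ∈ l := by rw [hpre]; simp
      have hlt : pre.length < (b.st t run (tuple a s)).length := by rw [bl, hpre]; simp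
      refine Tri.seq (Tri.assign ((Evals.get b0 ht1 htB (.reg' b4) (.reg' bs) (.reg' hi)
        hrun (hZB _ _ hxs) hlt).congr (show _ = v by simp [bl, hpre])) ?_)
      obtain ⟨⟨h1, h2, h3⟩, h4', h5⟩ := hb
      set b₁ : AState := { b with reg := Function.update b.reg (20 + 3 * d) v } with hb₁
      have hc₁ : SameCore a b₁ := by
        refine ⟨h1, fun r hr => ?_, fun i => ?_⟩
        · exact (Function.update_of_ne (by omega) _ _).trans (h2 r hr)
        · exact (Function.update_of_ne (by omega) _ _).trans (h3 i)
      have htup : ∀ i, i ∉ dsts ls → tuple b₁ i = Function.update (tuple a) d v i := by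
        intro i hi
        by_cases hid : i = d
        · subst hid; simp [hb₁, tuple]
        · rw [Function.update_of_ne hid]
          exact (Function.update_of_ne (by omega) _ _).trans (h4' i hi hid).1
      have hwalk : walks T ls (tuple b₁) = W v := walks_congr g4 htup
      have := ih (a := b₁) ((hc₁.low 0 (by norm_num)).trans h0) ((hc₁.low 4 (by norm_num)).trans h4)
        (fun t u => by rw [hc₁.st, hT]) (fun q hq => htag q (List.mem_cons_of_mem _ hq))
        (fun q hq => hTB q (List.mem_cons_of_mem _ hq))
        (fun q hq => hZ q (List.mem_cons_of_mem _ hq))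
        (fun q hq => hne q (List.mem_of_mem_tail hq)) (fun q hq => ?_) g4 (fun b' hb' hm => ?_)
      · rw [hwalk] at this
        refine this.mono le_rfl ?_
        rintro b' ⟨k1, k2, k3⟩
        refine ⟨?_, hupd _ _ _ ⟨hc₁.trans k1, fun i hi hid => ⟨?_, ?_⟩, ?_⟩⟩
        · rw [(k2 d g3).2]
          exact (Function.update_of_ne (by omega) _ _).trans hi
        · rw [(k2 i hi).1]
          exact (Function.update_of_ne (by omega) _ _).trans (h4' i hi hid).1
        · rw [(k2 i hi).2]
          exact (Function.update_of_ne (by omega) _ _).trans (h4' i hi hid).2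
        · rw [k3]
          simp [hb₁, h5]
      · by_cases hq' : q.src ∈ dsts ls
        · exact Or.inr hq'
        · left
          rw [htup _ hq']
          by_cases hqd : q.src = d
          · rw [hqd, Function.update_self]
            exact hZ _ List.mem_cons_self _ hxs v hvl
          · rw [Function.update_of_ne hqd]
            exact (hx q (List.mem_cons_of_mem _ hq)).resolve_right ((hd _).2 ⟨hqd, hq'⟩)
      · refine hleaf b' (hc₁.trans hb') ?_
        rw [hwalk] at hm
        exact List.mem_flatMap.2 ⟨v, hvl, hm⟩
    · have hlc : (Program.assign (20 + 3 * d)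
          (getE t (.reg 4) (.reg (20 + 3 * s)) (.reg (22 + 3 * d)))).size +
            2 * (lenE t (.reg 4) (.reg (20 + 3 * s))).cost + 12 = linkCost := rfl
      set A := (Program.assign (20 + 3 * d)
          (getE t (.reg 4) (.reg (20 + 3 * s)) (.reg (22 + 3 * d)))).size
      set b := (lenE t (.reg 4) (.reg (20 + 3 * s))).cost
      set D := linkCost
      change (l.map fun v => A + ((cl + 2 * D * ls.length) * (W v).length + D) + (b + 7)).sum +
        (b + 5) ≤ (cl + 2 * D * (ls.length + 1)) * (l.flatMap W).length + D
      have hsum : ∀ l' : List ℕ, (∀ v ∈ l', W v ≠ []) →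
          (l'.map fun v => A + ((cl + 2 * D * ls.length) * (W v).length + D) + (b + 7)).sum ≤
          (cl + 2 * D * (ls.length + 1)) * (l'.flatMap W).length := by
        intro l' hl'
        induction l' with
        | nil => simp
        | cons v l' ih' =>
          have h1 : 1 ≤ (W v).length := List.length_pos_iff.2 (hl' v List.mem_cons_self)
          have h2 := ih' fun w hw => hl' w (List.mem_cons_of_mem _ hw)
          simp only [List.map_cons, List.sum_cons, List.flatMap_cons, List.length_append]
          have h3 : 2 * D * 1 ≤ 2 * D * (W v).length := Nat.mul_le_mul_left _ h1
          calc _ ≤ A + ((cl + 2 * D * ls.length) * (W v).length + D) + (b + 7) +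
                (cl + 2 * D * (ls.length + 1)) * (l'.flatMap W).length := by gcongr
            _ ≤ (cl + 2 * D * ls.length) * (W v).length + 2 * D * (W v).length +
                (cl + 2 * D * (ls.length + 1)) * (l'.flatMap W).length := by omega
            _ = _ := by ring
      have := hsum l hWne
      omega
    · rintro b ⟨k1, k2, k3⟩
      refine ⟨k1, fun i hi => ?_, k3⟩
      obtain ⟨hi1, hi2⟩ := (hd i).1 hi
      exact k2 i hi2 hi1

end EvenCycles

namespace EvenCycles

open WordRAM Machine

/-! ### Separating the entries of a tuple by a modulus -/

/-- The distance of two natural numbers, written with the operations of the machine. -/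
def absDiff (x y : ℕ) : ℕ := (x - y) + (y - x)

/-- The product of the distances of all pairs of entries. -/
def prodDiff : List ℕ → ℕ
  | [] => 1
  | x :: l => (l.map (absDiff x)).prod * prodDiff l

/-- An expression for the product of the distances of all pairs of values. -/
def prodDiffE : List Expr → Expr
  | [] => .lit 1
  | e :: l => .bin .mul (l.foldr (fun e' r =>
      .bin .mul (.bin .add (.bin .sub e e') (.bin .sub e' e)) r) (.lit 1)) (prodDiffE l)

theorem absDiff_le {x y X : ℕ} (hx : x ≤ X) (hy : y ≤ X) : absDiff x y ≤ X := by
  unfold absDiff; omega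

theorem absDiff_ne_zero {x y : ℕ} : absDiff x y ≠ 0 ↔ x ≠ y := by
  unfold absDiff; omega

theorem prodDiff_ne_zero {l : List ℕ} : prodDiff l ≠ 0 ↔ l.Nodup := by
  induction l with
  | nil => simp [prodDiff]
  | cons x l ih =>
    rw [prodDiff, mul_ne_zero_iff, ih, List.nodup_cons, Ne, List.prod_eq_zero_iff, List.mem_map]
    refine and_congr_left fun _ => not_congr ⟨?_, fun h => ⟨x, h, by simp [absDiff]⟩⟩
    rintro ⟨y, hy, hxy⟩
    have : x = y := by by_contra hne; exact absDiff_ne_zero.2 hne hxy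
    rwa [this]

theorem prod_absDiff_le {l : List ℕ} {x X : ℕ} (hx : x ≤ X) (hl : ∀ y ∈ l, y ≤ X) :
    (l.map (absDiff x)).prod ≤ X ^ l.length := by
  rw [← List.length_map (absDiff x)]
  refine List.prod_le_pow_card _ _ fun y hy => ?_
  obtain ⟨z, hz, rfl⟩ := List.mem_map.1 hy
  exact absDiff_le hx (hl z hz)

theorem prodDiff_le {l : List ℕ} {X : ℕ} (hX : 1 ≤ X) (hl : ∀ x ∈ l, x ≤ X) :
    prodDiff l ≤ X ^ (l.length * l.length) := by
  induction l with
  | nil => simp [prodDiff]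
  | cons x l ih =>
    rw [List.forall_mem_cons] at hl
    calc prodDiff (x :: l) ≤ X ^ l.length * X ^ (l.length * l.length) :=
          Nat.mul_le_mul (prod_absDiff_le hl.1 hl.2) (ih hl.2)
      _ = X ^ (l.length + l.length * l.length) := (pow_add _ _ _).symm
      _ ≤ _ := Nat.pow_le_pow_right hX (by simp only [List.length_cons]; nlinarith)

/-- A modulus that does not divide the product of the differences separates the entries. -/
theorem nodup_map_mod {l : List ℕ} {p : ℕ} (h : ¬ p ∣ prodDiff l) : (l.map (· % p)).Nodup := by
  induction l with
  | nil => simp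
  | cons x l ih =>
    rw [prodDiff] at h
    rw [List.map_cons, List.nodup_cons]
    refine ⟨fun hm => h ?_, ih fun hd => h (hd.mul_left _)⟩
    obtain ⟨y, hy, hxy⟩ := List.mem_map.1 hm
    refine Dvd.dvd.mul_right ?_ _
    have h1 : p ∣ absDiff x y := by
      have hmod : y ≡ x [MOD p] := hxy
      unfold absDiff
      rcases le_total x y with hle | hle
      · rw [Nat.sub_eq_zero_of_le hle, zero_add]
        exact (Nat.modEq_iff_dvd' hle).1 hmod.symm
      · rw [Nat.sub_eq_zero_of_le hle, add_zero]
        exact (Nat.modEq_iff_dvd' hle).1 hmod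
    exact h1.trans (List.dvd_prod (List.mem_map_of_mem hy))

/-- The least positive number that does not divide `x`. -/
noncomputable def leastNonDvd (x : ℕ) : ℕ := sInf {q | 1 ≤ q ∧ ¬ q ∣ x}

theorem leastNonDvd_spec {x : ℕ} (hx : 0 < x) :
    1 ≤ leastNonDvd x ∧ ¬ leastNonDvd x ∣ x :=
  Nat.sInf_mem (s := {q | 1 ≤ q ∧ ¬ q ∣ x})
    ⟨x + 1, by omega, fun h => by have := Nat.le_of_dvd hx h; omega⟩

theorem leastNonDvd_le {x q : ℕ} (hq : 1 ≤ q) (h : ¬ q ∣ x) : leastNonDvd x ≤ q :=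
  Nat.sInf_le (s := {q | 1 ≤ q ∧ ¬ q ∣ x}) ⟨hq, h⟩

theorem dvd_of_lt_leastNonDvd {x q : ℕ} (hq : 1 ≤ q) (h : q < leastNonDvd x) : q ∣ x := by
  by_contra hc
  exact absurd (leastNonDvd_le hq hc) (by omega)

theorem two_pow_le_centralBinom (n : ℕ) : 2 ^ n ≤ n.centralBinom := by
  induction n with
  | zero => simp
  | succ n ih =>
    have h := Nat.succ_mul_centralBinom_succ n
    refine Nat.le_of_mul_le_mul_left (c := n + 1) ?_ (by omega)
    rw [h, pow_succ]
    nlinarith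

/-- The least non-divisor is logarithmic: all prime powers that occur in the central binomial
coefficient of `n` are at most `2 * n`, so this coefficient divides every positive number that is
divisible by `1, …, 2 * n`. -/
theorem two_pow_leastNonDvd_le {x : ℕ} (hx : 0 < x) : 2 ^ leastNonDvd x ≤ 4 * x ^ 2 := by
  obtain ⟨h1, -⟩ := leastNonDvd_spec hx
  set n := (leastNonDvd x - 1) / 2 with hn
  have hdvd : n.centralBinom ∣ x := by
    rw [← Nat.factorization_le_iff_dvd (Nat.centralBinom_ne_zero n) hx.ne']
    intro p
    by_cases hp : p.Prime
    · by_cases h0 : n.centralBinom.factorization p = 0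
      · rw [h0]; exact Nat.zero_le _
      · rw [← hp.pow_dvd_iff_le_factorization hx.ne']
        have hn0 : 0 < n := by
          by_contra hc
          have : n = 0 := by omega
          rw [this] at h0
          simp at h0
        refine dvd_of_lt_leastNonDvd (Nat.one_le_pow _ _ hp.pos) ?_
        have : p ^ n.centralBinom.factorization p ≤ 2 * n :=
          Nat.pow_factorization_choose_le (by omega)
        omega
    · rw [Nat.factorization_eq_zero_of_not_prime _ hp]
      exact Nat.zero_le _
  have h2 : 2 ^ n ≤ n.centralBinom := two_pow_le_centralBinom n
  have h3 : n.centralBinom ≤ x := Nat.le_of_dvd hx hdvd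
  calc 2 ^ leastNonDvd x ≤ 2 ^ (2 * n + 2) := Nat.pow_le_pow_right (by norm_num) (by omega)
    _ = 4 * (2 ^ n) ^ 2 := by ring
    _ ≤ 4 * x ^ 2 := by gcongr; exact h2.trans h3

variable {M : Machine} {a : AState}

theorem Evals.prodDiffE {es : List Expr} {xs : List ℕ} {X : ℕ} (hX : 1 ≤ X)
    (h : List.Forall₂ (fun e x => M.Evals e a x) es xs) (hxs : ∀ x ∈ xs, x ≤ X)
    (hw : X ^ (xs.length * xs.length) < 2 ^ M.w) :
    M.Evals (prodDiffE es) a (prodDiff xs) := by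
  induction h with
  | nil => exact Evals.lit (by simpa using hw)
  | @cons e x es xs he hes ih =>
    rw [List.forall_mem_cons] at hxs
    have hle : ∀ m, m ≤ (xs.length + 1) * (xs.length + 1) → X ^ m < 2 ^ M.w := fun m hm =>
      (Nat.pow_le_pow_right hX hm).trans_lt (by simpa using hw)
    have hX' : X < 2 ^ M.w := by simpa using hle 1 (by nlinarith)
    refine Evals.mul ?_ (ih hxs.2 (hle _ (by nlinarith))) ?_
    · have : ∀ {es' : List Expr} {xs' : List ℕ}, List.Forall₂ (fun e x => M.Evals e a x) es' xs' →
          (∀ y ∈ xs', y ≤ X) → xs'.length ≤ xs.length →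
          M.Evals (es'.foldr (fun e' r => .bin .mul
            (.bin .add (.bin .sub e e') (.bin .sub e' e)) r) (.lit 1)) a
            (xs'.map (absDiff x)).prod := by
        intro es' xs' h'
        induction h' with
        | nil => intro _ _; exact Evals.lit (by simpa using hle 0 (by omega))
        | @cons e' y es' xs' he' hes' ih' =>
          intro hy hlen
          have hb := prod_absDiff_le hxs.1 hy
          rw [List.forall_mem_cons] at hy
          rw [List.length_cons] at hlen
          have h1 := absDiff_le hxs.1 hy.1
          refine ((((he.sub he' (by omega)).add (he'.sub he (by omega)) ?_)).mul
            (ih' hy.2 (by omega)) ?_)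
          · unfold absDiff at h1; omega
          · exact hb.trans_lt (hle _ (by rw [List.length_cons]; nlinarith))
      exact this hes hxs.2 le_rfl
    · refine (prodDiff_le (l := x :: xs) hX ?_).trans_lt hw
      rw [List.forall_mem_cons]
      exact hxs

/-! ### The tuples that are put out -/

/-- The rank of the vertex `e`: the first entry of its list of arcs. -/
def rankE (e : Expr) : Expr := getE 2 (.lit 0) e (.lit 0)

theorem Evals.rankE {e : Expr} {v r : ℕ} {l : List ℕ} (h0 : a.reg 0 = M.B) (h2 : 2 < M.B)
    (he : M.Evals e a v) (hv : v < M.B) (hl : a.st 2 0 v = r :: l) :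
    M.Evals (rankE e) a r :=
  (Evals.get (i := 0) h0 (by norm_num) h2 (.lit (by positivity)) he (.lit (by positivity)) (by omega)
    hv (by simp [hl])).congr (by simp [hl])

/-- Put out the tuple `x` in the registers if `x 1 < x (ℓ - 1)` and register `1` holds the least
number that does not divide the product of the differences of the ranks. -/
def leafP (ℓ : ℕ) : Program :=
  .seq (.assign 12 (prodDiffE ((List.range ℓ).map fun i => rankE (.reg (20 + 3 * i))))) <|
  .seq (.assign 11 (.lit 1)) <|
  .seq (.loop (.bin .eq (.bin .mod (.reg 12) (.reg 11)) (.lit 0))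
    (.assign 11 (.bin .add (.reg 11) (.lit 1)))) <|
  .ite (.bin .mul (.bin .eq (.reg 11) (.reg 1))
      (.bin .lt (.reg (20 + 3 * 1)) (.reg (20 + 3 * (ℓ - 1)))))
    (seqP ((List.range ℓ).map fun i => .emit (.reg (20 + 3 * i)))) .skip

/-- Only one modulus and one of the two directions lead to output. -/
def Chosen (ℓ p : ℕ) (rk x : ℕ → ℕ) : Prop :=
  leastNonDvd (prodDiff ((List.range ℓ).map fun i => rk (x i))) = p ∧ x 1 < x (ℓ - 1)

open Classical in
/-- The output for the tuple `x`. -/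
noncomputable def leafOut (ℓ p : ℕ) (rk x : ℕ → ℕ) : List ℕ :=
  if Chosen ℓ p rk x then (List.range ℓ).map x else []

/-- The output routine finds the least non-divisor by trial division, which takes at most `N` steps of
the loop. -/
theorem Tri.leaf {ℓ p X N : ℕ} {rk : ℕ → ℕ} (h0 : a.reg 0 = M.B) (h1 : a.reg 1 = p)
    (h2 : 2 < M.B) (hNB : N < M.B) (hX : 1 ≤ X) (hXB : X ^ (ℓ * ℓ) < M.B)
    (hx : ∀ i < ℓ, tuple a i < M.B ∧ rk (tuple a i) ≤ X ∧
      ∃ l, a.st 2 0 (tuple a i) = rk (tuple a i) :: l)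
    (hnd : ((List.range ℓ).map fun i => rk (tuple a i)).Nodup)
    (hN : leastNonDvd (prodDiff ((List.range ℓ).map fun i => rk (tuple a i))) ≤ N) :
    M.Tri (leafP ℓ) a ((leafP ℓ).size * (N + 1)) fun b => SameCore a b ∧
      (∀ r, 20 ≤ r → b.reg r = a.reg r) ∧ b.out = a.out ++ leafOut ℓ p rk (tuple a) := by
  have hD0 := Nat.pos_of_ne_zero (prodDiff_ne_zero.2 hnd)
  set D := prodDiff ((List.range ℓ).map fun i => rk (tuple a i)) with hD
  obtain ⟨hq1, hq2⟩ := leastNonDvd_spec hD0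
  set q := leastNonDvd D with hq
  have hDle : D ≤ X ^ (ℓ * ℓ) := by
    have := prodDiff_le (l := (List.range ℓ).map fun i => rk (tuple a i)) hX (fun y hy => by
      obtain ⟨i, hi, rfl⟩ := List.mem_map.1 hy
      exact (hx i (List.mem_range.1 hi)).2.1)
    simpa using this
  set E₁ : Expr := prodDiffE ((List.range ℓ).map fun i => rankE (.reg (20 + 3 * i)))
  set E₂ : Expr := .bin .eq (.bin .mod (.reg 12) (.reg 11)) (.lit 0) with hE₂
  set E₃ : Expr := .bin .mul (.bin .eq (.reg 11) (.reg 1))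
      (.bin .lt (.reg (20 + 3 * 1)) (.reg (20 + 3 * (ℓ - 1))))
  set P₃ : Program := seqP ((List.range ℓ).map fun i => .emit (.reg (20 + 3 * i))) with hP₃
  have hsz : (leafP ℓ).size = E₁.cost + 1 + (2 + (E₂.cost + 1 + 4 + (E₃.cost + 1 + P₃.size + 1))) :=
    rfl
  refine Tri.cost_le (c₁ := E₁.cost + 1 + (2 + ((∑ t ∈ Finset.range (q - 1), (4 + (E₂.cost + 1)) +
    (E₂.cost + 1)) + (E₃.cost + 1 + (P₃.size + 1))))) ?_ ?_
  · refine Tri.seq (Tri.assign (v := D) (Evals.prodDiffE hX ?_ ?_ ?_) (Tri.seq (Tri.assign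
      (Evals.lit one_lt_two_pow) (Tri.seq ?_))))
    · rw [List.forall₂_map_left_iff, List.forall₂_map_right_iff, List.forall₂_same]
      intro i hi
      obtain ⟨hx1, -, l, hl⟩ := hx i (List.mem_range.1 hi)
      exact Evals.rankE h0 h2 (Evals.reg _) hx1 hl
    · intro y hy
      obtain ⟨i, hi, rfl⟩ := List.mem_map.1 hy
      exact (hx i (List.mem_range.1 hi)).2.1
    · simpa using lt_two_pow hXB
    set a₂ : AState := { a with reg := Function.update (Function.update a.reg 12 D) 11 1 } with ha₂
    refine (Tri.loop (M := M) (q - 1) (fun _ => 4) (fun t b => b.st = a.st ∧ b.out = a.out ∧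
      b.reg 11 = t + 1 ∧ b.reg 12 = D ∧ ∀ r, r < 11 ∨ 20 ≤ r → b.reg r = a.reg r) ?_ ?_ ?_).mono
      le_rfl ?_
    · refine ⟨rfl, rfl, by simp [ha₂], by simp [ha₂], fun r hr => ?_⟩
      rw [ha₂]
      exact (Function.update_of_ne (by omega) _ _).trans (Function.update_of_ne (by omega) _ _)
    · rintro t b ht ⟨-, -, b11, b12, -⟩
      refine ⟨_, ((Evals.reg' b12).mod (Evals.reg' b11) (lt_two_pow (by omega))).eq
        (Evals.lit (by positivity)), ?_⟩
      have : (D % (t + 1) = 0) ↔ t < q - 1 := by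
        rw [← Nat.dvd_iff_mod_eq_zero]
        constructor
        · intro hd
          by_contra hc
          have : t + 1 = q := by omega
          exact hq2 (this ▸ hd)
        · intro hlt
          exact dvd_of_lt_leastNonDvd (by omega) (by omega)
      rw [← this]
      split_ifs with h
      · exact ⟨fun _ => h, fun _ => one_ne_zero⟩
      · exact ⟨fun h' => absurd rfl h', fun h' => absurd h' h⟩
    · rintro t b ht ⟨b1, b2, b11, b12, b3⟩
      refine Tri.assign ((Evals.reg' b11).add (Evals.lit one_lt_two_pow) (lt_two_pow (by omega))) ?_
      refine ⟨b1, b2, by simp, by simp [b12], fun r hr => ?_⟩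
      exact (Function.update_of_ne (by omega) _ _).trans (b3 r hr)
    · rintro b ⟨b1, b2, b11, b12, b3⟩
      have hb11 : b.reg 11 = q := by omega
      have hsame : SameCore a b := ⟨b1, fun r hr => b3 r (Or.inl hr), fun i => b3 _ (by omega)⟩
      have h20 : ∀ r, 20 ≤ r → b.reg r = a.reg r := fun r hr => b3 r (Or.inr hr)
      have hx' : ∀ i, b.reg (20 + 3 * i) = tuple a i := fun i => b3 _ (by omega)
      refine Tri.ite (((Evals.reg' hb11).eq (.reg' ((b3 1 (by omega)).trans h1))).mul
        ((Evals.reg' (hx' 1)).lt (.reg' (hx' (ℓ - 1)))) ?_) ?_ ?_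
      · have := one_lt_two_pow (M := M)
        split_ifs <;> omega
      · intro hne
        have hch : Chosen ℓ p rk (tuple a) := by
          refine ⟨?_, ?_⟩
          · by_contra hc
            exact hne (by rw [if_neg hc, zero_mul])
          · by_contra hc
            exact hne (by rw [if_neg hc, mul_zero])
        refine (Tri.seqP (M := M) (fun t c => c.st = b.st ∧ c.reg = b.reg ∧
          c.out = a.out ++ (List.range t).map (tuple a)) ⟨rfl, rfl, by simp [b2]⟩ ?_).mono
          (Nat.le_succ _) ?_
        · rintro t ht c ⟨c1, c2, c3⟩
          simp only [List.getElem_map, List.getElem_range]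
          refine Tri.emit (Evals.reg' ((congrFun c2 _).trans (hx' t))) ⟨c1, c2, ?_⟩
          rw [List.range_succ, List.map_append, ← List.append_assoc, ← c3]
          rfl
        · rintro c ⟨c1, c2, c3⟩
          refine ⟨⟨c1.trans hsame.st, fun r hr => by rw [c2]; exact hsame.low r hr, fun i => by
            rw [c2]; exact hsame.col i⟩, fun r hr => by rw [c2]; exact h20 r hr, ?_⟩
          rw [c3, leafOut, if_pos hch]
          simp
      · intro hz
        have hch : ¬ Chosen ℓ p rk (tuple a) := by
          rintro ⟨h3, h4⟩
          rw [if_pos h3, if_pos h4] at hz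
          exact absurd hz (by norm_num)
        refine (Tri.skip ⟨hsame, h20, ?_⟩).cost_le (by simp [Program.size])
        rw [leafOut, if_neg hch, List.append_nil, b2]
  · rw [Finset.sum_const, Finset.card_range, smul_eq_mul, hsz]
    have : (q - 1) * (4 + (E₂.cost + 1)) ≤ N * (4 + (E₂.cost + 1)) :=
      Nat.mul_le_mul_right _ (by omega)
    nlinarith

end EvenCycles

namespace WordRAM.Machine

variable {M : Machine} {a : AState}

/-- Any list of programs, the `i`-th of which runs in at most `c i` steps from any state that the
previous ones may leave. -/
theorem Tri.seqP_cost {l : List Program} (c : ℕ → ℕ) (Inv : ℕ → AState → Prop) (h0 : Inv 0 a)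
    (step : ∀ i (h : i < l.length) b, Inv i b → M.Tri l[i] b (c i) (Inv (i + 1))) :
    M.Tri (WordRAM.seqP l) a (∑ i ∈ Finset.range l.length, c i + 1) (Inv l.length) := by
  induction l generalizing a Inv c with
  | nil => exact (Tri.skip h0).cost_le (by simp [Program.size])
  | cons p l ih =>
    have h := Tri.seq ((step 0 (by simp) a h0).mono le_rfl fun b hb =>
      ih (fun i => c (i + 1)) (fun i => Inv (i + 1)) hb
        fun i hi b hb => step (i + 1) (by simpa using hi) b hb)
    refine h.cost_le ?_
    rw [List.length_cons, Finset.sum_range_succ']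
    omega

end WordRAM.Machine

namespace EvenCycles

open WordRAM Machine

/-! ### The layers of a search -/

/-- The tag of the queue of layer `j` on side `s`. -/
def tQ (s j : ℕ) : ℕ := 3 + 4 * j + s

/-- The tag of the lists of predecessors of the vertices of layer `j` on side `s`. -/
def tF (s j : ℕ) : ℕ := 5 + 4 * j + s

/-- The vertex `u` is at the end of a walk of length `j` from `x₀` whose `i`-th vertex satisfies
`ok i`, for `1 ≤ i ≤ j`. -/
def Reach (nb : ℕ → List ℕ) (ok : ℕ → ℕ → Prop) (x₀ : ℕ) : ℕ → ℕ → Prop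
  | 0, u => u = x₀
  | j + 1, u => ok (j + 1) u ∧ ∃ v, Reach nb ok x₀ j v ∧ u ∈ nb v

open Classical in
/-- The number of vertices in layer `j` plus the sum of their degrees. -/
noncomputable def layerCost (n : ℕ) (nb : ℕ → List ℕ) (ok : ℕ → ℕ → Prop) (x₀ j : ℕ) : ℕ :=
  ∑ v ∈ (Finset.range n).filter (Reach nb ok x₀ j), (1 + (nb v).length)

/-- `Q j` lists the vertices of layer `j`, and `F j u` the neighbours of `u` in layer `j - 1`. -/
structure Layers (nb : ℕ → List ℕ) (ok : ℕ → ℕ → Prop) (x₀ k : ℕ) (Q : ℕ → List ℕ)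
    (F : ℕ → ℕ → List ℕ) : Prop where
  zero : Q 0 = [x₀]
  nodup_pred : ∀ j < k, ∀ u, (F (j + 1) u).Nodup
  mem_pred : ∀ j < k, ∀ u v, v ∈ F (j + 1) u ↔ ok (j + 1) u ∧ v ∈ Q j ∧ u ∈ nb v
  nodup : ∀ j ≤ k, (Q j).Nodup
  mem : ∀ j < k, ∀ u, u ∈ Q (j + 1) ↔ F (j + 1) u ≠ []

section Layers

variable {nb : ℕ → List ℕ} {ok : ℕ → ℕ → Prop} {x₀ k n : ℕ} {Q : ℕ → List ℕ} {F : ℕ → ℕ → List ℕ}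

theorem Layers.mem_succ (h : Layers nb ok x₀ k Q F) {j : ℕ} (hj : j < k) (u : ℕ) :
    u ∈ Q (j + 1) ↔ ok (j + 1) u ∧ ∃ v ∈ Q j, u ∈ nb v := by
  have : F (j + 1) u ≠ [] ↔ ∃ v, v ∈ F (j + 1) u :=
    ⟨List.exists_mem_of_ne_nil _, fun ⟨v, hv⟩ => List.ne_nil_of_mem hv⟩
  rw [h.mem j hj, this]
  simp only [h.mem_pred j hj]
  tauto

theorem Layers.mem_iff_reach (h : Layers nb ok x₀ k Q F) {j : ℕ} (hj : j ≤ k) (u : ℕ) :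
    u ∈ Q j ↔ Reach nb ok x₀ j u := by
  induction j generalizing u with
  | zero => rw [h.zero, List.mem_singleton, Reach]
  | succ j ih => simp only [h.mem_succ hj, ih (by omega), Reach]

theorem Layers.lt (h : Layers nb ok x₀ k Q F) (hx : x₀ < n) (hnb : ∀ v, ∀ u ∈ nb v, u < n)
    {j : ℕ} (hj : j ≤ k) : ∀ u ∈ Q j, u < n := by
  intro u hu
  cases j with
  | zero => rw [h.zero, List.mem_singleton] at hu; rwa [hu]
  | succ j =>
    obtain ⟨-, v, -, hv⟩ := (h.mem_succ hj u).1 hu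
    exact hnb v u hv

theorem Layers.sum_eq (h : Layers nb ok x₀ k Q F) (hx : x₀ < n)
    (hnb : ∀ v, ∀ u ∈ nb v, u < n) {j : ℕ} (hj : j ≤ k) :
    ((Q j).map fun v => 1 + (nb v).length).sum = layerCost n nb ok x₀ j := by
  classical
  rw [layerCost, ← List.sum_toFinset _ (h.nodup j hj)]
  congr 1
  ext u
  simp only [List.mem_toFinset, Finset.mem_filter, Finset.mem_range, ← h.mem_iff_reach hj]
  exact ⟨fun hu => ⟨h.lt hx hnb hj u hu, hu⟩, fun hu => hu.2⟩

end Layers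

/-- One side of the search: `k` layers of breadth-first search. -/
def bfsSide (s k : ℕ) (cond : ℕ → Expr) : Program :=
  seqP ((List.range k).map fun j => bfsStep (tQ s j) (tQ s (j + 1)) (tF s (j + 1)) (cond (j + 1)))

theorem size_le_seqP {l : List Program} {p : Program} (hp : p ∈ l) : p.size ≤ (seqP l).size := by
  induction l with
  | nil => simp at hp
  | cons q l ih =>
    change p.size ≤ q.size + (seqP l).size
    rcases List.mem_cons.1 hp with rfl | h
    · omega
    · have := ih h
      omega

/-- The tags used by side `s` of a search. -/
def SideTag (s t : ℕ) : Prop := 3 ≤ t ∧ t % 2 = (3 + s) % 2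

variable {M : Machine} {a : AState}

/-- One side of a search takes time proportional to the size of its layers. The condition for layer
`j + 1` need only be tested correctly in states that differ from `a` in the registers for local use and
in the lists of this side. -/
theorem Tri.bfsSide {s k n run x₀ : ℕ} {cond : ℕ → Expr} {nb : ℕ → List ℕ} {ok : ℕ → ℕ → Prop}
    (h0 : a.reg 0 = M.B) (h4 : a.reg 4 = run) (h20 : a.reg 20 = x₀) (hs : s < 2)
    (hk : 4 * k + 8 < M.B) (hrun : run < M.B) (hx₀ : x₀ < n) (hn : n * n + n + 2 < M.B)
    (hst : ∀ v < n, a.st 1 0 v = nb v) (hnd : ∀ v, (nb v).Nodup) (hnb : ∀ v, ∀ u ∈ nb v, u < n)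
    (hQ : a.st (tQ s 0) run x₀ = [x₀])
    (hfresh : ∀ j < k, ∀ u, a.st (tQ s (j + 1)) run u = [] ∧ a.st (tF s (j + 1)) run u = [])
    (hcond : ∀ j < k, ∀ b v, SameRegs a b →
      (∀ t r u, ¬ (SideTag s t ∧ r = run) → b.st t r u = a.st t r u) →
      b.reg 10 ∈ nb v → v < n →
      ∃ z, M.Evals (cond (j + 1)) b z ∧ (z ≠ 0 ↔ ok (j + 1) (b.reg 10))) :
    M.Tri (EvenCycles.bfsSide s k cond) a ((EvenCycles.bfsSide s k cond).size *
      (1 + ∑ j ∈ Finset.range k, (1 + layerCost n nb ok x₀ j))) fun b =>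
      SameRegs a b ∧ b.out = a.out ∧
      (∀ t r u, ¬ (SideTag s t ∧ r = run) → b.st t r u = a.st t r u) ∧
      Layers nb ok x₀ k (fun j => b.st (tQ s j) run x₀) (fun j u => b.st (tF s j) run u) := by
  classical
  set step : ℕ → Program := fun j =>
    EvenCycles.bfsStep (tQ s j) (tQ s (j + 1)) (tF s (j + 1)) (cond (j + 1)) with hstep
  have hsize : ∀ j < k, (step j).size ≤ (EvenCycles.bfsSide s k cond).size := fun j hj =>
    size_le_seqP (List.mem_map_of_mem (List.mem_range.2 hj))
  have hpos : 1 ≤ (EvenCycles.bfsSide s k cond).size := by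
    unfold EvenCycles.bfsSide
    generalize (List.range k).map _ = l
    induction l with
    | nil => exact le_rfl
    | cons q l ih => change 1 ≤ q.size + (seqP l).size; omega
  have h := Tri.seqP_cost (M := M) (a := a)
    (l := (List.range k).map step) (fun j => (step j).size * (1 + layerCost n nb ok x₀ j))
    (fun t b => SameRegs a b ∧ b.out = a.out ∧
      (∀ t r u, ¬ (SideTag s t ∧ r = run) → b.st t r u = a.st t r u) ∧
      (∀ j, t ≤ j → j < k → ∀ u, b.st (tQ s (j + 1)) run u = [] ∧ b.st (tF s (j + 1)) run u = []) ∧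
      Layers nb ok x₀ t (fun j => b.st (tQ s j) run x₀) (fun j u => b.st (tF s j) run u)) ?_ ?_
  · refine h.mono ?_ ?_
    · rw [List.length_map, List.length_range, mul_add, mul_one, Finset.mul_sum, add_comm]
      refine Nat.add_le_add hpos (Finset.sum_le_sum fun j hj => ?_)
      exact Nat.mul_le_mul_right _ (hsize j (Finset.mem_range.1 hj))
    · rintro b ⟨h1, h2, h3, h4, h5⟩
      rw [List.length_map, List.length_range] at h5
      exact ⟨h1, h2, h3, h5⟩
  · refine ⟨fun _ _ => rfl, rfl, fun _ _ _ _ => rfl, fun j _ hj => hfresh j hj, hQ, ?_, ?_, ?_, ?_⟩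
    · intro j hj; omega
    · intro j hj; omega
    · intro j hj
      obtain rfl : j = 0 := by omega
      simp [hQ]
    · intro j hj; omega
  · rintro t ht b ⟨h1, h2, h3, h5, h6⟩
    rw [List.length_map, List.length_range] at ht
    simp only [List.getElem_map, List.getElem_range]
    have hlt := h6.lt hx₀ hnb le_rfl
    have hne : ∀ t', (t' = tQ s (t + 1) ∨ t' = tF s (t + 1)) → SideTag s t' := by
      unfold tQ tF SideTag; omega
    have h := Tri.bfsStep (M := M) (a := b) (tq := tQ s t) (tq' := tQ s (t + 1)) (tf := tF s (t + 1))
      (cond := cond (t + 1)) (ok := ok (t + 1)) (n := n) (run := run) (x₀ := x₀) (nb := nb)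
      ((h1 0 (by omega)).trans h0) ((h1 4 (by omega)).trans h4) ((h1 20 (by omega)).trans h20)
      (by unfold tQ; omega) (by unfold tQ; omega) (by unfold tF; omega) (by unfold tQ; omega)
      (by unfold tQ; omega) (by unfold tF; omega) (by unfold tQ; omega)
      (by unfold tQ tF; omega) (by unfold tQ tF; omega) hrun hx₀ hn
      (fun v hv => (h3 1 0 v (by unfold SideTag; omega)).trans (hst v hv)) hnd hnb
      (h6.nodup t le_rfl) hlt (h5 t le_rfl ht x₀).1 (fun u => (h5 t le_rfl ht u).2)
      (fun c v hc hc' hu hv => hcond t ht c v (fun r hr => (hc r hr).trans (h1 r hr))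
        (fun t' r u htr => (hc' t' r u fun hh => htr ⟨hne t' hh.1, hh.2⟩).trans (h3 t' r u htr))
        hu hv)
    refine h.mono ?_ ?_
    · rw [h6.sum_eq hx₀ hnb le_rfl]
    · rintro c ⟨c1, c2, c3, c4, c5, c6, c7⟩
      have hQold : ∀ j ≤ t, c.st (tQ s j) run x₀ = b.st (tQ s j) run x₀ := fun j hj =>
        c2 _ _ _ (by unfold tQ tF; omega)
      have hFold : ∀ j ≤ t, ∀ u, c.st (tF s j) run u = b.st (tF s j) run u := fun j hj u =>
        c2 _ _ _ (by unfold tQ tF; omega)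
      refine ⟨fun r hr => (c1 r hr).trans (h1 r hr), c3.trans h2,
        fun t' r u htr => (c2 t' r u fun hh => htr ⟨hne t' hh.1, hh.2⟩).trans (h3 t' r u htr),
        fun j hj hjk u => ?_, ?_, fun j hj u => ?_, fun j hj u v => ?_, fun j hj => ?_,
        fun j hj u => ?_⟩
      · rw [c2 _ _ _ (by unfold tQ tF; omega), c2 _ _ _ (by unfold tQ tF; omega)]
        exact h5 j (by omega) hjk u
      · exact (hQold 0 (by omega)).trans h6.zero
      · rcases Nat.lt_succ_iff_lt_or_eq.1 hj with hj | rfl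
        · rw [hFold _ (by omega)]; exact h6.nodup_pred j hj u
        · exact c4 u
      · rcases Nat.lt_succ_iff_lt_or_eq.1 hj with hj | rfl
        · rw [hFold _ (by omega), hQold _ (by omega)]; exact h6.mem_pred j hj u v
        · rw [hQold _ le_rfl]; exact c5 u v
      · rcases Nat.le_succ_iff.1 hj with hj | rfl
        · rw [hQold _ hj]; exact h6.nodup j hj
        · exact c6
      · rcases Nat.lt_succ_iff_lt_or_eq.1 hj with hj | rfl
        · rw [hFold _ (by omega), hQold _ (by omega)]; exact h6.mem j hj u
        · exact c7 u

/-! ### Closed walks through the layers -/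

/-- The links that join the two sides of a search: position `k` runs through the last queue of the
second side, and from there both sides are followed back to position `0`. -/
def links (k : ℕ) : List Link :=
  ⟨0, k, tQ 1 k⟩ :: ((List.range (k - 1)).map fun i => ⟨k - i, k - i - 1, tF 0 (k - i)⟩) ++
    (List.range (k - 1)).map fun i => ⟨k + i, k + i + 1, tF 1 (k - i)⟩

theorem mem_dsts_links {k i : ℕ} (hk : 2 ≤ k) : i ∈ dsts (links k) ↔ 1 ≤ i ∧ i < 2 * k := by
  simp only [dsts, links, List.map_append, List.map_cons, List.map_map, List.mem_append,
    List.mem_cons, List.mem_map, List.mem_range, Function.comp]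
  constructor
  · rintro ((rfl | ⟨j, hj, rfl⟩) | ⟨j, hj, rfl⟩) <;> omega
  · intro h
    rcases lt_trichotomy i k with h' | h' | h'
    · exact Or.inl (Or.inr ⟨k - i - 1, by omega, by omega⟩)
    · exact Or.inl (Or.inl h')
    · exact Or.inr ⟨i - k - 1, by omega, by omega⟩

theorem linked_of_pairwise {ls : List Link} (h : ∀ p ∈ ls, p.src ≠ p.dst)
    (h' : ls.Pairwise fun p q => p.src ≠ q.dst ∧ p.dst ≠ q.dst) : Linked ls := by
  induction ls with
  | nil => trivial
  | cons p ls ih =>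
    rw [List.pairwise_cons] at h'
    refine ⟨h p List.mem_cons_self, fun hm => ?_, fun hm => ?_,
      ih (fun q hq => h q (List.mem_cons_of_mem _ hq)) h'.2⟩
    · obtain ⟨q, hq, he⟩ := List.mem_map.1 hm
      exact (h'.1 q hq).1 he.symm
    · obtain ⟨q, hq, he⟩ := List.mem_map.1 hm
      exact (h'.1 q hq).2 he.symm

theorem forall_mem_links {k : ℕ} {P : Link → Prop} : (∀ p ∈ links k, P p) ↔
    P ⟨0, k, tQ 1 k⟩ ∧ (∀ i < k - 1, P ⟨k - i, k - i - 1, tF 0 (k - i)⟩) ∧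
      ∀ i < k - 1, P ⟨k + i, k + i + 1, tF 1 (k - i)⟩ := by
  simp only [links, List.forall_mem_append, List.forall_mem_cons, List.forall_mem_map,
    List.mem_range, and_assoc]

theorem linked_links {k : ℕ} (hk : 2 ≤ k) : Linked (links k) := by
  refine linked_of_pairwise (forall_mem_links.2 ⟨?_, fun i hi => ?_, fun i hi => ?_⟩) ?_
  · simp only; omega
  · simp only; omega
  · simp only; omega
  · rw [links, List.pairwise_append, List.pairwise_cons, List.pairwise_map, List.pairwise_map]
    have hr := List.pairwise_lt_range (n := k - 1)
    refine ⟨⟨?_, hr.imp_of_mem fun hi hj hij => ?_⟩, hr.imp_of_mem fun hi hj hij => ?_, ?_⟩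
    · intro q hq
      obtain ⟨i, hi, rfl⟩ := List.mem_map.1 hq
      rw [List.mem_range] at hi
      simp only; omega
    · rw [List.mem_range] at hi hj
      simp only; omega
    · simp only; omega
    · intro p hp q hq
      obtain ⟨j, hj, rfl⟩ := List.mem_map.1 hq
      rw [List.mem_range] at hj
      rcases List.mem_cons.1 hp with rfl | hp
      · simp only; omega
      · obtain ⟨i, hi, rfl⟩ := List.mem_map.1 hp
        rw [List.mem_range] at hi
        simp only; omega

/-- The tuple `y` is a closed walk of length `2 * k`; its entries at the positions `1, …, 2 * k - 1`
are allowed there, and the other ones agree with `x`. -/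
structure ClosedWalk (k : ℕ) (nb : ℕ → List ℕ) (ok : ℕ → ℕ → Prop) (x y : ℕ → ℕ) : Prop where
  base : ∀ i, i = 0 ∨ 2 * k ≤ i → y i = x i
  ok : ∀ i, 1 ≤ i → i < 2 * k → ok i (y i)
  adj : ∀ i, i + 1 < 2 * k → y (i + 1) ∈ nb (y i)
  last : y 0 ∈ nb (y (2 * k - 1))

section closed

variable {nb : ℕ → List ℕ} {ok ok₁ : ℕ → ℕ → Prop} {k n : ℕ} {x : ℕ → ℕ} {T : ℕ → ℕ → List ℕ}

/-- Following the links through the layers yields exactly the closed walks. Every vertex of a layer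
has a predecessor in the layer before, and the vertices in the last layer of the second side have
predecessors on both sides; this is what makes the enumeration free of dead ends. -/
theorem mem_walks_links (hk : 2 ≤ k) (hsymm : ∀ u v, u ∈ nb v ↔ v ∈ nb u)
    (L₀ : Layers nb ok (x 0) k (fun j => T (tQ 0 j) (x 0)) (fun j u => T (tF 0 j) u))
    (L₁ : Layers nb ok₁ (x 0) k (fun j => T (tQ 1 j) (x 0)) (fun j u => T (tF 1 j) u))
    (hok₁ : ∀ j u, 1 ≤ j → j ≤ k → (ok₁ j u ↔ ok (2 * k - j) u ∧ (j = k → T (tF 0 k) u ≠ [])))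
    {y : ℕ → ℕ} : y ∈ walks T (links k) x ↔ ClosedWalk k nb ok x y := by
  rw [mem_walks (linked_links hk), forall_mem_links]
  simp only [mem_dsts_links hk]
  have m₀ : ∀ j < k, ∀ u v, v ∈ T (tF 0 (j + 1)) u ↔ ok (j + 1) u ∧ v ∈ T (tQ 0 j) (x 0) ∧ u ∈ nb v :=
    L₀.mem_pred
  have m₁ : ∀ j < k, ∀ u v, v ∈ T (tF 1 (j + 1)) u ↔ ok₁ (j + 1) u ∧ v ∈ T (tQ 1 j) (x 0) ∧ u ∈ nb v :=
    L₁.mem_pred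
  have q₀ : ∀ j < k, ∀ u, u ∈ T (tQ 0 (j + 1)) (x 0) ↔ ok (j + 1) u ∧
    ∃ v ∈ T (tQ 0 j) (x 0), u ∈ nb v := fun j hj u => L₀.mem_succ hj u
  have q₁ : ∀ j < k, ∀ u, u ∈ T (tQ 1 (j + 1)) (x 0) ↔ ok₁ (j + 1) u ∧
    ∃ v ∈ T (tQ 1 j) (x 0), u ∈ nb v := fun j hj u => L₁.mem_succ hj u
  have z₀ : T (tQ 0 0) (x 0) = [x 0] := L₀.zero
  have z₁ : T (tQ 1 0) (x 0) = [x 0] := L₁.zero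
  constructor
  · rintro ⟨hbase, hyk, hl₀, hl₁⟩
    have hy0 : y 0 = x 0 := hbase 0 (by omega)
    rw [hy0] at hyk
    -- positions `2, …, k`, and their predecessors on the first side
    have s₀ : ∀ j, 2 ≤ j → j ≤ k → ok j (y j) ∧ y (j - 1) ∈ T (tQ 0 (j - 1)) (x 0) ∧
        y j ∈ nb (y (j - 1)) := by
      intro j hj hjk
      have h := hl₀ (k - j) (by omega)
      rw [show k - (k - j) = j by omega] at h
      have h' := m₀ (j - 1) (by omega) (y j) (y (j - 1))
      rw [show j - 1 + 1 = j by omega] at h'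
      exact h'.1 h
    have s₁ : ∀ j, 2 ≤ j → j ≤ k → ok₁ j (y (2 * k - j)) ∧
        y (2 * k - j + 1) ∈ T (tQ 1 (j - 1)) (x 0) ∧ y (2 * k - j) ∈ nb (y (2 * k - j + 1)) := by
      intro j hj hjk
      have h := hl₁ (k - j) (by omega)
      rw [show k - (k - j) = j by omega, show k + (k - j) = 2 * k - j by omega] at h
      have h' := m₁ (j - 1) (by omega) (y (2 * k - j)) (y (2 * k - j + 1))
      rw [show j - 1 + 1 = j by omega] at h'
      exact h'.1 h
    have e₀ : ok 1 (y 1) ∧ y 1 ∈ nb (x 0) := by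
      have h := (q₀ 0 (by omega) (y 1)).1 (s₀ 2 le_rfl hk).2.1
      rw [z₀] at h
      simpa using h
    have e₁ : ok₁ 1 (y (2 * k - 1)) ∧ y (2 * k - 1) ∈ nb (x 0) := by
      have h := (s₁ 2 le_rfl hk).2.1
      rw [show 2 * k - 2 + 1 = 2 * k - 1 by omega] at h
      have h := (q₁ 0 (by omega) (y (2 * k - 1))).1 h
      rw [z₁] at h
      simpa using h
    refine ⟨fun i hi => hbase i (by omega), fun i hi1 hi2 => ?_, fun i hi => ?_, ?_⟩
    · rcases Nat.lt_or_ge i 2 with h2 | h2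
      · obtain rfl : i = 1 := by omega
        exact e₀.1
      · rcases Nat.lt_or_ge k i with hki | hki
        · rcases Nat.lt_or_ge i (2 * k - 1) with h3 | h3
          · have := ((hok₁ (2 * k - i) _ (by omega) (by omega)).1 (s₁ (2 * k - i) (by omega) (by omega)).1).1
            rwa [show 2 * k - (2 * k - i) = i by omega] at this
          · obtain rfl : i = 2 * k - 1 := by omega
            exact ((hok₁ 1 _ le_rfl (by omega)).1 e₁.1).1
        · exact (s₀ i h2 hki).1
    · rcases Nat.lt_or_ge i k with hik | hik
      · rcases Nat.eq_zero_or_pos i with rfl | hi0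
        · rw [hy0]; exact e₀.2
        · exact (s₀ (i + 1) (by omega) (by omega)).2.2
      · have := (s₁ (2 * k - i) (by omega) (by omega)).2.2
        rw [show 2 * k - (2 * k - i) = i by omega] at this
        exact (hsymm _ _).1 this
    · rw [hy0]
      exact (hsymm _ _).1 e₁.2
  · rintro ⟨hbase, hok, hadj, hlast⟩
    have hy0 : y 0 = x 0 := hbase 0 (Or.inl rfl)
    have r₀ : ∀ j ≤ k, y j ∈ T (tQ 0 j) (x 0) := by
      intro j hj
      induction j with
      | zero => rw [z₀, hy0]; simp
      | succ j ih =>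
        exact (q₀ j (by omega) _).2 ⟨hok _ (by omega) (by omega), _, ih (by omega), hadj j (by omega)⟩
    have hFk : T (tF 0 k) (y k) ≠ [] := by
      have h1 := r₀ k le_rfl
      have h2 := L₀.mem (k - 1) (by omega) (y k)
      rw [show k - 1 + 1 = k by omega] at h2
      exact h2.1 h1
    have o₁ : ∀ j, 1 ≤ j → j ≤ k → ok₁ j (y (2 * k - j)) := by
      intro j h1 h2
      refine (hok₁ j _ h1 h2).2 ⟨hok _ (by omega) (by omega), fun h => ?_⟩
      rw [h, show 2 * k - k = k by omega]
      exact hFk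
    have a₁ : ∀ j, j + 2 ≤ k → y (2 * k - (j + 2)) ∈ nb (y (2 * k - (j + 1))) := by
      intro j hj
      have := hadj (2 * k - (j + 2)) (by omega)
      rw [show 2 * k - (j + 2) + 1 = 2 * k - (j + 1) by omega] at this
      exact (hsymm _ _).1 this
    have r₁ : ∀ j < k, y (2 * k - (j + 1)) ∈ T (tQ 1 (j + 1)) (x 0) := by
      intro j hj
      induction j with
      | zero =>
        refine (q₁ 0 (by omega) _).2 ⟨o₁ 1 le_rfl (by omega), x 0, by rw [z₁]; simp, ?_⟩
        rw [← hy0]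
        exact (hsymm _ _).1 hlast
      | succ j ih =>
        exact (q₁ (j + 1) (by omega) _).2 ⟨o₁ (j + 2) (by omega) (by omega), _, ih (by omega),
          a₁ j (by omega)⟩
    refine ⟨fun i hi => hbase i (by omega), ?_, fun i hi => ?_, fun i hi => ?_⟩
    · have := r₁ (k - 1) (by omega)
      rw [show k - 1 + 1 = k by omega, show 2 * k - k = k by omega] at this
      rwa [hy0]
    · have h := (m₀ (k - i - 1) (by omega) (y (k - i)) (y (k - i - 1))).2
      rw [show k - i - 1 + 1 = k - i by omega] at h
      refine h ⟨hok _ (by omega) (by omega), r₀ _ (by omega), ?_⟩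
      have := hadj (k - i - 1) (by omega)
      rwa [show k - i - 1 + 1 = k - i by omega] at this
    · have h := (m₁ (k - i - 1) (by omega) (y (k + i)) (y (k + i + 1))).2
      rw [show k - i - 1 + 1 = k - i by omega] at h
      have h1 := o₁ (k - i) (by omega) (by omega)
      have h2 := r₁ (k - i - 2) (by omega)
      rw [show 2 * k - (k - i) = k + i by omega] at h1
      rw [show k - i - 2 + 1 = k - i - 1 by omega,
        show 2 * k - (k - i - 1) = k + i + 1 by omega] at h2
      exact h ⟨h1, h2, (hsymm _ _).1 (hadj _ (by omega))⟩

/-- The possible entries at each position of the enumeration. -/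
def entries (k : ℕ) (T : ℕ → ℕ → List ℕ) (x₀ i : ℕ) : Set ℕ :=
  if i = 0 then {x₀} else if i < k then {u | u ∈ T (tQ 0 i) x₀}
  else {u | i < 2 * k ∧ u ∈ T (tQ 1 (2 * k - i)) x₀}

theorem entries_links (hk : 2 ≤ k) {x₀ : ℕ}
    (L₀ : Layers nb ok x₀ k (fun j => T (tQ 0 j) x₀) (fun j u => T (tF 0 j) u))
    (L₁ : Layers nb ok₁ x₀ k (fun j => T (tQ 1 j) x₀) (fun j u => T (tF 1 j) u))
    (hok₁ : ∀ j u, 1 ≤ j → j ≤ k → (ok₁ j u ↔ ok (2 * k - j) u ∧ (j = k → T (tF 0 k) u ≠ []))) :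
    (∀ p ∈ links k, ∀ u ∈ entries k T x₀ p.src, ∀ v ∈ T p.tag u, v ∈ entries k T x₀ p.dst) ∧
    (∀ p ∈ links k, ∀ u ∈ entries k T x₀ p.src, (T p.tag u).Nodup) ∧
    (∀ p ∈ (links k).tail, ∀ u ∈ entries k T x₀ p.src, T p.tag u ≠ []) := by
  have m₀ : ∀ j < k, ∀ u v, v ∈ T (tF 0 (j + 1)) u ↔ ok (j + 1) u ∧ v ∈ T (tQ 0 j) x₀ ∧ u ∈ nb v :=
    L₀.mem_pred
  have m₁ : ∀ j < k, ∀ u v, v ∈ T (tF 1 (j + 1)) u ↔ ok₁ (j + 1) u ∧ v ∈ T (tQ 1 j) x₀ ∧ u ∈ nb v :=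
    L₁.mem_pred
  have n₀ : ∀ j < k, ∀ u, u ∈ T (tQ 0 (j + 1)) x₀ ↔ T (tF 0 (j + 1)) u ≠ [] := L₀.mem
  have n₁ : ∀ j < k, ∀ u, u ∈ T (tQ 1 (j + 1)) x₀ ↔ T (tF 1 (j + 1)) u ≠ [] := L₁.mem
  have hne : (∀ i < k - 1, ∀ u ∈ entries k T x₀ (k - i), T (tF 0 (k - i)) u ≠ []) ∧
      ∀ i < k - 1, ∀ u ∈ entries k T x₀ (k + i), T (tF 1 (k - i)) u ≠ [] := by
    constructor
    · intro i hi u hu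
      rw [entries, if_neg (by omega)] at hu
      rcases Nat.eq_zero_or_pos i with rfl | hi0
      · rw [if_neg (by omega)] at hu
        have hq := hu.2
        rw [show 2 * k - (k - 0) = k - 1 + 1 by omega] at hq
        have := ((L₁.mem_succ (by omega) u).1 hq).1
        rw [show k - 1 + 1 = k by omega] at this
        exact ((hok₁ k u (by omega) le_rfl).1 this).2 rfl
      · rw [if_pos (by omega)] at hu
        have := n₀ (k - i - 1) (by omega) u
        rw [show k - i - 1 + 1 = k - i by omega] at this
        exact this.1 hu
    · intro i hi u hu
      rw [entries, if_neg (by omega), if_neg (by omega)] at hu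
      have hq := hu.2
      have := n₁ (k - i - 1) (by omega) u
      rw [show k - i - 1 + 1 = k - i by omega] at this
      rw [show 2 * k - (k + i) = k - i by omega] at hq
      exact this.1 hq
  refine ⟨forall_mem_links.2 ⟨?_, fun i hi u hu v hv => ?_, fun i hi u hu v hv => ?_⟩,
    forall_mem_links.2 ⟨?_, fun i hi u _ => ?_, fun i hi u _ => ?_⟩, ?_⟩
  · intro u hu v hv
    simp only [entries, if_true, Set.mem_singleton_iff] at hu
    subst hu
    simp only [entries]
    rw [if_neg (by omega), if_neg (by omega)]
    refine ⟨by omega, ?_⟩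
    rwa [show 2 * k - k = k by omega]
  · have h := (m₀ (k - i - 1) (by omega) u v).1
    rw [show k - i - 1 + 1 = k - i by omega] at h
    simp only [entries]
    rw [if_neg (by omega), if_pos (by omega)]
    exact (h hv).2.1
  · have h := (m₁ (k - i - 1) (by omega) u v).1
    rw [show k - i - 1 + 1 = k - i by omega] at h
    simp only [entries]
    rw [if_neg (by omega), if_neg (by omega)]
    refine ⟨by omega, ?_⟩
    rw [show 2 * k - (k + i + 1) = k - i - 1 by omega]
    exact (h hv).2.1
  · intro u hu
    simp only [entries, if_true, Set.mem_singleton_iff] at hu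
    subst hu
    exact L₁.nodup k le_rfl
  · have := L₀.nodup_pred (k - i - 1) (by omega) u
    rwa [show k - i - 1 + 1 = k - i by omega] at this
  · have := L₁.nodup_pred (k - i - 1) (by omega) u
    rwa [show k - i - 1 + 1 = k - i by omega] at this
  · intro p hp
    rw [links, List.cons_append, List.tail_cons, List.mem_append] at hp
    rcases hp with hp | hp <;> obtain ⟨i, hi, rfl⟩ := List.mem_map.1 hp <;>
      rw [List.mem_range] at hi
    · exact hne.1 i hi
    · exact hne.2 i hi

end closed

end EvenCycles

namespace EvenCycles

open WordRAM Machine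

/-! ### Searching from one vertex -/

/-- What is stored of a graph on the vertices `0, …, n - 1`: the list `nb v` of neighbours of `v` and
the list `rl v` of the numbers of the arcs with tail `v`. -/
structure ArcData (n : ℕ) (nb rl : ℕ → List ℕ) : Prop where
  nodup : ∀ v, (nb v).Nodup
  lt : ∀ v, ∀ u ∈ nb v, u < n
  symm : ∀ u v, u ∈ nb v ↔ v ∈ nb u
  ne_nil : ∀ v, nb v ≠ [] → rl v ≠ []

/-- The rank of a vertex that is not isolated: the number of its first arc. -/
def rank (rl : ℕ → List ℕ) (v : ℕ) : ℕ := (rl v).headD 0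

/-- The key of a vertex; keys order the vertices by degree, then by number. -/
def vkey (n : ℕ) (nb : ℕ → List ℕ) (v : ℕ) : ℕ := (nb v).length * n + v

/-- The vertex `u` has the colour of position `i`, and its key is below that of `x₀`. -/
def Allowed (n : ℕ) (nb rl : ℕ → List ℕ) (p : ℕ) (c : ℕ → ℕ) (x₀ i u : ℕ) : Prop :=
  rank rl u % p = c i ∧ vkey n nb u < vkey n nb x₀

/-- The condition on the vertices of layer `j` of the second side of a search. In the last layer,
only vertices that the first side has reached are kept. -/
def AllowedBack (nb : ℕ → List ℕ) (ok : ℕ → ℕ → Prop) (k x₀ j u : ℕ) : Prop :=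
  ok (2 * k - j) u ∧ (j = k → Reach nb ok x₀ k u)

/-- The lists with tags `1` and `2` hold the graph. -/
def Holds (n : ℕ) (nb rl : ℕ → List ℕ) (a : AState) : Prop :=
  ∀ v < n, a.st 1 0 v = nb v ∧ a.st 2 0 v = rl v

/-- The key of the vertex `e`. -/
def keyE (e : Expr) : Expr := .bin .add (.bin .mul (degE e) (.load (.lit 0))) e

/-- The vertex in register `10` is allowed at position `i`. The modulus is in register `1`, the
colour of position `i` in register `21 + 3 * i`, and the key of the first vertex in register `6`. -/
def okE (i : ℕ) : Expr :=
  .bin .mul (.bin .eq (.bin .mod (rankE (.reg 10)) (.reg 1)) (.reg (21 + 3 * i)))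
    (.bin .lt (keyE (.reg 10)) (.reg 6))

/-- The condition of the second side of a search. -/
def okBackE (k j : ℕ) : Expr :=
  if j = k then .bin .mul (okE (2 * k - j)) (.bin .lt (.lit 0) (lenE (tF 0 k) (.reg 4) (.reg 10)))
  else okE (2 * k - j)

/-- Find all closed walks of length `2 * k` that start with the vertex in register `20`, the other
vertices of which are allowed. -/
def searchP (k : ℕ) : Program :=
  .seq (.assign 6 (keyE (.reg 20))) <|
  .seq (pushP (tQ 0 0) (.reg 4) (.reg 20) (.reg 20)) <|
  .seq (pushP (tQ 1 0) (.reg 4) (.reg 20) (.reg 20)) <|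
  .seq (bfsSide 0 k okE) <|
  .seq (bfsSide 1 k (okBackE k)) (enumP (leafP (2 * k)) (links k))

/-- The constant in the bound for the number of steps of a search. -/
def searchCost (k : ℕ) : ℕ :=
  (searchP k).size + 2 * linkCost * (links k).length + linkCost

variable {M : Machine} {a : AState} {n p : ℕ} {nb rl : ℕ → List ℕ} {c : ℕ → ℕ}

theorem ArcData.length_le (hA : ArcData n nb rl) (v : ℕ) : (nb v).length ≤ n :=
  list_length_le_of_nodup (hA.nodup v) (hA.lt v)

theorem ArcData.exists_cons (hA : ArcData n nb rl) {v : ℕ} (hv : nb v ≠ []) :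
    ∃ l, rl v = rank rl v :: l := by
  have := hA.ne_nil v hv
  unfold rank
  cases h : rl v with
  | nil => exact absurd h this
  | cons r l => exact ⟨l, rfl⟩

theorem ArcData.ne_nil_of_mem (hA : ArcData n nb rl) {u v : ℕ} (h : u ∈ nb v) : nb u ≠ [] :=
  List.ne_nil_of_mem ((hA.symm u v).1 h)

theorem Evals.keyE (hA : ArcData n nb rl) (ha : Holds n nb rl a) (h0 : a.reg 0 = M.B)
    (hlen : 0 < M.len) (hin : M.inp 0 = n) (hn : n * n + n + 2 < M.B) {e : Expr} {v : ℕ}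
    (he : M.Evals e a v) (hv : v < n) : M.Evals (EvenCycles.keyE e) a (vkey n nb v) := by
  have hd := hA.length_le v
  have hdn : (nb v).length * n ≤ n * n := Nat.mul_le_mul_right _ hd
  have hdeg : M.Evals (degE e) a (nb v).length :=
    (Evals.len h0 le_rfl (by omega) (.lit (by positivity)) he (by omega) (by omega)).congr
      (by rw [(ha v hv).1])
  exact (hdeg.mul ((Evals.input (Evals.lit (c := 0) (by positivity)) hlen).congr hin)
    (lt_two_pow (by omega))).add he (lt_two_pow (by omega))

theorem Evals.okE (hA : ArcData n nb rl) (ha : Holds n nb rl a) (h0 : a.reg 0 = M.B)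
    (h1 : a.reg 1 = p) {x₀ i : ℕ} (h6 : a.reg 6 = vkey n nb x₀)
    (hc : a.reg (21 + 3 * i) = c i) (hlen : 0 < M.len) (hin : M.inp 0 = n)
    (hn : n * n + n + 2 < M.B) (h2B : 2 < M.B) (hrB : ∀ v, rank rl v < M.B) {v : ℕ}
    (hu : a.reg 10 ∈ nb v) :
    ∃ z ≤ 1, M.Evals (EvenCycles.okE i) a z ∧ (z ≠ 0 ↔ Allowed n nb rl p c x₀ i (a.reg 10)) := by
  have hun := hA.lt v _ hu
  obtain ⟨l, hl⟩ := hA.exists_cons (hA.ne_nil_of_mem hu)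
  refine ⟨_, ?_, ((((Evals.rankE h0 h2B (.reg 10) (by omega) ((ha _ hun).2.trans hl)).mod (.reg' h1)
    (lt_two_pow (hrB _))).eq (.reg' hc)).mul ((Evals.keyE hA ha h0 hlen hin hn (.reg 10) hun).lt
    (.reg' h6)) ?_), ?_⟩
  · split_ifs <;> norm_num
  · have := one_lt_two_pow (M := M)
    split_ifs <;> omega
  · unfold Allowed
    split_ifs <;> simp_all

/-- The steps of the parts of a search, added up: `D₀` and `D₁` are the sizes of the two sides, and `W`
bounds the number of tuples found. -/
theorem search_arith {A₁ A₂ A₃ S₀ S₁ D₀ D₁ L E lc lk N W : ℕ} (hD₀ : 1 ≤ D₀) (hL : L ≤ E) :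
    A₁ + (A₂ + (A₃ + (S₀ * D₀ + (S₁ * D₁ + ((L * (N + 1) + lc) * W + lk))))) ≤
      (A₁ + (A₂ + (A₃ + (S₀ + (S₁ + E)))) + lc + lk) * (D₀ + D₁ + (N + 1) * W) := by
  have h1 : (L * (N + 1) + lc) * W ≤ (E + lc) * ((N + 1) * W) := by
    calc (L * (N + 1) + lc) * W ≤ (E * (N + 1) + lc * (N + 1)) * W := by
          gcongr ?_ * W
          exact Nat.add_le_add (Nat.mul_le_mul_right _ hL) (Nat.le_mul_of_pos_right _ (by omega))
      _ = _ := by ring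
  have h2 : A₁ + A₂ + A₃ + lk ≤ (A₁ + A₂ + A₃ + lk) * D₀ := Nat.le_mul_of_pos_right _ hD₀
  calc _ ≤ (A₁ + A₂ + A₃ + lk) * D₀ + S₀ * D₀ + S₁ * D₁ + (E + lc) * ((N + 1) * W) := by omega
    _ ≤ (A₁ + A₂ + A₃ + lk + S₀) * (D₀ + D₁ + (N + 1) * W) + S₁ * (D₀ + D₁ + (N + 1) * W) +
        (E + lc) * (D₀ + D₁ + (N + 1) * W) := by
      rw [← add_mul]
      gcongr <;> omega
    _ = _ := by ring

/-- A search from `x₀` finds exactly the closed walks through `x₀` whose other vertices are allowed,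
and hands each of them once to the output routine. Its time is the size of the layers of the two sides,
plus `N + 1` for each closed walk, where `N` bounds the moduli. Only lists with the number `run` of this
search are changed. -/
theorem Tri.search {k run x₀ X N W : ℕ} (hk : 2 ≤ k) (hA : ArcData n nb rl) (ha : Holds n nb rl a)
    (hlen : 0 < M.len) (hin : M.inp 0 = n) (hn : n * n + n + 2 < M.B) (hkB : 4 * k + 8 < M.B)
    (h0 : a.reg 0 = M.B) (h1 : a.reg 1 = p) (h4 : a.reg 4 = run) (h20 : a.reg 20 = x₀)
    (hrun : run < M.B) (hx₀ : x₀ < n) (hne : nb x₀ ≠ [])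
    (hc : ∀ i, a.reg (21 + 3 * i) = c i) (hcnd : ((List.range (2 * k)).map c).Nodup)
    (hc0 : rank rl x₀ % p = c 0)
    (hX : 1 ≤ X) (hrX : ∀ v, rank rl v ≤ X) (hXB : X ^ (2 * k * (2 * k)) < M.B)
    (hN : 4 * (X ^ (2 * k * (2 * k))) ^ 2 < 2 ^ (N + 1)) (hNB : N < M.B)
    (hfresh : ∀ t, 3 ≤ t → ∀ u, a.st t run u = [])
    (hW : ∀ ys : List (ℕ → ℕ), ys.Nodup →
      (∀ y ∈ ys, ClosedWalk k nb (Allowed n nb rl p c x₀) (tuple a) y) → ys.length ≤ W) :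
    M.Tri (searchP k) a (searchCost k *
      ((1 + ∑ j ∈ Finset.range k, (1 + layerCost n nb (Allowed n nb rl p c x₀) x₀ j)) +
        (1 + ∑ j ∈ Finset.range k,
          (1 + layerCost n nb (AllowedBack nb (Allowed n nb rl p c x₀) k x₀) x₀ j)) +
        (N + 1) * W)) fun b =>
      (∀ r < 6, b.reg r = a.reg r) ∧ (∀ i, b.reg (21 + 3 * i) = a.reg (21 + 3 * i)) ∧
      (∀ t r u, t < 3 ∨ r ≠ run → b.st t r u = a.st t r u) ∧
      ∃ ys : List (ℕ → ℕ), ys.Nodup ∧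
        (∀ y, y ∈ ys ↔ ClosedWalk k nb (Allowed n nb rl p c x₀) (tuple a) y) ∧
        b.out = a.out ++ ys.flatMap (leafOut (2 * k) p (rank rl)) := by
  set ok := Allowed n nb rl p c x₀ with hok
  set okB := AllowedBack nb ok k x₀ with hokB
  have hrB : ∀ v, rank rl v < M.B := fun v =>
    ((hrX v).trans (Nat.le_self_pow (by positivity) X)).trans_lt hXB
  set a₁ : AState := { a with reg := Function.update a.reg 6 (vkey n nb x₀) } with ha₁
  set a₂ : AState := { a₁ with st := a₁.st.push (tQ 0 0) run x₀ x₀ } with ha₂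
  set a₃ : AState := { a₂ with st := a₂.st.push (tQ 1 0) run x₀ x₀ } with ha₃
  have r₁ : ∀ r, r ≠ 6 → a₁.reg r = a.reg r := fun r hr => Function.update_of_ne hr _ _
  have r₃ : ∀ r, r ≠ 6 → a₃.reg r = a.reg r := r₁
  have s₃ : ∀ t r u, ¬ ((t = tQ 0 0 ∨ t = tQ 1 0) ∧ r = run ∧ u = x₀) →
      a₃.st t r u = a.st t r u := by
    intro t r u h
    have e1 : ¬ (t = tQ 1 0 ∧ r = run ∧ u = x₀) := by tauto
    have e2 : ¬ (t = tQ 0 0 ∧ r = run ∧ u = x₀) := by tauto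
    simp only [ha₃, ha₂, ha₁, Store.push, if_neg e1, if_neg e2]
  have q₃ : a₃.st (tQ 0 0) run x₀ = [x₀] ∧ a₃.st (tQ 1 0) run x₀ = [x₀] := by
    have e0 := hfresh (tQ 0 0) (by unfold tQ; omega) x₀
    have e1 := hfresh (tQ 1 0) (by unfold tQ; omega) x₀
    have e2 : tQ 0 0 ≠ tQ 1 0 := by unfold tQ; omega
    simp [ha₃, ha₂, ha₁, Store.push, e0, e1, e2, e2.symm]
  have h6 : a₃.reg 6 = vkey n nb x₀ := by simp [ha₃, ha₂, ha₁]
  set A₁ := (Program.assign 6 (EvenCycles.keyE (.reg 20))).size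
  set A₂ := (pushP (tQ 0 0) (.reg 4) (.reg 20) (.reg 20)).size
  set A₃ := (pushP (tQ 1 0) (.reg 4) (.reg 20) (.reg 20)).size
  set D₀ := 1 + ∑ j ∈ Finset.range k, (1 + layerCost n nb ok x₀ j)
  set D₁ := 1 + ∑ j ∈ Finset.range k, (1 + layerCost n nb okB x₀ j)
  set S₀ := (EvenCycles.bfsSide 0 k EvenCycles.okE).size
  set S₁ := (EvenCycles.bfsSide 1 k (okBackE k)).size
  set cl := (leafP (2 * k)).size * (N + 1)
  refine Tri.cost_le (c₁ := A₁ + (A₂ + (A₃ + (S₀ * D₀ + (S₁ * D₁ +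
    ((cl + 2 * linkCost * (links k).length) * W + linkCost)))))) ?_ ?_
  · refine Tri.seq (Tri.assign (Evals.keyE hA ha h0 hlen hin hn (.reg' h20) hx₀) (Tri.seq
      (Tri.push (t := tQ 0 0) ((r₁ 0 (by norm_num)).trans h0) (by unfold tQ; omega)
      (by unfold tQ; omega)
      (.reg' ((r₁ 4 (by norm_num)).trans h4)) (.reg' ((r₁ 20 (by norm_num)).trans h20))
      (.reg' ((r₁ 20 (by norm_num)).trans h20)) hrun (by omega) ?_ (Tri.seq
      (Tri.push (t := tQ 1 0) (a := a₂) ((r₁ 0 (by norm_num)).trans h0) (by unfold tQ; omega)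
      (by unfold tQ; omega)
      (.reg' ((r₁ 4 (by norm_num)).trans h4)) (.reg' ((r₁ 20 (by norm_num)).trans h20))
      (.reg' ((r₁ 20 (by norm_num)).trans h20)) hrun (by omega) ?_ (Tri.seq (a := a₃) ?_))))))
    · change (a.st (tQ 0 0) run x₀).length + 2 < M.B
      rw [hfresh _ (by unfold tQ; omega)]
      simp only [List.length_nil]; omega
    · have : a₂.st (tQ 1 0) run x₀ = [] := by
        simp only [ha₂, Store.push]
        exact hfresh _ (by unfold tQ; omega) x₀
      rw [this]
      simp only [List.length_nil]; omega
    have hHolds : ∀ b : AState, (∀ s, (s = 0 ∨ s = 1) → ∀ t r u, t < 3 → b.st t r u = a.st t r u) →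
        Holds n nb rl b := fun b hb v hv =>
      ⟨(hb 0 (Or.inl rfl) 1 0 v (by norm_num)).trans (ha v hv).1,
        (hb 0 (Or.inl rfl) 2 0 v (by norm_num)).trans (ha v hv).2⟩
    have low₃ : ∀ t r u, t < 3 → a₃.st t r u = a.st t r u := fun t r u ht =>
      s₃ t r u (by unfold tQ; omega)
    have hokE : ∀ b v i, SameRegs a₃ b → (∀ t r u, t < 3 → b.st t r u = a.st t r u) →
        b.reg 10 ∈ nb v → ∃ z ≤ 1, M.Evals (EvenCycles.okE i) b z ∧ (z ≠ 0 ↔ ok i (b.reg 10)) := by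
      intro b v i hb hlow hu
      exact Evals.okE hA (hHolds b fun _ _ => hlow)
        ((hb 0 (by norm_num)).trans ((r₃ 0 (by norm_num)).trans h0))
        ((hb 1 (by norm_num)).trans ((r₃ 1 (by norm_num)).trans h1))
        ((hb 6 (by norm_num)).trans h6)
        ((hb _ (by omega)).trans ((r₃ _ (by omega)).trans (hc i))) hlen hin hn (by omega) hrB hu
    refine (Tri.bfsSide (M := M) (a := a₃) (s := 0) (k := k) (n := n) (run := run) (x₀ := x₀)
      (cond := EvenCycles.okE) (nb := nb) (ok := ok) ((r₃ 0 (by norm_num)).trans h0)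
      ((r₃ 4 (by norm_num)).trans h4) ((r₃ 20 (by norm_num)).trans h20) (by norm_num) hkB hrun hx₀ hn
      (fun v hv => (low₃ 1 0 v (by norm_num)).trans (ha v hv).1) hA.nodup hA.lt q₃.1
      (fun j hj u => ⟨?_, ?_⟩) ?_).mono le_rfl ?_
    · rw [s₃ _ _ _ (by unfold tQ; omega)]
      exact hfresh _ (by unfold tQ; omega) u
    · rw [s₃ _ _ _ (by unfold tF tQ; omega)]
      exact hfresh _ (by unfold tF; omega) u
    · intro j hj b v hb hbs hu hv
      obtain ⟨z, -, hz⟩ := hokE b v (j + 1) hb (fun t r u ht => (hbs t r u (by unfold SideTag; omega)).trans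
        (low₃ t r u ht)) hu
      exact ⟨z, hz⟩
    rintro b ⟨b1, b2, b3, b4⟩
    have lowb : ∀ t r u, t < 3 → b.st t r u = a.st t r u := fun t r u ht =>
      (b3 t r u (by unfold SideTag; omega)).trans (low₃ t r u ht)
    have regb : ∀ r, (r < 7 ∨ 20 ≤ r) → r ≠ 6 → b.reg r = a.reg r := fun r hr hr' =>
      (b1 r hr).trans (r₃ r hr')
    refine Tri.seq ((Tri.bfsSide (M := M) (a := b) (s := 1) (k := k) (n := n) (run := run) (x₀ := x₀)
      (cond := okBackE k) (nb := nb) (ok := okB) ((regb 0 (by omega) (by norm_num)).trans h0)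
      ((regb 4 (by omega) (by norm_num)).trans h4) ((regb 20 (by omega) (by norm_num)).trans h20)
      (by norm_num) hkB hrun hx₀ hn
      (fun v hv => (lowb 1 0 v (by norm_num)).trans (ha v hv).1) hA.nodup hA.lt ?_
      (fun j hj u => ⟨?_, ?_⟩) ?_).mono le_rfl ?_)
    · rw [b3 _ _ _ (by unfold SideTag tQ; omega)]
      exact q₃.2
    · rw [b3 _ _ _ (by unfold SideTag tQ; omega), s₃ _ _ _ (by unfold tQ; omega)]
      exact hfresh _ (by unfold tQ; omega) u
    · rw [b3 _ _ _ (by unfold SideTag tF; omega), s₃ _ _ _ (by unfold tF tQ; omega)]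
      exact hfresh _ (by unfold tF; omega) u
    · intro j hj d v hd hds hu hv
      obtain ⟨z, hz1, hz, hz'⟩ := hokE d v (2 * k - (j + 1)) (fun r hr => (hd r hr).trans (b1 r hr))
        (fun t r u ht => (hds t r u (by unfold SideTag; omega)).trans (lowb t r u ht)) hu
      unfold okBackE
      split_ifs with hjk
      · have hlenE : M.Evals (lenE (tF 0 k) (.reg 4) (.reg 10)) d
            (d.st (tF 0 k) run (d.reg 10)).length :=
          Evals.len ((hd 0 (by omega)).trans ((regb 0 (by omega) (by norm_num)).trans h0))
            (by unfold tF; omega) (by unfold tF; omega)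
            (.reg' ((hd 4 (by omega)).trans ((regb 4 (by omega) (by norm_num)).trans h4))) (.reg 10)
            hrun (by have := hA.lt v _ hu; omega)
        rw [hds _ _ _ (by unfold SideTag tF; omega)] at hlenE
        have hreach : 0 < (b.st (tF 0 k) run (d.reg 10)).length ↔ Reach nb ok x₀ k (d.reg 10) := by
          rw [← b4.mem_iff_reach le_rfl, List.length_pos_iff]
          have := b4.mem j hj (d.reg 10)
          rw [hjk] at this
          exact this.symm
        by_cases hR : Reach nb ok x₀ k (d.reg 10)
        · refine ⟨z * 1, hz.mul (((Evals.lit (c := 0) (by positivity)).lt hlenE).congr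
            (if_pos (hreach.2 hR))) ?_, ?_⟩
          · rw [mul_one]
            exact hz1.trans_lt one_lt_two_pow
          · rw [mul_one, hz']
            exact ⟨fun h => ⟨h, fun _ => hR⟩, fun h => h.1⟩
        · refine ⟨z * 0, hz.mul (((Evals.lit (c := 0) (by positivity)).lt hlenE).congr
            (if_neg fun h => hR (hreach.1 h))) (by positivity), ?_⟩
          simp only [mul_zero, ne_eq, not_true_eq_false, false_iff]
          exact fun h => hR (h.2 hjk)
      · refine ⟨z, hz, hz'.trans ⟨fun h => ⟨h, fun h' => absurd h' hjk⟩, fun h => h.1⟩⟩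
    rintro d ⟨d1, d2, d3, d4⟩
    have regd : ∀ r, (r < 7 ∨ 20 ≤ r) → r ≠ 6 → d.reg r = a.reg r := fun r hr hr' =>
      (d1 r hr).trans (regb r hr hr')
    have lowd : ∀ t r u, t < 3 → d.st t r u = a.st t r u := fun t r u ht =>
      (d3 t r u (by unfold SideTag; omega)).trans (lowb t r u ht)
    have htup : tuple d = tuple a := funext fun i => regd _ (by omega) (by omega)
    have htup0 : tuple d 0 = x₀ := by rw [htup]; exact h20
    set T : ℕ → ℕ → List ℕ := fun t u => d.st t run u with hT
    have L₀ : Layers nb ok (tuple d 0) k (fun j => T (tQ 0 j) (tuple d 0))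
        (fun j u => T (tF 0 j) u) := by
      have e1 : (fun j => T (tQ 0 j) x₀) = fun j => b.st (tQ 0 j) run x₀ :=
        funext fun j => d3 _ _ _ (by unfold SideTag tQ; omega)
      have e2 : (fun j u => T (tF 0 j) u) = fun j u => b.st (tF 0 j) run u :=
        funext fun j => funext fun u => d3 _ _ _ (by unfold SideTag tF; omega)
      rw [htup0, e1, e2]
      exact b4
    have L₁ : Layers nb okB (tuple d 0) k (fun j => T (tQ 1 j) (tuple d 0))
        (fun j u => T (tF 1 j) u) := by rw [htup0]; exact d4
    have hokB' : ∀ j u, 1 ≤ j → j ≤ k →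
        (okB j u ↔ ok (2 * k - j) u ∧ (j = k → T (tF 0 k) u ≠ [])) := by
      intro j u hj1 hj2
      have h1 := L₀.mem_iff_reach le_rfl u
      have h2 := L₀.mem (k - 1) (by omega) u
      rw [show k - 1 + 1 = k by omega] at h2
      rw [htup0] at h1 h2
      rw [hokB, AllowedBack, ← h1, h2]
    have hwalks : ∀ y, y ∈ walks T (links k) (tuple d) ↔ ClosedWalk k nb ok (tuple a) y := fun y => by
      rw [← htup]
      exact mem_walks_links hk hA.symm L₀ L₁ hokB'
    obtain ⟨hZ, hZnd, hZne⟩ := entries_links hk L₀ L₁ hokB'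
    have hlt₀ := fun j (hj : j ≤ k) => L₀.lt (n := n) (by rwa [htup0]) hA.lt hj
    have hlt₁ := fun j (hj : j ≤ k) => L₁.lt (n := n) (by rwa [htup0]) hA.lt hj
    have hZn : ∀ i, ∀ u ∈ entries k T (tuple d 0) i, u < n := by
      intro i u hu
      unfold entries at hu
      split_ifs at hu with g1 g2
      · rw [Set.mem_singleton_iff] at hu
        rwa [hu, htup0]
      · exact hlt₀ i g2.le u hu
      · exact hlt₁ (2 * k - i) (by omega) u hu.2
    have hZB : ∀ i, ∀ u ∈ entries k T (tuple d 0) i, u < M.B := fun i u hu => by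
      have := hZn i u hu
      omega
    have hsrc : ∀ p ∈ links k, tuple d p.src ∈ entries k T (tuple d 0) p.src ∨
        p.src ∈ dsts (links k) := by
      refine forall_mem_links.2 ⟨?_, fun i hi => Or.inr ?_, fun i hi => Or.inr ?_⟩
      · left
        simp [entries]
      · rw [mem_dsts_links hk]; simp only; omega
      · rw [mem_dsts_links hk]; simp only; omega
    have hnodup := nodup_walks hZ hZnd hsrc (linked_links hk)
    have hen := Tri.enum (M := M) (a := d) (leaf := leafP (2 * k)) (cl := cl) (run := run)
      (f := leafOut (2 * k) p (rank rl)) (T := T) (Z := entries k T (tuple d 0)) (ls := links k)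
      ((regd 0 (by omega) (by norm_num)).trans h0) ((regd 4 (by omega) (by norm_num)).trans h4)
      hrun (fun _ _ => rfl)
      (forall_mem_links.2 ⟨by simp only [tQ]; omega, fun i hi => by simp only [tF]; omega,
        fun i hi => by simp only [tF]; omega⟩) hZB ?_ hZ hZne hsrc (linked_links hk) ?_
    · refine hen.mono ?_ ?_
      · have := hW _ hnodup fun y hy => (hwalks y).1 hy
        gcongr
      · rintro e ⟨e1, e2, e3⟩
        refine ⟨fun r hr => (e1.low r (by omega)).trans (regd r (by omega) (by omega)),
          fun i => (e1.col i).trans (regd _ (by omega) (by omega)), fun t r u htr => ?_,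
          walks T (links k) (tuple d), hnodup, hwalks, ?_⟩
        · rw [e1.st, d3 t r u, b3 t r u, s₃ t r u]
          · unfold tQ; omega
          · unfold SideTag; omega
          · unfold SideTag; omega
        · rw [e3, d2, b2]
    · intro q hq u hu
      have := list_length_le_of_nodup (hZnd q hq u hu) fun v hv => hZn _ v (hZ q hq u hu v hv)
      omega
    · intro e he hy
      have hcw := (hwalks _).1 hy
      have hres : ∀ i < 2 * k, rank rl (tuple e i) % p = c i := by
        intro i hi
        rcases Nat.eq_zero_or_pos i with rfl | hi0
        · rw [hcw.base 0 (Or.inl rfl)]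
          change rank rl (a.reg 20) % p = c 0
          rw [h20, hc0]
        · exact (hcw.ok i hi0 hi).1
      have hnbi : ∀ i < 2 * k, nb (tuple e i) ≠ [] ∧ tuple e i < n := by
        intro i hi
        rcases Nat.eq_zero_or_pos i with rfl | hi0
        · rw [hcw.base 0 (Or.inl rfl)]
          change nb (a.reg 20) ≠ [] ∧ a.reg 20 < n
          rw [h20]
          exact ⟨hne, hx₀⟩
        · have := hcw.adj (i - 1) (by omega)
          rw [show i - 1 + 1 = i by omega] at this
          exact ⟨hA.ne_nil_of_mem this, hA.lt _ _ this⟩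
      have hnd : ((List.range (2 * k)).map fun i => rank rl (tuple e i)).Nodup := by
        refine List.Nodup.of_map (· % p) ?_
        rw [List.map_map]
        have : (List.range (2 * k)).map ((· % p) ∘ fun i => rank rl (tuple e i)) =
            (List.range (2 * k)).map c :=
          List.map_congr_left fun i hi => hres i (List.mem_range.1 hi)
        rwa [this]
      refine Tri.leaf (X := X) ((he.low 0 (by norm_num)).trans ((regd 0 (by omega) (by norm_num)).trans h0))
        ((he.low 1 (by norm_num)).trans ((regd 1 (by omega) (by norm_num)).trans h1)) (by omega) hNB hX
        hXB (fun i hi => ⟨?_, hrX _, ?_⟩) hnd ?_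
      · have := (hnbi i hi).2
        omega
      · obtain ⟨l, hl⟩ := hA.exists_cons (hnbi i hi).1
        refine ⟨l, ?_⟩
        rw [he.st, lowd 2 0 _ (by norm_num), (ha _ (hnbi i hi).2).2, hl]
      · have h1 := two_pow_leastNonDvd_le (Nat.pos_of_ne_zero (prodDiff_ne_zero.2 hnd))
        have h2 := prodDiff_le (l := (List.range (2 * k)).map fun i => rank rl (tuple e i)) hX
          (fun y hy => by obtain ⟨i, -, rfl⟩ := List.mem_map.1 hy; exact hrX _)
        rw [List.length_map, List.length_range] at h2
        have h3 : 2 ^ leastNonDvd (prodDiff ((List.range (2 * k)).map fun i => rank rl (tuple e i))) <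
            2 ^ (N + 1) := (h1.trans (by gcongr)).trans_lt hN
        have := (Nat.pow_lt_pow_iff_right (by norm_num)).1 h3
        omega
  · have hleaf : (leafP (2 * k)).size ≤ (enumP (leafP (2 * k)) (links k)).size := by
      generalize links k = ls
      induction ls with
      | nil => exact le_rfl
      | cons q ls ih => exact ih.trans (by simp only [enumP, forP, Program.size]; omega)
    exact search_arith (Nat.le_add_right _ _) hleaf

end EvenCycles

namespace EvenCycles

open WordRAM Machine

/-! ### The stored graph -/

variable {n : ℕ}

/-- The neighbours of `v`, in the order in which they occur in the edge list. -/
def nbOf (L : List (Fin n × Fin n)) (v : ℕ) : List ℕ :=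
  L.flatMap fun e => (if (e.1 : ℕ) = v then [(e.2 : ℕ)] else []) ++
    (if (e.2 : ℕ) = v then [(e.1 : ℕ)] else [])

/-- The tail of the arc with number `i`: the arcs `2 * j` and `2 * j + 1` are the two orientations
of the `j`-th edge. -/
def tailOf (L : List (Fin n × Fin n)) (i : ℕ) : ℕ := (encodeInput L).getD (i + 2) 0

/-- The numbers of the arcs with tail `v`. -/
def rlOf (L : List (Fin n × Fin n)) (v : ℕ) : List ℕ :=
  (List.range (2 * L.length)).filter fun i => tailOf L i = v

theorem getD_flatMap_pair (L : List (Fin n × Fin n)) (j : ℕ) (hj : j < L.length) :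
    (L.flatMap fun e => [(e.1 : ℕ), (e.2 : ℕ)]).getD (2 * j) 0 = L[j].1 ∧
    (L.flatMap fun e => [(e.1 : ℕ), (e.2 : ℕ)]).getD (2 * j + 1) 0 = L[j].2 := by
  induction L generalizing j with
  | nil => simp at hj
  | cons e L ih =>
    cases j with
    | zero => simp
    | succ j =>
      have := ih j (by simpa using hj)
      rw [show 2 * (j + 1) = 2 * j + 2 by ring, show 2 * j + 2 + 1 = 2 * j + 1 + 2 by ring]
      simpa using this

variable {L : List (Fin n × Fin n)}

theorem tailOf_two_mul {j : ℕ} (hj : j < L.length) : tailOf L (2 * j) = L[j].1 :=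
  (getD_flatMap_pair L j hj).1

theorem tailOf_two_mul_add_one {j : ℕ} (hj : j < L.length) : tailOf L (2 * j + 1) = L[j].2 :=
  (getD_flatMap_pair L j hj).2

theorem length_encodeInput : (encodeInput L).length = 2 * L.length + 2 := by
  simp [encodeInput, List.length_flatMap, mul_comm]

theorem mem_nbOf {u v : ℕ} : u ∈ nbOf L v ↔
    ∃ e ∈ L, ((e.1 : ℕ) = v ∧ (e.2 : ℕ) = u) ∨ ((e.2 : ℕ) = v ∧ (e.1 : ℕ) = u) := by
  unfold nbOf
  rw [List.mem_flatMap]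
  refine exists_congr fun e => and_congr_right fun _ => ?_
  rw [List.mem_append]
  split_ifs <;> simp_all [eq_comm]

theorem exists_of_tailOf {i : ℕ} (hi : i < 2 * L.length) :
    ∃ h : i / 2 < L.length, tailOf L i = L[i / 2].1 ∨ tailOf L i = L[i / 2].2 := by
  refine ⟨by omega, ?_⟩
  rcases Nat.even_or_odd' i with ⟨j, rfl | rfl⟩
  · left
    rw [tailOf_two_mul (by omega)]
    congr 3; omega
  · right
    rw [tailOf_two_mul_add_one (by omega)]
    congr 3; omega

theorem tailOf_spec {i : ℕ} (hi : i < 2 * L.length) :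
    tailOf L i < n ∧ nbOf L (tailOf L i) ≠ [] := by
  obtain ⟨h, h' | h'⟩ := exists_of_tailOf hi <;> rw [h']
  · exact ⟨Fin.is_lt _, List.ne_nil_of_mem (mem_nbOf.2 ⟨_, List.getElem_mem h, Or.inl ⟨rfl, rfl⟩⟩)⟩
  · exact ⟨Fin.is_lt _, List.ne_nil_of_mem (mem_nbOf.2 ⟨_, List.getElem_mem h, Or.inr ⟨rfl, rfl⟩⟩)⟩

theorem mem_rlOf {i v : ℕ} : i ∈ rlOf L v ↔ i < 2 * L.length ∧ tailOf L i = v := by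
  simp [rlOf]

theorem rlOf_ne_nil {v : ℕ} (h : nbOf L v ≠ []) : rlOf L v ≠ [] := by
  obtain ⟨u, hu⟩ := List.exists_mem_of_ne_nil _ h
  obtain ⟨e, he, h' | h'⟩ := mem_nbOf.1 hu <;> obtain ⟨j, hj, rfl⟩ := List.mem_iff_getElem.1 he
  · exact List.ne_nil_of_mem (mem_rlOf.2 ⟨by omega, (tailOf_two_mul hj).trans h'.1⟩)
  · exact List.ne_nil_of_mem (mem_rlOf.2 ⟨by omega, (tailOf_two_mul_add_one hj).trans h'.1⟩)

theorem rank_mem {v : ℕ} (h : nbOf L v ≠ []) : rank (rlOf L) v ∈ rlOf L v := by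
  have := rlOf_ne_nil h
  unfold rank
  cases hl : rlOf L v with
  | nil => exact absurd hl this
  | cons r l => simp

theorem rank_lt {v : ℕ} (h : nbOf L v ≠ []) : rank (rlOf L) v < 2 * L.length :=
  (mem_rlOf.1 (rank_mem h)).1

theorem tailOf_rank {v : ℕ} (h : nbOf L v ≠ []) : tailOf L (rank (rlOf L) v) = v :=
  (mem_rlOf.1 (rank_mem h)).2

theorem rank_le (v : ℕ) : rank (rlOf L) v ≤ 2 * L.length := by
  unfold rank
  cases hl : rlOf L v with
  | nil => simp
  | cons r l => exact (mem_rlOf.1 (hl ▸ List.mem_cons_self : r ∈ rlOf L v)).1.le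

theorem mem_nbOf_iff_adj {G : SimpleGraph (Fin n)} (hL : IsEdgeList G L) {u v : Fin n} :
    (u : ℕ) ∈ nbOf L v ↔ G.Adj v u := by
  rw [mem_nbOf, ← hL.2, List.mem_map]
  refine exists_congr fun e => and_congr_right fun _ => ?_
  rw [Sym2.eq_iff]
  simp only [Fin.ext_iff]
  tauto

theorem lt_of_mem_nbOf {u v : ℕ} (h : u ∈ nbOf L v) : u < n ∧ v < n := by
  obtain ⟨e, -, ⟨rfl, rfl⟩ | ⟨rfl, rfl⟩⟩ := mem_nbOf.1 h <;> exact ⟨Fin.is_lt _, Fin.is_lt _⟩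

theorem arcData {G : SimpleGraph (Fin n)} (hL : IsEdgeList G L) : ArcData n (nbOf L) (rlOf L) where
  nodup v := by
    have hloop : ∀ e ∈ L, (e.1 : ℕ) ≠ e.2 := by
      intro e he h
      have h1 : G.Adj e.1 e.2 := (hL.2 e.1 e.2).1 (List.mem_map.2 ⟨e, he, rfl⟩)
      exact h1.ne (Fin.ext h)
    have hp := List.pairwise_map.1 hL.1
    unfold nbOf
    rw [List.nodup_flatMap]
    refine ⟨fun e he => ?_, hp.imp fun {e e'} hne x hx hx' => hne ?_⟩
    · have := hloop e he
      split_ifs <;> simp_all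
    · have key : ∀ e : Fin n × Fin n, x ∈ (if (e.1 : ℕ) = v then [(e.2 : ℕ)] else []) ++
          (if (e.2 : ℕ) = v then [(e.1 : ℕ)] else []) →
          ((e.1 : ℕ) = v ∧ (e.2 : ℕ) = x) ∨ ((e.2 : ℕ) = v ∧ (e.1 : ℕ) = x) := by
        intro e h
        rw [List.mem_append] at h
        split_ifs at h <;> simp_all
      have h1 := key e hx
      have h2 := key e' hx'
      rw [Sym2.eq_iff]
      simp only [Fin.ext_iff]
      omega
  lt v u hu := (lt_of_mem_nbOf hu).1
  symm u v := by
    rw [mem_nbOf, mem_nbOf]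
    exact exists_congr fun e => and_congr_right fun _ => by tauto
  ne_nil v := rlOf_ne_nil

/-! ### Tuples of vertices -/

/-- A tuple of vertices as a sequence of numbers. -/
def ext {ℓ : ℕ} (v : Fin ℓ → Fin n) (i : ℕ) : ℕ := if h : i < ℓ then v ⟨i, h⟩ else 0

theorem ext_of_lt {ℓ : ℕ} {v : Fin ℓ → Fin n} {i : ℕ} (h : i < ℓ) : ext v i = v ⟨i, h⟩ := dif_pos h

theorem finRotate_of_lt {ℓ i : ℕ} (h : i + 1 < ℓ) : finRotate ℓ ⟨i, by omega⟩ = ⟨i + 1, h⟩ := by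
  obtain ⟨m, rfl⟩ : ∃ m, ℓ = m + 1 := ⟨ℓ - 1, by omega⟩
  exact _root_.finRotate_of_lt (by omega)

theorem finRotate_of_last {ℓ : ℕ} (h : 0 < ℓ) : finRotate ℓ ⟨ℓ - 1, by omega⟩ = ⟨0, h⟩ := by
  obtain ⟨m, rfl⟩ : ∃ m, ℓ = m + 1 := ⟨ℓ - 1, by omega⟩
  exact finRotate_last'

theorem isCycleTuple_iff {G : SimpleGraph (Fin n)} (hL : IsEdgeList G L) {ℓ : ℕ} (hℓ : 0 < ℓ)
    {v : Fin ℓ → Fin n} : IsCycleTuple G v ↔ Function.Injective v ∧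
      (∀ i, i + 1 < ℓ → ext v (i + 1) ∈ nbOf L (ext v i)) ∧ ext v 0 ∈ nbOf L (ext v (ℓ - 1)) := by
  constructor
  · rintro ⟨h1, h2⟩
    refine ⟨h1, fun i hi => ?_, ?_⟩
    · rw [ext_of_lt hi, ext_of_lt (show i < ℓ by omega), mem_nbOf_iff_adj hL, ← finRotate_of_lt hi]
      exact h2 _
    · rw [ext_of_lt hℓ, ext_of_lt (show ℓ - 1 < ℓ by omega), mem_nbOf_iff_adj hL,
        ← finRotate_of_last hℓ]
      exact h2 _
  · rintro ⟨h1, h2, h3⟩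
    refine ⟨h1, fun i => ?_⟩
    rw [← mem_nbOf_iff_adj hL]
    by_cases hi : (i : ℕ) + 1 < ℓ
    · have := h2 i hi
      rwa [ext_of_lt hi, ext_of_lt i.2, ← finRotate_of_lt hi] at this
    · have hil : i = ⟨ℓ - 1, by omega⟩ := Fin.ext (by have := i.2; simp only; omega)
      rw [ext_of_lt hℓ, ext_of_lt (show ℓ - 1 < ℓ by omega), ← finRotate_of_last hℓ, ← hil] at h3
      exact h3

/-- Among the tuples that traverse the same cycle, the canonical one starts with the vertex with the
largest key, and its second entry is smaller than its last. -/
structure Canonical (G : SimpleGraph (Fin n)) (L : List (Fin n × Fin n)) {ℓ : ℕ}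
    (v : Fin ℓ → Fin n) : Prop where
  cycle : IsCycleTuple G v
  top : ∀ i, 1 ≤ i → i < ℓ → vkey n (nbOf L) (ext v i) < vkey n (nbOf L) (ext v 0)
  dir : ext v 1 < ext v (ℓ - 1)

/-- The modulus by which the algorithm separates the entries of a tuple. -/
noncomputable def modulus (L : List (Fin n × Fin n)) {ℓ : ℕ} (v : Fin ℓ → Fin n) : ℕ :=
  leastNonDvd (prodDiff ((List.range ℓ).map fun i => rank (rlOf L) (ext v i)))

/-- The word sequence `out` is the concatenation of the tuples in `S`, each taken once. -/
def Lists {ℓ : ℕ} (out : List ℕ) (S : Set (Fin ℓ → Fin n)) : Prop :=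
  ∃ cs : List (Fin ℓ → Fin n), cs.Nodup ∧ (∀ v, v ∈ cs ↔ v ∈ S) ∧
    out = cs.flatMap fun v => List.ofFn fun i => (v i : ℕ)

theorem Lists.append {ℓ : ℕ} {o₁ o₂ : List ℕ} {S₁ S₂ S : Set (Fin ℓ → Fin n)} (h₁ : Lists o₁ S₁)
    (h₂ : Lists o₂ S₂) (hd : ∀ v ∈ S₁, v ∉ S₂) (hS : ∀ v, v ∈ S ↔ v ∈ S₁ ∨ v ∈ S₂) :
    Lists (o₁ ++ o₂) S := by
  obtain ⟨c₁, n₁, m₁, rfl⟩ := h₁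
  obtain ⟨c₂, n₂, m₂, rfl⟩ := h₂
  refine ⟨c₁ ++ c₂, ?_, fun v => by rw [List.mem_append, m₁, m₂, hS], by simp⟩
  rw [List.nodup_append]
  refine ⟨n₁, n₂, fun v hv w hw hvw => ?_⟩
  subst hvw
  exact hd v ((m₁ v).1 hv) ((m₂ v).1 hw)

theorem Lists.congr {ℓ : ℕ} {o : List ℕ} {S S' : Set (Fin ℓ → Fin n)} (h : Lists o S)
    (hS : ∀ v, v ∈ S' ↔ v ∈ S) : Lists o S' := by
  rwa [show S' = S from Set.ext hS]

theorem Lists.nil {ℓ : ℕ} {S : Set (Fin ℓ → Fin n)} (h : ∀ v, v ∉ S) : Lists [] S :=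
  ⟨[], by simp, fun v => by simp [h v], by simp⟩

/-- The entries of a sequence below `n`, as a tuple; `z` is used where an entry is too large. -/
def toTuple (ℓ : ℕ) (z : Fin n) (y : ℕ → ℕ) : Fin ℓ → Fin n := fun i =>
  if h : y i < n then ⟨y i, h⟩ else z

theorem ext_toTuple {ℓ : ℕ} {z : Fin n} {y : ℕ → ℕ} {i : ℕ} (hi : i < ℓ) (h : y i < n) :
    ext (toTuple ℓ z y) i = y i := by
  rw [ext_of_lt hi, toTuple]
  simp [h]

section search

variable {G : SimpleGraph (Fin n)} {k p : ℕ} {c : ℕ → ℕ} {x₀ : Fin n} {x y : ℕ → ℕ}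

theorem ClosedWalk.lt (hk : 2 ≤ k) {ok : ℕ → ℕ → Prop} (h : ClosedWalk k (nbOf L) ok x y) {i : ℕ}
    (hi : i < 2 * k) : y i < n := by
  by_cases hi' : i + 1 < 2 * k
  · exact (lt_of_mem_nbOf (h.adj i hi')).2
  · obtain rfl : i = 2 * k - 1 := by omega
    exact (lt_of_mem_nbOf h.last).2

/-- The closed walks found by a search traverse cycles. -/
theorem ClosedWalk.isCycleTuple (hL : IsEdgeList G L) (hk : 2 ≤ k)
    (hc : ((List.range (2 * k)).map c).Nodup) (hc0 : rank (rlOf L) (x 0) % p = c 0)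
    (h : ClosedWalk k (nbOf L) (Allowed n (nbOf L) (rlOf L) p c x₀) x y) :
    IsCycleTuple G (toTuple (2 * k) x₀ y) := by
  have he : ∀ i < 2 * k, ext (toTuple (2 * k) x₀ y) i = y i := fun i hi => ext_toTuple hi (h.lt hk hi)
  have hcol : ∀ i < 2 * k, rank (rlOf L) (y i) % p = c i := by
    intro i hi
    rcases Nat.eq_zero_or_pos i with rfl | hi0
    · rw [h.base 0 (Or.inl rfl), hc0]
    · exact (h.ok i hi0 hi).1
  rw [isCycleTuple_iff hL (by omega)]
  refine ⟨fun i j hij => ?_, fun i hi => ?_, ?_⟩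
  · have h1 : y i = y j := by
      rw [← he i i.2, ← he j j.2, ext_of_lt i.2, ext_of_lt j.2]
      exact congrArg Fin.val hij
    have h2 : c i = c j := by rw [← hcol i i.2, ← hcol j j.2, h1]
    have h3 := List.inj_on_of_nodup_map hc (List.mem_range.2 i.2) (List.mem_range.2 j.2) h2
    exact Fin.ext h3
  · rw [he _ hi, he _ (by omega)]
    exact h.adj i hi
  · rw [he _ (by omega), he _ (by omega)]
    exact h.last

theorem toTuple_injective_of_base (hk : 2 ≤ k) {ok : ℕ → ℕ → Prop} {y' : ℕ → ℕ}
    (h : ClosedWalk k (nbOf L) ok x y) (h' : ClosedWalk k (nbOf L) ok x y')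
    (he : toTuple (2 * k) x₀ y = toTuple (2 * k) x₀ y') : y = y' := by
  funext i
  by_cases hi : i < 2 * k
  · rw [← ext_toTuple (z := x₀) hi (h.lt hk hi), ← ext_toTuple (z := x₀) hi (h'.lt hk hi), he]
  · rw [h.base i (by omega), h'.base i (by omega)]

open Classical in
/-- The number of closed walks found by a search from `x₀` is at most the number of tuples that
start with `x₀` and traverse a cycle. -/
theorem length_le_of_closedWalk (hL : IsEdgeList G L) (hk : 2 ≤ k)
    (hc : ((List.range (2 * k)).map c).Nodup) (hx : x 0 = x₀) (hc0 : rank (rlOf L) x₀ % p = c 0)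
    {ys : List (ℕ → ℕ)} (hys : ys.Nodup)
    (h : ∀ y ∈ ys, ClosedWalk k (nbOf L) (Allowed n (nbOf L) (rlOf L) p c x₀) x y) :
    ys.length ≤ (Finset.univ.filter fun v : Fin (2 * k) → Fin n =>
      IsCycleTuple G v ∧ ext v 0 = x₀).card := by
  have hnd : (ys.map (toTuple (2 * k) x₀)).Nodup :=
    List.Nodup.map_on (fun y hy y' hy' he => toTuple_injective_of_base hk (h y hy) (h y' hy') he) hys
  rw [← List.length_map (toTuple (2 * k) x₀), ← List.toFinset_card_of_nodup hnd]
  refine Finset.card_le_card fun v hv => ?_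
  rw [List.mem_toFinset, List.mem_map] at hv
  obtain ⟨y, hy, rfl⟩ := hv
  rw [Finset.mem_filter]
  refine ⟨Finset.mem_univ _, (h y hy).isCycleTuple hL hk hc (by rw [hx, hc0]), ?_⟩
  rw [ext_toTuple (by omega) ((h y hy).lt hk (by omega)), (h y hy).base 0 (Or.inl rfl), hx]

/-- The output of a search. -/
theorem lists_search (hL : IsEdgeList G L) (hk : 2 ≤ k)
    (hc : ((List.range (2 * k)).map c).Nodup) (hx : x 0 = x₀) (hc0 : rank (rlOf L) x₀ % p = c 0)
    {ys : List (ℕ → ℕ)} (hys : ys.Nodup)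
    (h : ∀ y, y ∈ ys ↔ ClosedWalk k (nbOf L) (Allowed n (nbOf L) (rlOf L) p c x₀) x y) :
    Lists (ys.flatMap (leafOut (2 * k) p (rank (rlOf L))))
      {v : Fin (2 * k) → Fin n | Canonical G L v ∧ modulus L v = p ∧
        (∀ i < 2 * k, rank (rlOf L) (ext v i) % p = c i) ∧ ext v 0 = x₀} := by
  classical
  have he : ∀ y ∈ ys, ∀ i < 2 * k, ext (toTuple (2 * k) x₀ y) i = y i := fun y hy i hi =>
    ext_toTuple hi (((h y).1 hy).lt hk hi)
  have hmod : ∀ y ∈ ys, modulus L (toTuple (2 * k) x₀ y) =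
      leastNonDvd (prodDiff ((List.range (2 * k)).map fun i => rank (rlOf L) (y i))) := by
    intro y hy
    unfold modulus
    congr 2
    exact List.map_congr_left fun i hi => by rw [he y hy i (List.mem_range.1 hi)]
  refine ⟨(ys.filter fun y => Chosen (2 * k) p (rank (rlOf L)) y).map (toTuple (2 * k) x₀), ?_, ?_, ?_⟩
  · refine List.Nodup.map_on (fun y hy y' hy' he => ?_) (hys.filter _)
    exact toTuple_injective_of_base hk ((h y).1 (List.mem_filter.1 hy).1)
      ((h y').1 (List.mem_filter.1 hy').1) he
  · intro v
    simp only [List.mem_map, List.mem_filter, decide_eq_true_eq, Set.mem_ofPred_eq]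
    constructor
    · rintro ⟨y, ⟨hy, hm, hd⟩, rfl⟩
      have hw := (h y).1 hy
      have hy0 : y 0 = x₀ := (hw.base 0 (Or.inl rfl)).trans hx
      refine ⟨⟨hw.isCycleTuple hL hk hc (by rw [hx, hc0]), fun i hi1 hi2 => ?_, ?_⟩, ?_,
        fun i hi => ?_, ?_⟩
      · rw [he y hy i hi2, he y hy 0 (by omega), hy0]
        exact (hw.ok i hi1 hi2).2
      · rwa [he y hy _ (by omega), he y hy _ (by omega)]
      · rw [hmod y hy, hm]
      · rw [he y hy i hi]
        rcases Nat.eq_zero_or_pos i with rfl | hi0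
        · rw [hy0, hc0]
        · exact (hw.ok i hi0 hi).1
      · rw [he y hy 0 (by omega), hy0]
    · rintro ⟨⟨hcyc, htop, hdir⟩, hm, hcol, hv0⟩
      obtain ⟨-, hadj, hlast⟩ := (isCycleTuple_iff hL (by omega)).1 hcyc
      set y : ℕ → ℕ := fun i => if i < 2 * k then ext v i else x i with hy
      have hyv : ∀ i < 2 * k, y i = ext v i := fun i hi => if_pos hi
      have hw : ClosedWalk k (nbOf L) (Allowed n (nbOf L) (rlOf L) p c x₀) x y := by
        refine ⟨fun i hi => ?_, fun i hi1 hi2 => ?_, fun i hi => ?_, ?_⟩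
        · rcases hi with rfl | hi
          · rw [hyv 0 (by omega), hv0, hx]
          · exact if_neg (by omega)
        · rw [hyv i hi2]
          refine ⟨hcol i hi2, ?_⟩
          have := htop i hi1 hi2
          rwa [hv0] at this
        · rw [hyv _ hi, hyv _ (by omega)]
          exact hadj i hi
        · rw [hyv _ (by omega), hyv _ (by omega)]
          exact hlast
      have hyys := (h y).2 hw
      have hty : toTuple (2 * k) x₀ y = v := by
        funext i
        have := he y hyys i i.2
        rw [hyv i i.2, ext_of_lt i.2, ext_of_lt i.2] at this
        exact Fin.ext this
      refine ⟨y, ⟨hyys, ?_, ?_⟩, hty⟩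
      · rw [← hmod y hyys, hty, hm]
      · rwa [hyv _ (by omega), hyv _ (by omega)]
  · have : ∀ l : List (ℕ → ℕ), (∀ y ∈ l, y ∈ ys) →
        l.flatMap (leafOut (2 * k) p (rank (rlOf L))) =
          ((l.filter fun y => Chosen (2 * k) p (rank (rlOf L)) y).map (toTuple (2 * k) x₀)).flatMap
            fun v => List.ofFn fun i => (v i : ℕ) := by
      intro l hl
      induction l with
      | nil => simp
      | cons y l ih =>
        rw [List.forall_mem_cons] at hl
        rw [List.flatMap_cons, ih hl.2]
        by_cases hch : Chosen (2 * k) p (rank (rlOf L)) y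
        · rw [List.filter_cons_of_pos (by simpa using hch), List.map_cons, List.flatMap_cons]
          congr 1
          rw [leafOut, if_pos hch]
          refine List.ext_getElem (by simp) fun i h1 h2 => ?_
          rw [List.length_map, List.length_range] at h1
          have := he y hl.1 i h1
          rw [ext_of_lt h1] at this
          simp [this]
        · rw [List.filter_cons_of_neg (by simpa using hch), leafOut, if_neg hch, List.nil_append]
    exact this ys fun y hy => hy

end search

end EvenCycles

namespace EvenCycles

open WordRAM Machine

/-! ### The program -/

/-- The power `e ^ j`. -/
def powE (e : Expr) : ℕ → Expr
  | 0 => .lit 1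
  | j + 1 => .bin .mul (powE e j) e

/-- Store the edges: register `5` runs through the edges, register `9` and `10` hold their ends. -/
def storeEdgesP : Program :=
  forP 5 (.load (.lit 1)) <|
    .seq (.assign 9 (.load (.bin .add (.bin .mul (.reg 5) (.lit 2)) (.lit 2)))) <|
    .seq (.assign 10 (.load (.bin .add (.bin .mul (.reg 5) (.lit 2)) (.lit 3)))) <|
    .seq (pushP 1 (.lit 0) (.reg 9) (.reg 10)) <|
    .seq (pushP 1 (.lit 0) (.reg 10) (.reg 9)) <|
    .seq (pushP 2 (.lit 0) (.reg 9) (.bin .mul (.reg 5) (.lit 2)))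
      (pushP 2 (.lit 0) (.reg 10) (.bin .add (.bin .mul (.reg 5) (.lit 2)) (.lit 1)))

/-- Search from the tail of the arc in register `5`, if this is the first arc with this tail and the
tail has the colour of position `0`. Register `4` counts the searches. -/
def vertexP (k : ℕ) : Program :=
  .seq (.assign 20 (.load (.bin .add (.reg 5) (.lit 2)))) <|
  .seq (.ite (.bin .mul (.bin .eq (rankE (.reg 20)) (.reg 5))
      (.bin .eq (.bin .mod (.reg 5) (.reg 1)) (.reg 21))) (searchP k) .skip)
    (.assign 4 (.bin .add (.reg 4) (.lit 1)))

/-- Decode the colours of the positions, the digits of the number in register `3` in the base in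
register `1`. -/
def colourP (ℓ : ℕ) : Program :=
  seqP ((List.range ℓ).map fun i =>
    .assign (21 + 3 * i) (.bin .mod (.bin .div (.reg 3) (powE (.reg 1) i)) (.reg 1)))

/-- Search from all vertices, provided that the colours are distinct. -/
def codeP (k : ℕ) : Program :=
  .seq (colourP (2 * k)) <|
  .ite (prodDiffE ((List.range (2 * k)).map fun i => .reg (21 + 3 * i)))
    (forP 5 (.bin .mul (.load (.lit 1)) (.lit 2)) (vertexP k)) .skip

/-- Run through all colourings for the modulus in register `1`. -/
def modulusP (k : ℕ) : Program := forP 3 (powE (.reg 1) (2 * k)) (codeP k)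

/-- The program: all moduli `p` are tried for which `2 ^ p`, which is kept in register `2`, is at
most `(m + 2) ^ K`, where `m` is the number of edges. -/
def mainP (k K q : ℕ) : Program :=
  .seq (.assign 0 (powE (.bin .add (.bin .add (.load (.lit 0)) (.load (.lit 1))) (.lit 2)) q)) <|
  .seq storeEdgesP <|
  .seq (.assign 1 (.lit 1)) <|
  .seq (.assign 2 (.lit 2)) <|
  .loop (.bin .lt (.reg 2) (.bin .add (powE (.bin .add (.load (.lit 1)) (.lit 2)) K) (.lit 1))) <|
    .seq (modulusP k) <|
    .seq (.assign 1 (.bin .add (.reg 1) (.lit 1))) (.assign 2 (.bin .mul (.reg 2) (.lit 2)))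

variable {M : Machine} {a : AState} {n : ℕ} {L : List (Fin n × Fin n)}

theorem Evals.powE {e : Expr} {v j : ℕ} (he : M.Evals e a v) (hv : 1 ≤ v) (hw : v ^ j < 2 ^ M.w) :
    M.Evals (powE e j) a (v ^ j) := by
  induction j with
  | zero => exact Evals.lit one_lt_two_pow
  | succ j ih =>
    exact (ih ((Nat.pow_le_pow_right hv (by omega)).trans_lt hw)).mul he hw

/-- The machine holds the encoded edge list. -/
structure Input (M : Machine) (L : List (Fin n × Fin n)) : Prop where
  len : M.len = 2 * L.length + 2
  inp : ∀ i, M.inp i = (encodeInput L).getD i 0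

theorem Input.zero (hM : Input M L) : M.inp 0 = n := by rw [hM.inp]; rfl

theorem Input.one (hM : Input M L) : M.inp 1 = L.length := by rw [hM.inp]; rfl

theorem Evals.edges (hM : Input M L) : M.Evals (.load (.lit 1)) a L.length :=
  (Evals.input (Evals.lit one_lt_two_pow) (by rw [hM.len]; omega)).congr hM.one

theorem nbOf_append (L L' : List (Fin n × Fin n)) (v : ℕ) :
    nbOf (L ++ L') v = nbOf L v ++ nbOf L' v := List.flatMap_append ..

theorem length_nbOf_le (L : List (Fin n × Fin n)) (v : ℕ) : (nbOf L v).length ≤ 2 * L.length := by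
  induction L with
  | nil => simp [nbOf]
  | cons e L ih =>
    rw [show e :: L = [e] ++ L from rfl, nbOf_append, List.length_append, List.length_append]
    have : (nbOf [e] v).length ≤ 2 := by
      simp only [nbOf, List.flatMap_cons, List.flatMap_nil]
      split_ifs <;> simp
    simp only [List.length_singleton]
    omega

theorem Store.push_same (st : Store) (t r u x w : ℕ) :
    st.push t r u x t r w = st t r w ++ if u = w then [x] else [] := by
  unfold Store.push
  split_ifs <;> simp_all

theorem Store.push_of_ne (st : Store) {t t' r u x r' w : ℕ} (h : t' ≠ t) :
    st.push t r u x t' r' w = st t' r' w := if_neg fun h' => h h'.1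

theorem Tri.storeEdges (hM : Input M L) (h0 : a.reg 0 = M.B)
    (hB : 2 * L.length + n + 5 < M.B) (hst : ∀ t r u, a.st t r u = []) :
    M.Tri storeEdgesP a (storeEdgesP.size * (L.length + 1)) fun b =>
      b.reg 0 = M.B ∧ b.reg 4 = a.reg 4 ∧ b.out = a.out ∧ Holds n (nbOf L) (rlOf L) b ∧
      ∀ t, 3 ≤ t → ∀ r u, b.st t r u = [] := by
  set body : Program :=
    .seq (.assign 9 (.load (.bin .add (.bin .mul (.reg 5) (.lit 2)) (.lit 2)))) <|
    .seq (.assign 10 (.load (.bin .add (.bin .mul (.reg 5) (.lit 2)) (.lit 3)))) <|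
    .seq (pushP 1 (.lit 0) (.reg 9) (.reg 10)) <|
    .seq (pushP 1 (.lit 0) (.reg 10) (.reg 9)) <|
    .seq (pushP 2 (.lit 0) (.reg 9) (.bin .mul (.reg 5) (.lit 2)))
      (pushP 2 (.lit 0) (.reg 10) (.bin .add (.bin .mul (.reg 5) (.lit 2)) (.lit 1))) with hbody
  refine (Tri.for (M := M) (a := a) (P := body) (i := 5) (bound := .load (.lit 1)) L.length
    (fun _ => body.size) (fun j b => b.reg 0 = M.B ∧ b.reg 4 = a.reg 4 ∧ b.out = a.out ∧
      (∀ v, b.st 1 0 v = nbOf (L.take j) v) ∧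
      (∀ v, b.st 2 0 v = (List.range (2 * j)).filter fun i => tailOf L i = v) ∧
      ∀ t, 3 ≤ t → ∀ r u, b.st t r u = []) (lt_two_pow (by omega)) ?_ ?_ ?_).mono ?_ ?_
  · refine ⟨h0, rfl, rfl, fun v => ?_, fun v => ?_, fun t _ r u => hst t r u⟩
    · rw [List.take_zero]; exact hst 1 0 v
    · exact hst 2 0 v
  · intro j b _ _ _
    exact Evals.edges hM
  · rintro j b hj h5 ⟨b0, b4, bo, b1, b2, b3⟩
    have hlit : ∀ c, c ≤ 3 → c < 2 ^ M.w := fun c hc => lt_two_pow (by omega)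
    have hin : ∀ c d, c = 2 ∨ c = 3 → ∀ b : AState, b.reg 5 = j → M.inp (j * 2 + c) = d →
        M.Evals (.load (.bin .add (.bin .mul (.reg 5) (.lit 2)) (.lit c))) b d := by
      intro c d hc b h5 hd
      refine (Evals.input ((((Evals.reg' h5).mul (Evals.lit (hlit 2 (by norm_num)))
        (lt_two_pow (by omega))).add (Evals.lit (hlit c (by omega))) (lt_two_pow (by omega)))) ?_).congr hd
      rw [hM.len]; omega
    have e1 : M.inp (j * 2 + 2) = L[j].1 := by
      rw [hM.inp, mul_comm]; exact tailOf_two_mul hj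
    have e2 : M.inp (j * 2 + 3) = L[j].2 := by
      rw [hM.inp, mul_comm]; exact tailOf_two_mul_add_one hj
    set u : ℕ := (L[j].1 : Fin n).val
    set v : ℕ := (L[j].2 : Fin n).val
    have hu : u < n := Fin.is_lt _
    have hv : v < n := Fin.is_lt _
    have hl1 : ∀ w, (b.st 1 0 w).length ≤ 2 * j := fun w => by
      rw [b1]
      refine (length_nbOf_le _ _).trans ?_
      rw [List.length_take]; omega
    have hl2 : ∀ w, (b.st 2 0 w).length ≤ 2 * j := fun w => by
      rw [b2]
      exact (List.length_filter_le _ _).trans (by simp)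
    refine Tri.seq (Tri.assign (hin 2 _ (Or.inl rfl) b h5 e1) (Tri.seq (Tri.assign
      (hin 3 _ (Or.inr rfl) _ (by simp [h5]) e2) (Tri.seq ?_))))
    set b' : AState := { b with reg := Function.update (Function.update b.reg 9 u) 10 v } with hb'
    have r0 : b'.reg 0 = M.B := by simp [hb', b0]
    have r5 : b'.reg 5 = j := by simp [hb', h5]
    have r9 : b'.reg 9 = u := by simp [hb']
    have r10 : b'.reg 10 = v := by simp [hb']
    have hpl : ∀ (st : Store) t r x w t' r' w', ((st.push t r x w) t' r' w').length ≤
        (st t' r' w').length + 1 := by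
      intro st t r x w t' r' w'
      unfold Store.push
      split_ifs with h
      · obtain ⟨rfl, rfl, rfl⟩ := h; simp
      · omega
    have hz : ∀ c : AState, M.Evals (.lit 0) c 0 := fun c => Evals.lit (by positivity)
    have hm : ∀ c : AState, c.reg 5 = j → M.Evals (.bin .mul (.reg 5) (.lit 2)) c (j * 2) :=
      fun c hc => (Evals.reg' hc).mul (Evals.lit (hlit 2 (by norm_num))) (lt_two_pow (by omega))
    refine Tri.push (a := b') r0 le_rfl (by omega) (hz _) (.reg' r9) (.reg' r10) (by omega) (by omega)
      (by have := hl1 u; simp only [hb']; omega) (Tri.seq (Tri.push r0 le_rfl (by omega) (hz _)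
      (.reg' r10) (.reg' r9) (by omega) (by omega) ?_ (Tri.seq (Tri.push
      (a := { b' with st := (b'.st.push 1 0 u v).push 1 0 v u }) r0 (by norm_num) (by omega)
      (hz _) (.reg' r9) (hm _ r5)
      (by omega) (by omega) ?_ (Tri.push
      (a := { b' with st := ((b'.st.push 1 0 u v).push 1 0 v u).push 2 0 u (j * 2) }) r0
      (by norm_num) (by omega) (hz _) (.reg' r10) ((hm { b' with st := ((b'.st.push 1 0 u v).push 1 0 v u).push 2 0 u (j * 2) } r5).add
      (Evals.lit one_lt_two_pow) (lt_two_pow (by omega)))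
      (by omega) (by omega) ?_ ?_)))))
    · have := hpl b'.st 1 0 u v 1 0 v
      have := hl1 v
      simp only [hb'] at *
      omega
    · have := hpl (b'.st.push 1 0 u v) 1 0 v u 2 0 u
      have := hpl b'.st 1 0 u v 2 0 u
      have := hl2 u
      simp only [hb'] at *
      omega
    · have := hpl ((b'.st.push 1 0 u v).push 1 0 v u) 2 0 u (j * 2) 2 0 v
      have := hpl (b'.st.push 1 0 u v) 1 0 v u 2 0 v
      have := hpl b'.st 1 0 u v 2 0 v
      have := hl2 v
      simp only [hb'] at *
      omega
    · refine ⟨r5, by simp [hb', b0], by simp [hb', b4], bo, fun w => ?_, fun w => ?_,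
        fun t ht r w => ?_⟩
      · rw [List.take_add_one, List.getElem?_eq_getElem hj, Option.toList_some, nbOf_append, ← b1]
        change (((b.st.push 1 0 u v).push 1 0 v u).push 2 0 u (j * 2)).push 2 0 v (j * 2 + 1) 1 0 w = _
        rw [Store.push_of_ne _ (by norm_num), Store.push_of_ne _ (by norm_num), Store.push_same,
          Store.push_same, List.append_assoc]
        congr 1
        simp only [nbOf, List.flatMap_cons, List.flatMap_nil, List.append_nil]
        rfl
      · rw [show 2 * (j + 1) = 2 * j + 1 + 1 by ring, List.range_succ, List.range_succ,
          List.filter_append, List.filter_append, ← b2]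
        have t1 : tailOf L (2 * j) = u := tailOf_two_mul hj
        have t2 : tailOf L (2 * j + 1) = v := tailOf_two_mul_add_one hj
        change (((b.st.push 1 0 u v).push 1 0 v u).push 2 0 u (j * 2)).push 2 0 v (j * 2 + 1) 2 0 w = _
        rw [Store.push_same, Store.push_same, Store.push_of_ne _ (by norm_num),
          Store.push_of_ne _ (by norm_num), mul_comm j 2]
        congr 1
        · congr 1
          simp [List.filter_cons, t1]
        · simp [List.filter_cons, t2]
      · have h1 : t ≠ 1 := by omega
        have h2 : t ≠ 2 := by omega
        simp [Store.push, h1, h2, hb', b3 t ht]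
  · rw [Finset.sum_const, Finset.card_range, smul_eq_mul]
    have hs : storeEdgesP.size = 11 + body.size := by
      simp only [storeEdgesP, forP, Program.size, Expr.cost, hbody]; omega
    rw [hs]
    simp only [Expr.cost]
    nlinarith
  · rintro b ⟨b0, b4, bo, b1, b2, b3⟩
    refine ⟨b0, b4, bo, fun v _ => ⟨?_, ?_⟩, b3⟩
    · rw [b1, List.take_length]
    · rw [b2]; rfl

end EvenCycles

namespace EvenCycles

open WordRAM Machine

/-! ### Running through the vertices, the colourings and the moduli -/

variable {M : Machine} {a : AState} {n : ℕ} {L : List (Fin n × Fin n)} {k X N p : ℕ}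

/-- The input is stored, and the words are large enough. The ranks are at most `X`, and the moduli
at most `N`. -/
structure Ambient (M : Machine) (L : List (Fin n × Fin n)) (k X N : ℕ) : Prop where
  input : Input M L
  n_lt : n * n + n + 2 < M.B
  k_lt : 4 * k + 8 < M.B
  m_lt : 2 * L.length + n + 5 < M.B
  one_le : 1 ≤ X
  le : 2 * L.length ≤ X
  pow_lt : X ^ (2 * k * (2 * k)) < M.B
  lt_pow : 4 * (X ^ (2 * k * (2 * k))) ^ 2 < 2 ^ (N + 1)
  N_lt : N < M.B
  run_lt : (N + 1) ^ (2 * k * (2 * k)) * (2 * L.length + 1) + 2 < M.B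

/-- The state between two searches: the graph is stored, the modulus is `p`, and only the lists
of earlier searches have been used. -/
structure Ready (M : Machine) (L : List (Fin n × Fin n)) (p : ℕ) (a : AState) : Prop where
  base : a.reg 0 = M.B
  modulus : a.reg 1 = p
  holds : Holds n (nbOf L) (rlOf L) a
  fresh : ∀ t, 3 ≤ t → ∀ r, a.reg 4 ≤ r → ∀ u, a.st t r u = []

theorem Ready.congr {b : AState} (h : Ready M L p a) (h0 : b.reg 0 = a.reg 0)
    (h1 : b.reg 1 = a.reg 1) (h4 : b.reg 4 = a.reg 4) (hst : b.st = a.st) : Ready M L p b :=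
  ⟨h0.trans h.base, h1.trans h.modulus, fun v hv => by rw [hst]; exact h.holds v hv,
    fun t ht r hr u => by rw [hst]; exact h.fresh t ht r (h4 ▸ hr) u⟩

open Classical in
/-- The number of tuples that start with `x₀` and traverse a cycle. -/
noncomputable def tupleCount (G : SimpleGraph (Fin n)) (ℓ x₀ : ℕ) : ℕ :=
  (Finset.univ.filter fun v : Fin ℓ → Fin n => IsCycleTuple G v ∧ ext v 0 = x₀).card

/-- The work of a search from `x₀`, up to a constant. -/
noncomputable def searchWork (G : SimpleGraph (Fin n)) (L : List (Fin n × Fin n)) (k N p : ℕ)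
    (c : ℕ → ℕ) (x₀ : ℕ) : ℕ :=
  ∑ j ∈ Finset.range k, (layerCost n (nbOf L) (Allowed n (nbOf L) (rlOf L) p c x₀) x₀ j +
    layerCost n (nbOf L) (AllowedBack (nbOf L) (Allowed n (nbOf L) (rlOf L) p c x₀) k x₀) x₀ j) +
  (N + 1) * tupleCount G (2 * k) x₀

/-- The vertices from which there is a search. -/
def IsStart (L : List (Fin n × Fin n)) (p : ℕ) (c : ℕ → ℕ) (x₀ : ℕ) : Prop :=
  nbOf L x₀ ≠ [] ∧ rank (rlOf L) x₀ % p = c 0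

open Classical in
/-- The work of the searches for one colouring. -/
noncomputable def colouringWork (G : SimpleGraph (Fin n)) (L : List (Fin n × Fin n)) (k N p : ℕ)
    (c : ℕ → ℕ) : ℕ :=
  ∑ x ∈ (Finset.range n).filter (IsStart L p c), searchWork G L k N p c x

open Classical in
/-- The work for the arc with number `i`. -/
noncomputable def arcWork (G : SimpleGraph (Fin n)) (L : List (Fin n × Fin n)) (k N p : ℕ)
    (c : ℕ → ℕ) (i : ℕ) : ℕ :=
  if rank (rlOf L) (tailOf L i) = i ∧ i % p = c 0 then searchWork G L k N p c (tailOf L i) else 0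

theorem sum_arcWork_le (G : SimpleGraph (Fin n)) (c : ℕ → ℕ) :
    ∑ i ∈ Finset.range (2 * L.length), arcWork G L k N p c i ≤ colouringWork G L k N p c := by
  classical
  unfold arcWork colouringWork
  rw [← Finset.sum_filter]
  refine (Finset.sum_image (s := (Finset.range (2 * L.length)).filter fun i =>
    rank (rlOf L) (tailOf L i) = i ∧ i % p = c 0) (g := tailOf L)
    (f := searchWork G L k N p c) ?_).symm.trans_le
    (Finset.sum_le_sum_of_subset fun x hx => ?_)
  · intro i hi j hj hij
    rw [Finset.mem_coe, Finset.mem_filter] at hi hj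
    rw [← hi.2.1, ← hj.2.1, hij]
  · obtain ⟨i, hi, rfl⟩ := Finset.mem_image.1 hx
    rw [Finset.mem_filter, Finset.mem_range] at hi
    obtain ⟨h1, h2⟩ := tailOf_spec hi.1
    exact Finset.mem_filter.2 ⟨Finset.mem_range.2 h1, h2, by rw [hi.2.1]; exact hi.2.2⟩

/-- The constant in the bound for the number of steps of `vertexP`. -/
def vertexCost (k : ℕ) : ℕ := (vertexP k).size + searchCost k * (2 * k + 2)

/-- The part of the program for the arc with number `i` lists the canonical tuples that start with the
tail of this arc and have the colouring `c`, provided that it is the first arc with this tail. -/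
theorem Tri.vertex {G : SimpleGraph (Fin n)} {c : ℕ → ℕ} {i : ℕ} (hL : IsEdgeList G L) (hk : 2 ≤ k)
    (hM : Ambient M L k X N) (ha : Ready M L p a) (hrun : a.reg 4 + 1 < M.B) (hi : i < 2 * L.length)
    (h5 : a.reg 5 = i) (hc : ∀ i, a.reg (21 + 3 * i) = c i)
    (hcnd : ((List.range (2 * k)).map c).Nodup) :
    M.Tri (vertexP k) a (vertexCost k * (1 + arcWork G L k N p c i)) fun b =>
      Ready M L p b ∧ b.reg 2 = a.reg 2 ∧ b.reg 3 = a.reg 3 ∧ b.reg 4 = a.reg 4 + 1 ∧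
      b.reg 5 = i ∧ (∀ i, b.reg (21 + 3 * i) = c i) ∧
      ∃ o, b.out = a.out ++ o ∧ Lists o {v : Fin (2 * k) → Fin n | Canonical G L v ∧
        modulus L v = p ∧ (∀ i < 2 * k, rank (rlOf L) (ext v i) % p = c i) ∧
        rank (rlOf L) (ext v 0) = i} := by
  set x₀ := tailOf L i with hx₀
  obtain ⟨hxn, hne⟩ := tailOf_spec hi
  have hmB := hM.m_lt
  obtain ⟨r, l, hrl⟩ : ∃ r l, rlOf L x₀ = r :: l := List.exists_cons_of_ne_nil (rlOf_ne_nil hne)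
  have hrank : rank (rlOf L) x₀ = r := by simp [rank, hrl]
  set a₁ : AState := { a with reg := Function.update a.reg 20 x₀ } with ha₁
  have r₁ : ∀ r, r ≠ 20 → a₁.reg r = a.reg r := fun r hr => Function.update_of_ne hr _ _
  have h20 : a₁.reg 20 = x₀ := by simp [ha₁]
  have hR₁ : Ready M L p a₁ := ha.congr (r₁ 0 (by norm_num)) (r₁ 1 (by norm_num)) (r₁ 4 (by norm_num)) rfl
  have hc₁ : ∀ i, a₁.reg (21 + 3 * i) = c i := fun i => (r₁ _ (by omega)).trans (hc i)
  have hset : ∀ v : Fin (2 * k) → Fin n, Canonical G L v →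
      (rank (rlOf L) (ext v 0) = i ↔ rank (rlOf L) x₀ = i ∧ ext v 0 = x₀) := by
    intro v hv
    have hne0 : nbOf L (ext v 0) ≠ [] := by
      obtain ⟨-, -, h⟩ := (isCycleTuple_iff hL (by omega)).1 hv.cycle
      intro h0
      rw [(arcData hL).symm] at h
      simp [h0] at h
    constructor
    · intro h
      have := tailOf_rank hne0
      rw [h] at this
      exact ⟨by rw [hx₀, this, h], this.symm⟩
    · rintro ⟨h1, h2⟩
      rw [h2, h1]
  set W := searchCost k * (2 * k + 2) * (1 + arcWork G L k N p c i) with hW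
  set E : Expr := .bin .mul (.bin .eq (rankE (.reg 20)) (.reg 5))
      (.bin .eq (.bin .mod (.reg 5) (.reg 1)) (.reg 21)) with hE
  have hev : M.Evals E a₁ ((if r = i then 1 else 0) * (if i % p = c 0 then 1 else 0)) :=
    ((Evals.rankE hR₁.base (by omega) (.reg' h20) (by omega)
      ((hR₁.holds x₀ hxn).2.trans hrl)).eq (.reg' ((r₁ 5 (by norm_num)).trans h5))).mul
      (((Evals.reg' ((r₁ 5 (by norm_num)).trans h5)).mod (.reg' hR₁.modulus)
        (lt_two_pow (by omega))).eq (.reg' (hc₁ 0)))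
      ((show _ ≤ 1 by split_ifs <;> simp).trans_lt one_lt_two_pow)
  -- the state after the search, before the counter is increased
  have main : M.Tri (.ite E (searchP k) .skip) a₁ (E.cost + 1 + (1 + W)) fun b =>
      (∀ r < 6, b.reg r = a.reg r) ∧ (∀ i, b.reg (21 + 3 * i) = c i) ∧
      (∀ t r u, t < 3 ∨ r ≠ a.reg 4 → b.st t r u = a.st t r u) ∧
      ∃ o, b.out = a.out ++ o ∧ Lists o {v : Fin (2 * k) → Fin n | Canonical G L v ∧
        modulus L v = p ∧ (∀ i < 2 * k, rank (rlOf L) (ext v i) % p = c i) ∧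
        rank (rlOf L) (ext v 0) = i} := by
    refine Tri.ite hev (fun hv => ?_) fun hv => ?_
    · obtain ⟨h1, h2⟩ : r = i ∧ i % p = c 0 := by
        by_contra h
        apply hv
        split_ifs <;> simp_all
      have hcol : rank (rlOf L) x₀ % p = c 0 := by rw [hrank, h1, h2]
      refine (Tri.search (W := tupleCount G (2 * k) x₀) hk (arcData hL) hR₁.holds
        (by rw [hM.input.len]; omega) hM.input.zero hM.n_lt hM.k_lt hR₁.base hR₁.modulus
        (r₁ 4 (by norm_num)) h20 (by omega) hxn hne hc₁ hcnd hcol hM.one_le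
        (fun v => (rank_le v).trans hM.le) hM.pow_lt hM.lt_pow hM.N_lt
        (fun t ht u => hR₁.fresh t ht _ (r₁ 4 (by norm_num)).le u) ?_).mono ?_ ?_
      · intro ys hnd hys
        exact length_le_of_closedWalk (x₀ := ⟨x₀, hxn⟩) hL hk hcnd h20 hcol hnd hys
      · rw [hW, arcWork, if_pos ⟨hrank.trans h1, h2⟩, searchWork, Finset.sum_add_distrib,
          mul_assoc (searchCost k)]
        refine le_trans ?_ (Nat.le_add_left _ _)
        refine Nat.mul_le_mul_left _ ?_
        simp only [Finset.sum_add_distrib, Finset.sum_const, Finset.card_range, smul_eq_mul, mul_one,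
          ← hx₀]
        generalize (∑ j ∈ Finset.range k, _ : ℕ) = s₁
        generalize (∑ j ∈ Finset.range k, _ : ℕ) = s₂
        generalize (N + 1) * _ = s₃
        nlinarith
      · rintro b ⟨b1, b2, b3, ys, hnd, hys, bo⟩
        refine ⟨fun r hr => (b1 r hr).trans (r₁ r (by omega)), fun i => (b2 i).trans (hc₁ i), b3,
          _, bo, ?_⟩
        refine (lists_search (x₀ := ⟨x₀, hxn⟩) hL hk hcnd h20 hcol hnd hys).congr fun v => ?_
        simp only [Set.mem_ofPred_eq]
        refine and_congr_right fun hv => and_congr_right fun _ => and_congr_right fun _ => ?_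
        rw [hset v hv, hrank]
        simp [h1]
    · refine (Tri.skip (a := a₁) ?_).cost_le (by simp [Program.size])
      refine ⟨fun r hr => r₁ r (by omega), hc₁, fun t r u _ => rfl, [], by simp [ha₁], Lists.nil ?_⟩
      rintro v ⟨hv', -, hcol, hr⟩
      have h0 := hcol 0 (by omega)
      rw [hr] at h0
      have := ((hset v hv').1 hr).1
      rw [hrank] at this
      simp [this, h0] at hv
  refine Tri.cost_le (c₁ := 5 + (E.cost + 1 + (1 + W) + 4)) (Tri.seq (Tri.assign (v := x₀) ?_
    (Tri.seq (main.mono le_rfl ?_)))) ?_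
  · refine (Evals.input ((Evals.reg' h5).add (Evals.lit (lt_two_pow (by omega)))
      (lt_two_pow (by omega))) (by rw [hM.input.len]; omega)).congr ?_
    rw [hM.input.inp]; rfl
  · rintro b ⟨b1, b2, b3, o, bo, hls⟩
    refine (Tri.assign (v := a.reg 4 + 1) ((Evals.reg' (b1 4 (by norm_num))).add (Evals.lit one_lt_two_pow)
      (lt_two_pow hrun)) ⟨⟨?_, ?_, ?_, ?_⟩, ?_, ?_, ?_, ?_, ?_, o, bo, hls⟩)
    · simp [b1, ha.base]
    · simp [b1, ha.modulus]
    · intro v hv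
      simp only [b3 1 0 v (by norm_num), b3 2 0 v (by norm_num)]
      exact ha.holds v hv
    · intro t ht r hr u
      simp only [Function.update_self] at hr
      simp only [b3 t r u (Or.inr (by omega))]
      exact ha.fresh t ht r (by omega) u
    · simp [b1]
    · simp [b1]
    · simp
    · simp [b1, h5]
    · intro i
      rw [← b2 i]
      exact Function.update_of_ne (by omega) _ _
  · have hs : (vertexP k).size = 5 + (E.cost + 1 + (searchP k).size + 1 + 4) := by
      simp only [vertexP, Program.size, Expr.cost, hE]
    have : 1 ≤ (searchP k).size := by
      unfold searchP; simp only [Program.size]; omega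
    rw [vertexCost, hW]
    nlinarith

end EvenCycles

namespace EvenCycles

open WordRAM Machine

variable {M : Machine} {a : AState} {n : ℕ} {L : List (Fin n × Fin n)} {k X N p : ℕ}

theorem exists_digits {p : ℕ} (ℓ : ℕ) (d : ℕ → ℕ) (hd : ∀ i < ℓ, d i < p) :
    ∃ x < p ^ ℓ, ∀ i < ℓ, x / p ^ i % p = d i := by
  induction ℓ generalizing d with
  | zero => exact ⟨0, by simp, by simp⟩
  | succ ℓ ih =>
    obtain ⟨y, hy, hyd⟩ := ih (fun i => d (i + 1)) fun i hi => hd _ (by omega)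
    have h0 := hd 0 (by omega)
    refine ⟨d 0 + p * y, ?_, fun i hi => ?_⟩
    · calc d 0 + p * y < p * (y + 1) := by rw [mul_add]; omega
        _ ≤ p * p ^ ℓ := Nat.mul_le_mul_left _ hy
        _ = p ^ (ℓ + 1) := by ring
    · cases i with
      | zero => simp [Nat.mod_eq_of_lt h0]
      | succ i =>
        rw [pow_succ', ← Nat.div_div_eq_div_mul, Nat.add_mul_div_left _ _ (by omega),
          Nat.div_eq_of_lt h0, zero_add]
        exact hyd i (by omega)

theorem eq_of_digits {p ℓ x y : ℕ} (hx : x < p ^ ℓ) (hy : y < p ^ ℓ)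
    (h : ∀ i < ℓ, x / p ^ i % p = y / p ^ i % p) : x = y := by
  induction ℓ generalizing x y with
  | zero => simp at hx hy; omega
  | succ ℓ ih =>
    rw [pow_succ'] at hx hy
    have h0 := h 0 (by omega)
    have h1 : x / p = y / p := ih (Nat.div_lt_of_lt_mul hx) (Nat.div_lt_of_lt_mul hy) fun i hi => by
      have := h (i + 1) (by omega)
      rwa [pow_succ', ← Nat.div_div_eq_div_mul, ← Nat.div_div_eq_div_mul] at this
    simp only [pow_zero, Nat.div_one] at h0
    rw [← Nat.div_add_mod x p, ← Nat.div_add_mod y p, h0, h1]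

theorem nbOf_ext_ne_nil {G : SimpleGraph (Fin n)} (hL : IsEdgeList G L) {ℓ : ℕ} {v : Fin ℓ → Fin n}
    (hv : IsCycleTuple G v) {i : ℕ} (hi : i < ℓ) : nbOf L (ext v i) ≠ [] := by
  rw [ext_of_lt hi]
  exact List.ne_nil_of_mem ((mem_nbOf_iff_adj hL).2 (hv.adj ⟨i, hi⟩))

theorem nodup_ranks {G : SimpleGraph (Fin n)} (hL : IsEdgeList G L) {ℓ : ℕ} {v : Fin ℓ → Fin n}
    (hv : IsCycleTuple G v) : ((List.range ℓ).map fun i => rank (rlOf L) (ext v i)).Nodup := by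
  refine List.Nodup.map_on (fun i hi j hj hij => ?_) List.nodup_range
  rw [List.mem_range] at hi hj
  have h := congrArg (tailOf L) hij
  rw [tailOf_rank (nbOf_ext_ne_nil hL hv hi), tailOf_rank (nbOf_ext_ne_nil hL hv hj), ext_of_lt hi,
    ext_of_lt hj] at h
  exact congrArg Fin.val (hv.injective (Fin.ext h))

/-- The canonical tuples that are listed when the modulus is `p`, and the colours of the positions
are the digits of `x`. -/
def codeSet (G : SimpleGraph (Fin n)) (L : List (Fin n × Fin n)) (k p x : ℕ) :
    Set (Fin (2 * k) → Fin n) :=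
  {v | Canonical G L v ∧ modulus L v = p ∧ ∀ i < 2 * k, rank (rlOf L) (ext v i) % p = x / p ^ i % p}

theorem Tri.colour {ℓ x : ℕ} (hp : 1 ≤ p) (h1 : a.reg 1 = p) (h3 : a.reg 3 = x)
    (hpw : p ^ ℓ < 2 ^ M.w) (hx : x < p ^ ℓ) :
    M.Tri (colourP ℓ) a (colourP ℓ).size fun b =>
      b.st = a.st ∧ b.out = a.out ∧ (∀ r ≤ 20, b.reg r = a.reg r) ∧
      ∀ i < ℓ, b.reg (21 + 3 * i) = x / p ^ i % p := by
  refine (Tri.seqP (M := M) (a := a) (fun i b => b.st = a.st ∧ b.out = a.out ∧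
    (∀ r ≤ 20, b.reg r = a.reg r) ∧ ∀ j < i, b.reg (21 + 3 * j) = x / p ^ j % p) ?_ ?_).mono le_rfl ?_
  · exact ⟨rfl, rfl, fun _ _ => rfl, fun j hj => absurd hj (by omega)⟩
  · rintro i hi b ⟨b1, b2, b3, b4⟩
    rw [List.length_map, List.length_range] at hi
    simp only [List.getElem_map, List.getElem_range]
    have hpi : p ^ i < 2 ^ M.w := (Nat.pow_le_pow_right hp hi.le).trans_lt hpw
    have r1 : b.reg 1 = p := (b3 1 (by norm_num)).trans h1
    have r3 : b.reg 3 = x := (b3 3 (by norm_num)).trans h3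
    refine Tri.assign (((Evals.reg' r3).div (Evals.powE (.reg' r1) hp hpi) (by omega)).mod (.reg' r1)
      ((Nat.div_le_self _ _).trans_lt (by omega))) ⟨b1, b2, fun r hr => ?_, fun j hj => ?_⟩
    · rw [← b3 r hr]
      exact Function.update_of_ne (by omega) _ _
    · by_cases hji : j = i
      · subst hji; simp
      · rw [← b4 j (by omega)]
        exact Function.update_of_ne (by omega) _ _
  · rintro b ⟨b1, b2, b3, b4⟩
    exact ⟨b1, b2, b3, by simpa using b4⟩

/-- The constant in the bound for the number of steps of `codeP`. -/
def codeCost (k : ℕ) : ℕ := (codeP k).size + 2 * vertexCost k + 22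

/-- The searches for one colouring. A colouring that is not injective on the positions is skipped; no
tuple with modulus `p` has such a colouring. -/
theorem Tri.code {G : SimpleGraph (Fin n)} {x Z : ℕ} (hL : IsEdgeList G L) (hk : 2 ≤ k)
    (hM : Ambient M L k X N) (ha : Ready M L p a) (hp : 1 ≤ p) (hpN : p ≤ N)
    (hrun : a.reg 4 + 2 * L.length + 1 < M.B) (h3 : a.reg 3 = x) (hx : x < p ^ (2 * k))
    (hZ : ∀ c : ℕ → ℕ, ((List.range (2 * k)).map c).Nodup → colouringWork G L k N p c ≤ Z) :
    M.Tri (codeP k) a (codeCost k * (1 + L.length + Z)) fun b =>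
      Ready M L p b ∧ b.reg 2 = a.reg 2 ∧ b.reg 3 = x ∧ b.reg 4 ≤ a.reg 4 + 2 * L.length ∧
      ∃ o, b.out = a.out ++ o ∧ Lists o (codeSet G L k p x) := by
  have hmB := hM.m_lt
  have hNp : (N + 1) ^ (2 * k * (2 * k)) < M.B := by
    have := hM.run_lt
    nlinarith [Nat.zero_le ((N + 1) ^ (2 * k * (2 * k)) * (2 * L.length))]
  have hpp : p ^ (2 * k * (2 * k)) < M.B := (Nat.pow_le_pow_left (by omega) _).trans_lt hNp
  have hp2 : p ^ (2 * k) < 2 ^ M.w :=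
    lt_two_pow ((Nat.pow_le_pow_right hp (Nat.le_mul_of_pos_left _ (by omega))).trans_lt hpp)
  set E := prodDiffE ((List.range (2 * k)).map fun i => .reg (21 + 3 * i)) with hE
  set F := forP 5 (.bin .mul (.load (.lit 1)) (.lit 2)) (vertexP k) with hF
  refine Tri.cost_le (c₁ := (colourP (2 * k)).size + (E.cost + 1 +
    (vertexCost k * (2 * L.length + Z) + 22 * L.length + 10)))
    (Tri.seq ((Tri.colour hp ha.modulus h3 hp2 hx).mono le_rfl ?_)) ?_
  · rintro b ⟨b1, b2, b3, b4⟩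
    have hRb : Ready M L p b := ha.congr (b3 0 (by norm_num)) (b3 1 (by norm_num))
      (b3 4 (by norm_num)) b1
    set c : ℕ → ℕ := fun i => b.reg (21 + 3 * i) with hc
    have hcx : ∀ i < 2 * k, c i = x / p ^ i % p := b4
    have hev : M.Evals E b (prodDiff ((List.range (2 * k)).map c)) := by
      refine Evals.prodDiffE hp ?_ ?_ (by simpa using lt_two_pow hpp)
      · rw [List.forall₂_map_left_iff, List.forall₂_map_right_iff, List.forall₂_same]
        exact fun i _ => Evals.reg _
      · intro y hy
        obtain ⟨i, hi, rfl⟩ := List.mem_map.1 hy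
        rw [hcx i (List.mem_range.1 hi)]
        exact (Nat.mod_lt _ hp).le
    refine Tri.ite hev (fun hv => ?_) fun hv => ?_
    · have hcnd := prodDiff_ne_zero.1 hv
      refine (Tri.for (M := M) (a := b) (2 * L.length)
        (fun i => vertexCost k * (1 + arcWork G L k N p c i))
        (fun t s => Ready M L p s ∧ s.reg 2 = a.reg 2 ∧ s.reg 3 = x ∧ s.reg 4 = a.reg 4 + t ∧
          (∀ i, s.reg (21 + 3 * i) = c i) ∧ ∃ o, s.out = a.out ++ o ∧
          Lists o {v : Fin (2 * k) → Fin n | (Canonical G L v ∧ modulus L v = p ∧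
            ∀ i < 2 * k, rank (rlOf L) (ext v i) % p = c i) ∧ rank (rlOf L) (ext v 0) < t})
        (lt_two_pow (by omega)) ?_ ?_ ?_).mono ?_ ?_
      · refine ⟨hRb.congr rfl rfl rfl rfl, b3 2 (by norm_num), (b3 3 (by norm_num)).trans h3,
          b3 4 (by norm_num), fun i => Function.update_of_ne (by omega) _ _, [], by simp [b2],
          Lists.nil fun v hv => ?_⟩
        exact absurd hv.2 (by omega)
      · intro t s _ _ _
        rw [mul_comm 2]
        exact (Evals.edges hM.input).mul (Evals.lit (lt_two_pow (by omega))) (lt_two_pow (by omega))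
      · rintro t s ht h5 ⟨s1, s2, s3, s4, s5, o, so, hlo⟩
        refine (Tri.vertex hL hk hM s1 (by omega) ht h5 s5 hcnd).mono le_rfl ?_
        rintro u ⟨u1, u2, u3, u4, u5, u6, o', uo, hlo'⟩
        refine ⟨u5, u1.congr rfl rfl rfl rfl, u2.trans s2, u3.trans s3, ?_,
          fun i => (Function.update_of_ne (by omega) _ _).trans (u6 i), o ++ o', ?_, ?_⟩
        · exact u4.trans (by omega)
        · exact uo.trans (by rw [so, List.append_assoc])
        · refine hlo.append hlo' (fun v hv hv' => ?_) fun v => ?_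
          · have h1 := hv.2
            have h2 := hv'.2.2.2
            omega
          · simp only [Set.mem_ofPred_eq, Nat.lt_succ_iff_lt_or_eq]
            tauto
      · rw [Finset.sum_add_distrib, ← Finset.mul_sum, Finset.sum_add_distrib]
        simp only [Finset.sum_const, Finset.card_range, smul_eq_mul, mul_one, Expr.cost]
        have := Nat.mul_le_mul_left (vertexCost k) ((sum_arcWork_le (p := p) (N := N) (k := k) (L := L) G c).trans (hZ c hcnd))
        rw [mul_add, mul_add (vertexCost k) (2 * L.length) Z]
        omega
      · rintro s ⟨s1, s2, s3, s4, -, o, so, hlo⟩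
        refine ⟨s1, s2, s3, s4.le, o, so, hlo.congr fun v => ?_⟩
        simp only [codeSet, Set.mem_ofPred_eq]
        constructor
        · rintro ⟨h1, h2, h3⟩
          refine ⟨⟨h1, h2, fun i hi => (h3 i hi).trans (hcx i hi).symm⟩, rank_lt ?_⟩
          exact nbOf_ext_ne_nil hL h1.cycle (by omega)
        · rintro ⟨⟨h1, h2, h3⟩, -⟩
          exact ⟨h1, h2, fun i hi => (h3 i hi).trans (hcx i hi)⟩
    · refine (Tri.skip (a := b) ⟨hRb, b3 2 (by norm_num), (b3 3 (by norm_num)).trans h3, ?_, [],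
        by simp [b2], Lists.nil fun v hv => ?_⟩).cost_le (by simp only [Program.size]; omega)
      · rw [b3 4 (by norm_num)]; omega
      · -- the modulus of `v` separates its entries, so the colours of `v` are distinct
        obtain ⟨h1, h2, h3⟩ := hv
        have hnd : ((List.range (2 * k)).map fun i => rank (rlOf L) (ext v i)).Nodup :=
          nodup_ranks hL h1.cycle
        have hd := nodup_map_mod (p := p) (l := (List.range (2 * k)).map fun i => rank (rlOf L) (ext v i))
          (by rw [← h2]; exact (leastNonDvd_spec (Nat.pos_of_ne_zero (prodDiff_ne_zero.2 hnd))).2)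
        rw [List.map_map] at hd
        refine prodDiff_ne_zero.2 ?_ hv
        convert hd using 1
        exact List.map_congr_left fun i hi => by
          rw [hcx i (List.mem_range.1 hi), ← h3 i (List.mem_range.1 hi)]; rfl
  · have hs : (codeP k).size = (colourP (2 * k)).size + (E.cost + 1 + F.size + 1) := by
      simp only [codeP, Program.size, hE, hF]
    rw [codeCost, hs]
    nlinarith

/-- The constant in the bound for the number of steps of `modulusP`. -/
def modulusCost (k : ℕ) : ℕ := codeCost k + 2 * (powE (.reg 1) (2 * k)).cost + 12

/-- All colourings with `p` colours together list the canonical tuples with modulus `p`, because the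
colours of the entries of such a tuple are the digits of a unique number below `p ^ (2 * k)`. -/
theorem Tri.modulus {G : SimpleGraph (Fin n)} {Z : ℕ} (hL : IsEdgeList G L) (hk : 2 ≤ k)
    (hM : Ambient M L k X N) (ha : Ready M L p a) (hp : 1 ≤ p) (hpN : p ≤ N)
    (hrun : a.reg 4 + p ^ (2 * k) * (2 * L.length) + 1 < M.B)
    (hZ : ∀ c : ℕ → ℕ, ((List.range (2 * k)).map c).Nodup → colouringWork G L k N p c ≤ Z) :
    M.Tri (modulusP k) a (modulusCost k * ((p ^ (2 * k) + 1) * (1 + L.length + Z))) fun b =>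
      Ready M L p b ∧ b.reg 2 = a.reg 2 ∧ b.reg 4 ≤ a.reg 4 + p ^ (2 * k) * (2 * L.length) ∧
      ∃ o, b.out = a.out ++ o ∧
        Lists o {v : Fin (2 * k) → Fin n | Canonical G L v ∧ EvenCycles.modulus L v = p} := by
  have hNp : p ^ (2 * k) < 2 ^ M.w := by
    have h1 := hM.run_lt
    have h2 : p ^ (2 * k) ≤ (N + 1) ^ (2 * k * (2 * k)) :=
      (Nat.pow_le_pow_left (by omega) _).trans
        (Nat.pow_le_pow_right (by omega) (Nat.le_mul_of_pos_left _ (by omega)))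
    refine lt_two_pow ?_
    nlinarith [Nat.zero_le ((N + 1) ^ (2 * k * (2 * k)) * (2 * L.length))]
  refine (Tri.for (M := M) (a := a) (p ^ (2 * k)) (fun _ => codeCost k * (1 + L.length + Z))
    (fun t s => Ready M L p s ∧ s.reg 2 = a.reg 2 ∧ s.reg 4 ≤ a.reg 4 + t * (2 * L.length) ∧
      ∃ o, s.out = a.out ++ o ∧ Lists o {v : Fin (2 * k) → Fin n | ∃ x < t, v ∈ codeSet G L k p x})
    hNp ?_ ?_ ?_).mono ?_ ?_
  · refine ⟨ha.congr rfl rfl rfl rfl, rfl, by simp [Function.update_of_ne], [], by simp,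
      Lists.nil fun v hv => ?_⟩
    obtain ⟨x, hx, -⟩ := hv
    omega
  · rintro t s _ _ ⟨s1, -⟩
    exact Evals.powE (.reg' s1.modulus) hp hNp
  · rintro t s ht h3 ⟨s1, s2, s4, o, so, hlo⟩
    have hle : (t + 1) * (2 * L.length) ≤ p ^ (2 * k) * (2 * L.length) := Nat.mul_le_mul_right _ ht
    rw [add_mul, one_mul] at hle
    refine (Tri.code hL hk hM s1 hp hpN (by omega) h3 ht hZ).mono le_rfl ?_
    rintro u ⟨u1, u2, u3, u4, o', uo, hlo'⟩
    refine ⟨u3, u1.congr rfl rfl rfl rfl, u2.trans s2, ?_, o ++ o', ?_, ?_⟩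
    · rw [add_mul, one_mul]
      exact u4.trans (by omega)
    · exact uo.trans (by rw [so, List.append_assoc])
    · refine hlo.append hlo' (fun v hv hv' => ?_) fun v => ?_
      · obtain ⟨x, hx, hvx⟩ := hv
        have := eq_of_digits (hx.trans ht) ht fun i hi =>
          (hvx.2.2 i hi).symm.trans (hv'.2.2 i hi)
        omega
      · simp only [Set.mem_ofPred_eq, Nat.lt_succ_iff_lt_or_eq, or_and_right, exists_or,
          exists_eq_left]
  · rw [Finset.sum_const, Finset.card_range, smul_eq_mul, modulusCost]
    set A := (powE (.reg 1) (2 * k)).cost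
    set Y := 1 + L.length + Z with hY
    have : 1 ≤ Y := by omega
    generalize p ^ (2 * k) = q
    calc q * (codeCost k * Y + (A + 7)) + (A + 5) ≤ q * (codeCost k * Y + (A + 7) * Y) + (A + 5) * Y := by
          gcongr <;> nlinarith
      _ ≤ _ := by nlinarith [Nat.zero_le (q * Y * A), Nat.zero_le (A * Y), Nat.zero_le (q * Y), Nat.zero_le (codeCost k * Y)]
  · rintro s ⟨s1, s2, s4, o, so, hlo⟩
    refine ⟨s1, s2, s4, o, so, hlo.congr fun v => ⟨fun hv => ?_, ?_⟩⟩
    · obtain ⟨x, hx, hxd⟩ := exists_digits (p := p) (2 * k) (fun i => rank (rlOf L) (ext v i) % p)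
        fun i _ => Nat.mod_lt _ hp
      exact ⟨x, hx, hv.1, hv.2, fun i hi => (hxd i hi).symm⟩
    · rintro ⟨x, -, h1, h2, -⟩
      exact ⟨h1, h2⟩

end EvenCycles

namespace EvenCycles

open WordRAM Machine

variable {M : Machine} {a : AState} {n : ℕ} {L : List (Fin n × Fin n)} {k X N p : ℕ}

theorem prodDiff_ranks_pos {G : SimpleGraph (Fin n)} (hL : IsEdgeList G L) {ℓ : ℕ}
    {v : Fin ℓ → Fin n} (hv : IsCycleTuple G v) :
    0 < prodDiff ((List.range ℓ).map fun i => rank (rlOf L) (ext v i)) :=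
  Nat.pos_of_ne_zero (prodDiff_ne_zero.2 (nodup_ranks hL hv))

theorem modulus_pos {G : SimpleGraph (Fin n)} (hL : IsEdgeList G L) {ℓ : ℕ}
    {v : Fin ℓ → Fin n} (hv : IsCycleTuple G v) : 1 ≤ modulus L v :=
  (leastNonDvd_spec (prodDiff_ranks_pos hL hv)).1

/-- The moduli of the cycles are among those that the program tries. -/
theorem Ambient.modulus_le {G : SimpleGraph (Fin n)} (hM : Ambient M L k X N) (hL : IsEdgeList G L)
    {v : Fin (2 * k) → Fin n} (hv : IsCycleTuple G v) : modulus L v ≤ N := by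
  have h1 := two_pow_leastNonDvd_le (prodDiff_ranks_pos hL hv)
  have h2 := prodDiff_le (X := X) (l := (List.range (2 * k)).map fun i => rank (rlOf L) (ext v i))
    hM.one_le fun x hx => by
      obtain ⟨i, -, rfl⟩ := List.mem_map.1 hx
      exact (rank_le _).trans hM.le
  rw [List.length_map, List.length_range] at h2
  have h3 := (h1.trans (Nat.mul_le_mul_left 4 (Nat.pow_le_pow_left h2 2))).trans_lt hM.lt_pow
  have := (Nat.pow_lt_pow_iff_right (by norm_num)).1 h3
  unfold modulus
  omega

/-- The constant in the bound for the number of steps of the program. -/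
def mainCost (k K q : ℕ) : ℕ := (mainP k K q).size + storeEdgesP.size + 2 * modulusCost k

/-- The program lists the canonical tuples. The bound `Z` is for the work of the searches for one
colouring; there are at most `N` moduli and at most `(N + 1) ^ (2 * k)` colourings for each. -/
theorem Tri.main {G : SimpleGraph (Fin n)} {K q Z : ℕ} (hL : IsEdgeList G L) (hk : 2 ≤ k)
    (hM : Ambient M L k X N) (hB : M.B = (n + L.length + 2) ^ q)
    (hY : (L.length + 2) ^ K + 1 < M.B) (hN : N = Nat.log 2 ((L.length + 2) ^ K))
    (hreg : ∀ r, a.reg r = 0) (hst : ∀ t r u, a.st t r u = []) (hout : a.out = [])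
    (hZ : ∀ p, ∀ c : ℕ → ℕ, ((List.range (2 * k)).map c).Nodup → colouringWork G L k N p c ≤ Z) :
    M.Tri (mainP k K q) a (mainCost k K q * ((N + 1) ^ (2 * k + 1) * (1 + L.length + Z))) fun b =>
      Lists b.out {v : Fin (2 * k) → Fin n | Canonical G L v} := by
  have hmB := hM.m_lt
  have hm2 : ∀ c, c ≤ n + L.length + 2 → c < 2 ^ M.w := fun c hc => lt_two_pow (by omega)
  set Y := (L.length + 2) ^ K with hYd
  have hY0 : Y ≠ 0 := by positivity
  have hBw : M.B < 2 ^ M.w := by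
    have := M.pow_le
    have := M.two_le
    calc M.B < M.B ^ 4 := lt_self_pow₀ (by omega) (by norm_num)
      _ ≤ _ := M.pow_le
  have h2N : 2 * 2 ^ N < 2 ^ M.w := by
    have h1 : 2 ^ N ≤ Y := hN ▸ Nat.pow_log_le_self 2 hY0
    have h2 := M.pow_le
    have h3 := M.two_le
    have : 2 * M.B ≤ M.B ^ 4 := by
      calc 2 * M.B ≤ M.B * M.B := Nat.mul_le_mul_right _ h3
        _ = M.B ^ 2 := by ring
        _ ≤ M.B ^ 4 := Nat.pow_le_pow_right (by omega) (by norm_num)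
    omega
  have hin : ∀ b : AState, M.Evals (.load (.lit 0)) b n := fun b =>
    (Evals.input (Evals.lit (by positivity)) (by rw [hM.input.len]; omega)).congr hM.input.zero
  set E : Expr := .bin .lt (.reg 2) (.bin .add (powE (.bin .add (.load (.lit 1)) (.lit 2)) K) (.lit 1))
    with hE
  have hEv : ∀ b : AState, ∀ t, b.reg 2 = 2 ^ (t + 1) →
      M.Evals E b (if 2 ^ (t + 1) < Y + 1 then 1 else 0) := fun b t hb =>
    (Evals.reg' hb).lt ((Evals.powE ((Evals.edges hM.input).add (Evals.lit (hm2 2 (by omega)))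
      (hm2 _ (by omega))) (by omega) (lt_two_pow (by omega))).add (Evals.lit one_lt_two_pow)
      (lt_two_pow hY))
  set P : Program := .seq (modulusP k)
    (.seq (.assign 1 (.bin .add (.reg 1) (.lit 1))) (.assign 2 (.bin .mul (.reg 2) (.lit 2)))) with hP
  set S := (N + 1) ^ (2 * k) with hS
  have hrunS : (N + 1) * S * (2 * L.length) + 1 < M.B := by
    have h1 := hM.run_lt
    have h2 : (N + 1) * S ≤ (N + 1) ^ (2 * k * (2 * k)) := by
      rw [hS, ← pow_succ']
      exact Nat.pow_le_pow_right (by omega) (by nlinarith)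
    have h3 := Nat.mul_le_mul_right (2 * L.length) h2
    rw [mul_add] at h1
    omega
  set D := 1 + L.length + Z with hD
  have hloop : ∀ b : AState, Ready M L 1 b → b.reg 2 = 2 → b.reg 4 = 0 → b.out = [] →
      M.Tri (.loop E P) b (∑ t ∈ Finset.range N, (modulusCost k * (2 * S * D) + 8 + (E.cost + 1)) +
        (E.cost + 1)) fun b => Lists b.out {v : Fin (2 * k) → Fin n | Canonical G L v} := by
    intro b hb h2 h4 ho
    refine (Tri.loop (M := M) N (fun _ => modulusCost k * (2 * S * D) + 8) (fun t s =>
      Ready M L (t + 1) s ∧ s.reg 2 = 2 ^ (t + 1) ∧ s.reg 4 ≤ t * (S * (2 * L.length)) ∧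
      Lists s.out {v : Fin (2 * k) → Fin n | Canonical G L v ∧ EvenCycles.modulus L v ≤ t})
      ?_ ?_ ?_).mono le_rfl ?_
    · refine ⟨hb, by simpa using h2, by omega, ?_⟩
      rw [ho]
      refine Lists.nil fun v hv => ?_
      have := modulus_pos hL hv.1.cycle
      have := hv.2
      omega
    · rintro t s ht ⟨-, s2, -⟩
      refine ⟨_, hEv s t s2, ?_⟩
      have : 2 ^ (t + 1) < Y + 1 ↔ t < N := by
        rw [Nat.lt_succ_iff, ← Nat.le_log_iff_pow_le (by norm_num) hY0, ← hN, Nat.succ_le_iff]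
      rw [← this]
      split_ifs with h
      · exact iff_of_true one_ne_zero h
      · exact iff_of_false (not_not.2 rfl) h
    · rintro t s ht ⟨s1, s2, s4, hlo⟩
      have hpS : (t + 1) ^ (2 * k) ≤ S := Nat.pow_le_pow_left (by omega) _
      have hpSm := Nat.mul_le_mul_right (2 * L.length) hpS
      have hts : (t + 1) * (S * (2 * L.length)) ≤ (N + 1) * S * (2 * L.length) := by
        rw [← mul_assoc]; gcongr
      have hts' : (t + 1) * (S * (2 * L.length)) = t * (S * (2 * L.length)) + S * (2 * L.length) := by
        ring
      refine Tri.cost_le (c₁ := modulusCost k * (((t + 1) ^ (2 * k) + 1) * D) + (4 + 4)) (Tri.seq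
        ((Tri.modulus hL hk hM s1 (by omega) (by omega) (by
          rw [hts'] at hts; omega) (hZ _)).mono le_rfl ?_)) ?_
      · rintro u ⟨u1, u2, u4, o, uo, hlo'⟩
        have hu2 : u.reg 2 = 2 ^ (t + 1) := u2.trans s2
        have hpw : 2 ^ (t + 1) * 2 ≤ 2 * 2 ^ N := by
          rw [mul_comm]
          exact Nat.mul_le_mul_left _ (Nat.pow_le_pow_right (by norm_num) ht)
        refine Tri.seq (Tri.assign (v := t + 1 + 1) ((Evals.reg' u1.modulus).add (Evals.lit one_lt_two_pow)
          (by have := hM.N_lt; omega)) (Tri.assign (v := 2 ^ (t + 1) * 2)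
          ((Evals.reg' (by simp [hu2])).mul
          (Evals.lit (hm2 2 (by omega))) (by omega)) ⟨⟨?_, ?_, ?_, ?_⟩, ?_, ?_, ?_⟩))
        · simp [u1.base]
        · simp
        · exact u1.holds
        · intro t' ht' r hr u'
          exact u1.fresh t' ht' r (by simpa using hr) u'
        · simp [pow_succ]
        · refine (show _ = u.reg 4 by simp).trans_le ?_
          omega
        · change Lists u.out _
          rw [uo]
          refine hlo.append hlo' (fun v hv hv' => ?_) fun v => ?_
          · have h1 := hv.2
            have h2 := hv'.2
            omega
          · simp only [Set.mem_ofPred_eq, Nat.le_succ_iff]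
            tauto
      · have h1 : 1 ≤ S := Nat.one_le_pow _ _ (by omega)
        have : ((t + 1) ^ (2 * k) + 1) * D ≤ 2 * S * D := Nat.mul_le_mul_right _ (by omega)
        have := Nat.mul_le_mul_left (modulusCost k) this
        omega
    · rintro s ⟨-, -, -, hlo⟩
      exact hlo.congr fun v => ⟨fun hv => ⟨hv, hM.modulus_le hL hv.cycle⟩, fun hv => hv.1⟩
  set E₀ := powE (.bin .add (.bin .add (.load (.lit 0)) (.load (.lit 1))) (.lit 2)) q with hE₀
  have hE₀v : M.Evals E₀ a M.B := by
    rw [hB]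
    exact Evals.powE (((hin a).add (Evals.edges hM.input) (hm2 _ (by omega))).add
      (Evals.lit (hm2 2 (by omega))) (hm2 _ (by omega))) (by omega) (by rwa [← hB])
  refine Tri.cost_le (c₁ := E₀.cost + 1 + (storeEdgesP.size * (L.length + 1) + (2 + (2 +
    (∑ t ∈ Finset.range N, (modulusCost k * (2 * S * D) + 8 + (E.cost + 1)) + (E.cost + 1))))))
    (Tri.seq (Tri.assign hE₀v (Tri.seq ((Tri.storeEdges
      (a := { a with reg := Function.update a.reg 0 M.B }) hM.input ?_ hmB hst).mono le_rfl ?_)))) ?_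
  · simp
  · rintro b ⟨b0, b4, bo, bh, bf⟩
    refine Tri.seq (Tri.assign (Evals.lit one_lt_two_pow) (Tri.seq (Tri.assign
      (Evals.lit (hm2 2 (by omega))) (hloop _ ⟨?_, ?_, bh, ?_⟩ ?_ ?_ ?_))))
    · simp [b0]
    · simp
    · intro t ht r _ u
      exact bf t ht r u
    · simp
    · simp [b4, hreg]
    · exact bo.trans hout
  · have hs : (mainP k K q).size = E₀.cost + 1 + (storeEdgesP.size + (2 + (2 + (E.cost + 1 +
        ((modulusP k).size + (4 + 4)))))) := rfl
    rw [Finset.sum_const, Finset.card_range, smul_eq_mul, mainCost, hs, pow_succ, ← hS]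
    have h1 : 1 ≤ S := Nat.one_le_pow _ _ (by omega)
    have h2 : 1 ≤ D := by omega
    have h3 : N ≤ N + 1 := by omega
    set V := S * (N + 1) * D with hV
    have hSD : 1 ≤ S * D := Nat.mul_pos h1 h2
    have hV1 : V = N * (S * D) + S * D := by rw [hV]; ring
    have hNV : N ≤ N * (S * D) := Nat.le_mul_of_pos_right _ hSD
    have hDV : L.length + 1 ≤ V := by
      have : D ≤ S * D := Nat.le_mul_of_pos_left _ h1
      omega
    set A := modulusCost k
    set e := E.cost
    set s := storeEdgesP.size
    have e1 : N * (A * (2 * S * D) + 8 + (e + 1)) = 2 * A * (N * (S * D)) + 8 * N + (e + 1) * N := by ring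
    have e2 : s * (L.length + 1) ≤ s * V := Nat.mul_le_mul_left _ hDV
    have e3 : (e + 1) * N + (e + 1) ≤ (e + 1) * V := by
      rw [← Nat.mul_succ]; exact Nat.mul_le_mul_left _ (by omega)
    have e4 : 2 * A * (N * (S * D)) ≤ 2 * A * V := Nat.mul_le_mul_left _ (by omega)
    have e5 : E₀.cost ≤ E₀.cost * V := Nat.le_mul_of_pos_right _ (by omega)
    rw [e1]
    have e6 : (E₀.cost + 1 + (s + (2 + (2 + (e + 1 + ((modulusP k).size + (4 + 4)))))) + s + 2 * A) * V
      = E₀.cost * V + 13 * V + s * V + (e + 1) * V + (modulusP k).size * V + s * V + 2 * A * V := by ring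
    rw [e6]
    have := Nat.zero_le ((modulusP k).size * V)
    omega

end EvenCycles

namespace EvenCycles

/-! ### Canonical tuples -/

variable {n : ℕ} {L : List (Fin n × Fin n)} {G : SimpleGraph (Fin n)}

section cyclic

variable {m : ℕ} {v w : Fin (m + 3) → Fin n}

theorem isCycleTuple_iff_add_one :
    IsCycleTuple G v ↔ Function.Injective v ∧ ∀ i, G.Adj (v i) (v (i + 1)) := by
  constructor
  · rintro ⟨h1, h2⟩
    exact ⟨h1, fun i => by simpa [finRotate_apply] using h2 i⟩
  · rintro ⟨h1, h2⟩
    exact ⟨h1, fun i => by simpa [finRotate_apply] using h2 i⟩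

theorem mem_cycleEdges {e : Sym2 (Fin n)} : e ∈ cycleEdges v ↔ ∃ i, s(v i, v (i + 1)) = e := by
  simp [cycleEdges]

theorem mk_mem_cycleEdges (hv : Function.Injective v) {i : Fin (m + 3)} {x : Fin n} :
    s(v i, x) ∈ cycleEdges v ↔ x = v (i + 1) ∨ x = v (i - 1) := by
  rw [mem_cycleEdges]
  constructor
  · rintro ⟨j, hj⟩
    rw [Sym2.eq_iff] at hj
    rcases hj with ⟨h1, h2⟩ | ⟨h1, h2⟩
    · rw [hv h1] at h2; exact Or.inl h2.symm
    · right; rw [← h1, ← hv h2]; congr 1; abel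
  · rintro (rfl | rfl)
    · exact ⟨i, rfl⟩
    · exact ⟨i - 1, by rw [sub_add_cancel, Sym2.eq_swap]⟩

/-- Rotating a tuple does not change the cycle. -/
theorem IsCycleTuple.rotate (hv : IsCycleTuple G v) (r : Fin (m + 3)) :
    IsCycleTuple G (fun i => v (i + r)) ∧ cycleEdges (fun i => v (i + r)) = cycleEdges v := by
  rw [isCycleTuple_iff_add_one] at hv ⊢
  refine ⟨⟨fun i j h => add_right_cancel (hv.1 h), fun i => ?_⟩, Set.ext fun e => ?_⟩
  · have := hv.2 (i + r)
    rwa [add_right_comm] at this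
  · rw [mem_cycleEdges, mem_cycleEdges]
    constructor
    · rintro ⟨i, rfl⟩
      exact ⟨i + r, by rw [add_right_comm]⟩
    · rintro ⟨i, rfl⟩
      exact ⟨i - r, by rw [add_right_comm, sub_add_cancel]⟩

/-- Reversing a tuple does not change the cycle. -/
theorem IsCycleTuple.reverse (hv : IsCycleTuple G v) :
    IsCycleTuple G (fun i => v (-i)) ∧ cycleEdges (fun i => v (-i)) = cycleEdges v := by
  rw [isCycleTuple_iff_add_one] at hv ⊢
  have key : ∀ i : Fin (m + 3), -(i + 1) + 1 = -i := fun i => by abel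
  refine ⟨⟨fun i j h => neg_injective (hv.1 h), fun i => ?_⟩, Set.ext fun e => ?_⟩
  · have := hv.2 (-(i + 1))
    rw [key] at this
    exact this.symm
  · rw [mem_cycleEdges, mem_cycleEdges]
    constructor
    · rintro ⟨i, rfl⟩
      exact ⟨-(i + 1), by rw [key, Sym2.eq_swap]⟩
    · rintro ⟨i, rfl⟩
      exact ⟨-(i + 1), by rw [key, neg_neg, neg_neg, Sym2.eq_swap]⟩

theorem range_eq_of_cycleEdges (h : cycleEdges v = cycleEdges w) : Set.range v = Set.range w := by
  have key : ∀ {v w : Fin (m + 3) → Fin n}, cycleEdges v = cycleEdges w →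
      Set.range v ⊆ Set.range w := by
    rintro v w h _ ⟨i, rfl⟩
    obtain ⟨j, hj⟩ := mem_cycleEdges.1 (h ▸ mem_cycleEdges.2 ⟨i, rfl⟩ : s(v i, v (i + 1)) ∈ cycleEdges w)
    have : v i ∈ s(w j, w (j + 1)) := hj ▸ Sym2.mem_mk_left _ _
    rcases Sym2.mem_iff.1 this with h | h
    · exact ⟨j, h.symm⟩
    · exact ⟨j + 1, h.symm⟩
  exact (key h).antisymm (key h.symm)

theorem ext_one : ext v 1 = v 1 := ext_of_lt (by omega)

theorem ext_last : ext v (m + 3 - 1) = v (-1) := by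
  rw [ext_of_lt (by omega)]
  congr 2
  exact eq_neg_of_add_eq_zero_left (Fin.last_add_one (m + 2))

theorem vkey_injective {u v : Fin n} (h : vkey n (nbOf L) u = vkey n (nbOf L) v) : u = v := by
  have := congrArg (· % n) h
  simp only [vkey, Nat.mul_add_mod_self_right, Nat.mod_eq_of_lt u.2, Nat.mod_eq_of_lt v.2] at this
  exact Fin.ext this

theorem canonical_iff : Canonical G L v ↔ IsCycleTuple G v ∧
    (∀ i, i ≠ 0 → vkey n (nbOf L) (v i) < vkey n (nbOf L) (v 0)) ∧ v 1 < v (-1) := by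
  have h0 : ext v 0 = v 0 := ext_of_lt (by omega)
  constructor
  · rintro ⟨h1, h2, h3⟩
    refine ⟨h1, fun i hi => ?_, ?_⟩
    · have := h2 i (Nat.one_le_iff_ne_zero.2 fun h => hi (Fin.ext h)) i.2
      rwa [ext_of_lt i.2, h0] at this
    · rwa [ext_one, ext_last] at h3
  · rintro ⟨h1, h2, h3⟩
    refine ⟨h1, fun i hi hi' => ?_, ?_⟩
    · rw [ext_of_lt hi', h0]
      exact h2 _ fun h => by have := congrArg Fin.val h; simp at this; omega
    · rwa [ext_one, ext_last]

theorem one_ne_neg_one : (1 : Fin (m + 3)) ≠ -1 := by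
  intro h
  have h2 : (1 : Fin (m + 3)) + 1 = 0 := by nth_rewrite 2 [h]; abel
  have := congrArg Fin.val h2
  rw [Fin.val_add, Fin.val_one, Fin.val_zero, Nat.mod_eq_of_lt (by omega)] at this
  omega

/-- A tuple that traverses a cycle becomes canonical after a rotation that moves the vertex with the
largest key to the front, and possibly a reversal. -/
theorem exists_canonical_add_three (hv : IsCycleTuple G v) :
    ∃ w : Fin (m + 3) → Fin n, Canonical G L w ∧ cycleEdges w = cycleEdges v := by
  obtain ⟨r, -, hr⟩ := Finset.exists_max_image Finset.univ (fun i => vkey n (nbOf L) (v i)) ⟨0, by simp⟩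
  obtain ⟨hw, hwe⟩ := hv.rotate r
  set w := fun i => v (i + r) with hwd
  have htop : ∀ i, i ≠ 0 → vkey n (nbOf L) (w i) < vkey n (nbOf L) (w 0) := by
    intro i hi
    have h1 := hr (i + r) (Finset.mem_univ _)
    rw [show r = 0 + r by rw [zero_add]] at h1
    refine lt_of_le_of_ne ?_ fun h => hi (hw.injective (vkey_injective h))
    simpa [hwd] using h1
  rcases lt_or_gt_of_ne (hw.injective.ne one_ne_neg_one) with h | h
  · exact ⟨w, canonical_iff.2 ⟨hw, htop, h⟩, hwe⟩
  · obtain ⟨hw', hwe'⟩ := hw.reverse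
    refine ⟨_, canonical_iff.2 ⟨hw', fun i hi => ?_, ?_⟩, hwe'.trans hwe⟩
    · rw [neg_zero]; exact htop _ (neg_ne_zero.2 hi)
    · rwa [neg_neg]

/-- A canonical tuple is determined by the edges of its cycle: its first entry is the vertex with the
largest key, its second entry the smaller neighbour of that vertex on the cycle, and each further
entry the neighbour of the last one that has not just been passed. -/
theorem canonical_unique_add_three (hv : Canonical G L v) (hw : Canonical G L w)
    (h : cycleEdges v = cycleEdges w) : v = w := by
  obtain ⟨hv1, hv2, hv3⟩ := canonical_iff.1 hv
  obtain ⟨hw1, hw2, hw3⟩ := canonical_iff.1 hw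
  have hrange := range_eq_of_cycleEdges h
  have e0 : v 0 = w 0 := by
    obtain ⟨i, hi⟩ : w 0 ∈ Set.range v := hrange ▸ ⟨0, rfl⟩
    obtain ⟨j, hj⟩ : v 0 ∈ Set.range w := hrange ▸ ⟨0, rfl⟩
    by_contra hne
    have h1 := hv2 i (by rintro rfl; exact hne hi)
    have h2 := hw2 j (by rintro rfl; exact hne hj.symm)
    rw [hi] at h1
    rw [hj] at h2
    omega
  have hnb : ∀ i j x, v i = w j → ((x = v (i + 1) ∨ x = v (i - 1)) ↔
      (x = w (j + 1) ∨ x = w (j - 1))) := by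
    intro i j x hij
    rw [← mk_mem_cycleEdges hv1.injective, ← mk_mem_cycleEdges hw1.injective, h, hij]
  have e1 : v 1 = w 1 := by
    have h1 := (hnb 0 0 (v 1) e0).1 (by simp)
    have h2 := (hnb 0 0 (v (-1)) e0).1 (by simp)
    have h3 := hv1.injective.ne (one_ne_neg_one (m := m))
    simp only [zero_add, zero_sub] at h1 h2
    rcases h1 with h1 | h1
    · exact h1
    · rcases h2 with h2 | h2
      · rw [h1, h2] at hv3
        exact absurd hv3 (not_lt.2 hw3.le)
      · exact absurd (h1.trans h2.symm) h3
  have key : ∀ i, v i = w i ∧ v (i + 1) = w (i + 1) := by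
    intro i
    induction i using Fin.induction with
    | zero => simpa using ⟨e0, e1⟩
    | succ i ih =>
      rw [← Fin.coeSucc_eq_succ]
      refine ⟨ih.2, ?_⟩
      rcases (hnb _ _ (v (i.castSucc + 1 + 1)) ih.2).1 (Or.inl rfl) with h1 | h1
      · exact h1
      · rw [add_sub_cancel_right, ← ih.1] at h1
        have h2 := hv1.injective h1
        rw [add_assoc, add_eq_left] at h2
        exact absurd (eq_neg_of_add_eq_zero_left h2) one_ne_neg_one
  exact funext fun i => (key i).1

end cyclic

variable {ℓ : ℕ}

theorem exists_canonical (hℓ : 3 ≤ ℓ) {v : Fin ℓ → Fin n} (hv : IsCycleTuple G v) :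
    ∃ w : Fin ℓ → Fin n, Canonical G L w ∧ cycleEdges w = cycleEdges v := by
  obtain ⟨m, rfl⟩ : ∃ m, ℓ = m + 3 := ⟨ℓ - 3, by omega⟩
  exact exists_canonical_add_three hv

theorem canonical_unique (hℓ : 3 ≤ ℓ) {v w : Fin ℓ → Fin n} (hv : Canonical G L v)
    (hw : Canonical G L w) (h : cycleEdges v = cycleEdges w) : v = w := by
  obtain ⟨m, rfl⟩ : ∃ m, ℓ = m + 3 := ⟨ℓ - 3, by omega⟩
  exact canonical_unique_add_three hv hw h

/-- A list of the canonical tuples is a list of the cycles. -/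
theorem Lists.listsAllCycles (hℓ : 3 ≤ ℓ) {out : List ℕ}
    (h : Lists out {v : Fin ℓ → Fin n | Canonical G L v}) : ListsAllCycles G ℓ out := by
  obtain ⟨cs, hnd, hmem, rfl⟩ := h
  refine ⟨cs, fun v hv => ((hmem v).1 hv).cycle, ?_, fun v hv => ?_, rfl⟩
  · exact List.Nodup.map_on (fun v hv w hw h =>
      canonical_unique hℓ ((hmem v).1 hv) ((hmem w).1 hw) h) hnd
  · obtain ⟨w, hw, hwe⟩ := exists_canonical (L := L) hℓ hv
    exact List.mem_map.2 ⟨w, (hmem w).2 hw, hwe⟩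

/-- A cycle is traversed by a bounded number of tuples. -/
theorem sum_tupleCount_le (hℓ : 3 ≤ ℓ) :
    ∑ x ∈ Finset.range n, tupleCount G ℓ x ≤ ℓ ^ ℓ * cycleCount G ℓ := by
  classical
  obtain ⟨m, rfl⟩ : ∃ m, ℓ = m + 3 := ⟨ℓ - 3, by omega⟩
  set A : Finset (Fin (m + 3) → Fin n) := Finset.univ.filter fun v => IsCycleTuple G v with hA
  have h1 : ∑ x ∈ Finset.range n, tupleCount G (m + 3) x = A.card := by
    rw [Finset.card_eq_sum_card_fiberwise (f := fun v => ext v 0) (t := Finset.range n)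
      fun v _ => by
        rw [Finset.mem_coe, Finset.mem_range]
        exact (ext_of_lt (v := v) (i := 0) (by omega)).trans_lt (Fin.is_lt _)]
    refine Finset.sum_congr rfl fun x _ => ?_
    rw [tupleCount, hA, Finset.filter_filter]
  have h2 : cycleCount G (m + 3) = (A.image cycleEdges).card := by
    rw [cycleCount, ← Set.ncard_coe_finset]
    congr 1
    ext S
    simp [hA, eq_comm]
  rw [h1, h2]
  refine Finset.card_le_mul_card_image A _ fun S hS => ?_
  obtain ⟨v, hv, rfl⟩ := Finset.mem_image.1 hS
  calc _ ≤ (Finset.univ.image fun φ : Fin (m + 3) → Fin (m + 3) => v ∘ φ).card := by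
        refine Finset.card_le_card fun w hw => ?_
        have hr := range_eq_of_cycleEdges (Finset.mem_filter.1 hw).2
        have : ∀ i, ∃ j, v j = w i := fun i => by
          have : w i ∈ Set.range v := hr ▸ ⟨i, rfl⟩
          exact this
        choose φ hφ using this
        exact Finset.mem_image.2 ⟨φ, Finset.mem_univ _, funext hφ⟩
    _ ≤ _ := Finset.card_image_le.trans (by simp)

end EvenCycles

namespace EvenCycles

/-! ### Few edges between sets of vertices of small degree -/

variable {n : ℕ}

open Classical in
/-- The number of edges between two disjoint sets of vertices. -/
noncomputable def edgesBetween (G : SimpleGraph (Fin n)) (A B : Finset (Fin n)) : ℕ :=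
  ((A ×ˢ B).filter fun e => G.Adj e.1 e.2).card

theorem ncard_edgeSet_between {G : SimpleGraph (Fin n)} {A B : Finset (Fin n)} (h : Disjoint A B) :
    (G.between (A : Set (Fin n)) B).edgeSet.ncard = edgesBetween G A B := by
  classical
  have hne : ∀ x, x ∈ A → x ∉ B := fun _ hx => Finset.disjoint_left.1 h hx
  have himg : (G.between (A : Set (Fin n)) B).edgeSet =
      ((((A ×ˢ B).filter fun e => G.Adj e.1 e.2).image fun e => s(e.1, e.2) : Finset _) : Set _) := by
    ext e
    induction e using Sym2.ind with
    | _ x y =>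
    simp only [SimpleGraph.mem_edgeSet, SimpleGraph.between_adj, Finset.coe_image, Set.mem_image,
      Finset.mem_coe, Finset.mem_filter, Finset.mem_product, Prod.exists]
    constructor
    · rintro ⟨hadj, ⟨hx, hy⟩ | ⟨hx, hy⟩⟩
      · exact ⟨x, y, ⟨⟨hx, hy⟩, hadj⟩, rfl⟩
      · exact ⟨y, x, ⟨⟨hy, hx⟩, hadj.symm⟩, Sym2.eq_swap⟩
    · rintro ⟨u, v, ⟨⟨hu, hv⟩, hadj⟩, he⟩
      rcases Sym2.eq_iff.1 he with ⟨rfl, rfl⟩ | ⟨rfl, rfl⟩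
      · exact ⟨hadj, Or.inl ⟨hu, hv⟩⟩
      · exact ⟨hadj.symm, Or.inr ⟨hv, hu⟩⟩
  rw [himg, Set.ncard_coe_finset, edgesBetween, Finset.card_image_of_injOn]
  rintro ⟨u, v⟩ h1 ⟨u', v'⟩ h2 he
  simp only [Finset.coe_filter, Finset.mem_product, Set.mem_ofPred_eq] at h1 h2
  rcases Sym2.eq_iff.1 he with ⟨h3, h4⟩ | ⟨h3, h4⟩
  · exact Prod.ext h3 h4
  · simp only at h3
    exact absurd h2.1.2 (hne _ (h3 ▸ h1.1.1))

theorem cycleCount_mono {G H : SimpleGraph (Fin n)} (h : G ≤ H) (ℓ : ℕ) :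
    cycleCount G ℓ ≤ cycleCount H ℓ := by
  refine Set.ncard_le_ncard ?_ (Set.toFinite _)
  rintro S ⟨v, hv, rfl⟩
  exact ⟨v, ⟨hv.injective, fun i => h (hv.adj i)⟩, rfl⟩

/-- The term `s ^ ((k + 1) / (2 * k))` of the supersaturation conjecture is at most `σ √s`, as long as
`s ≤ σ ^ (2 * k)`. -/
theorem sq_rpow_le {k : ℕ} (hk : 2 ≤ k) {s σ : ℝ} (hσ : 1 ≤ σ) (hs : 0 < s) (h : s ≤ σ ^ (2 * k)) :
    (s ^ (((k : ℝ) + 1) / (2 * k))) ^ 2 ≤ σ ^ 2 * s := by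
  have hk0 : (k : ℝ) ≠ 0 := by positivity
  have h1 : s ^ ((k : ℝ)⁻¹) ≤ σ ^ 2 := by
    calc s ^ ((k : ℝ)⁻¹) ≤ ((σ ^ 2) ^ k) ^ ((k : ℝ)⁻¹) :=
          Real.rpow_le_rpow hs.le (by rwa [← pow_mul]) (by positivity)
      _ = σ ^ 2 := Real.pow_rpow_inv_natCast (by positivity) (by omega)
  calc (s ^ (((k : ℝ) + 1) / (2 * k))) ^ 2 = s ^ ((((k : ℝ) + 1) / (2 * k)) * (2 : ℕ)) := by
        rw [Real.rpow_mul hs.le, Real.rpow_natCast]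
    _ = s ^ ((k : ℝ)⁻¹ + 1) := by congr 1; push_cast; field_simp; ring
    _ = s ^ ((k : ℝ)⁻¹) * s := by rw [Real.rpow_add hs, Real.rpow_one]
    _ ≤ _ := by gcongr

/-- If there are few `2k`-cycles and few edges, then the number of edges between disjoint sets whose
vertices have degree at most `σ ^ 2` is `O(σ √(|A| |B|))`: otherwise the supersaturation conjecture
would yield too many `2k`-cycles, or one of the trivial bounds for the number of edges is
sufficient. -/
theorem exists_edgesBetween_le {k : ℕ} (hk : 2 ≤ k) (hconj : SupersaturationConjecture k) :
    ∃ D : ℝ, 1 ≤ D ∧ ∀ (n : ℕ) (G : SimpleGraph (Fin n)) (σ : ℝ), 1 ≤ σ →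
      (cycleCount G (2 * k) : ℝ) ≤ σ ^ (2 * k) → ∀ A B : Finset (Fin n), Disjoint A B →
      (edgesBetween G A B : ℝ) ≤ σ ^ (k + 1) → (edgesBetween G A B : ℝ) ≤ σ ^ 2 * A.card →
      (edgesBetween G A B : ℝ) ≤ σ ^ 2 * B.card →
      (edgesBetween G A B : ℝ) ^ 2 ≤ D * σ ^ 2 * (A.card * B.card) := by
  obtain ⟨C, c, hC, hc, hsat⟩ := hconj
  set D₁ := 3 * C * k with hD₁
  have hD₁0 : 0 ≤ D₁ := by positivity
  refine ⟨1 + 1 / c + D₁ + D₁ ^ 2, by have : 0 ≤ 1 / c + D₁ + D₁ ^ 2 := by positivity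
                                      linarith, ?_⟩
  intro n G σ hσ ht A B hAB hm hA hB
  set e : ℝ := (edgesBetween G A B : ℝ) with he
  set a : ℝ := (A.card : ℝ) with ha
  set b : ℝ := (B.card : ℝ) with hb
  have he0 : 0 ≤ e := Nat.cast_nonneg _
  have ha0 : 0 ≤ a := Nat.cast_nonneg _
  have hb0 : 0 ≤ b := Nat.cast_nonneg _
  have hσ2 : 0 ≤ σ ^ 2 := by positivity
  -- it suffices to prove the bound with any one of the summands of the constant
  have fin : ∀ d, d ≤ 1 + 1 / c + D₁ + D₁ ^ 2 → e ^ 2 ≤ d * σ ^ 2 * (a * b) →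
      e ^ 2 ≤ (1 + 1 / c + D₁ + D₁ ^ 2) * σ ^ 2 * (a * b) := fun d hd h =>
    h.trans (by gcongr)
  have hc0 : 0 ≤ 1 / c := by positivity
  rcases (mul_nonneg ha0 hb0).eq_or_lt with hab | hab
  · have : e = 0 := by
      rcases mul_eq_zero.1 hab.symm with h | h
      · rw [h, mul_zero] at hA; linarith
      · rw [h, mul_zero] at hB; linarith
    rw [this, ← hab]; simp
  set s := (a * b) ^ (((k : ℝ) + 1) / (2 * k)) with hs
  have hs0 : 0 ≤ s := Real.rpow_nonneg hab.le _
  by_cases hlarge : C * (k * (a + b + s)) ≤ e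
  · have hG := hsat (Fin n) (G.between (A : Set (Fin n)) B) A B
      (SimpleGraph.between_isBipartiteWith (Finset.disjoint_coe.2 hAB))
    rw [ncard_edgeSet_between hAB] at hG
    have h1 := (hG hlarge).trans ((Nat.cast_le.2 (cycleCount_mono SimpleGraph.between_le _)).trans ht)
    rw [← mul_pow, ← ha, ← hb, ← he] at h1
    have habk : 0 < (a * b) ^ k := by positivity
    have h2 : (e ^ 2) ^ k ≤ ((1 + 1 / c) * σ ^ 2 * (a * b)) ^ k := by
      have h3 : e ^ (2 * k) ≤ 1 / c * (σ ^ (2 * k) * (a * b) ^ k) := by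
        rw [mul_div_assoc', div_le_iff₀ habk] at h1
        rw [one_div, le_inv_mul_iff₀ hc]
        exact h1
      have h4 : 1 / c ≤ (1 + 1 / c) ^ k :=
        (by linarith : 1 / c ≤ 1 + 1 / c).trans (le_self_pow₀ (by linarith) (by omega))
      calc (e ^ 2) ^ k = e ^ (2 * k) := by rw [pow_mul]
        _ ≤ 1 / c * (σ ^ (2 * k) * (a * b) ^ k) := h3
        _ ≤ (1 + 1 / c) ^ k * (σ ^ (2 * k) * (a * b) ^ k) := by gcongr
        _ = _ := by rw [mul_pow _ (a * b), mul_pow _ (σ ^ 2), ← pow_mul σ]; ring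
    exact fin _ (by nlinarith) (le_of_pow_le_pow_left₀ (by omega) (by positivity) h2)
  · have hlt : e < C * (k * (a + b + s)) := not_le.1 hlarge
    have hCk : 0 < C * k := by positivity
    have : e ≤ D₁ * a ∨ e ≤ D₁ * b ∨ e ≤ D₁ * s := by
      by_contra! h
      obtain ⟨h1, h2, h3⟩ := h
      nlinarith
    rcases this with h | h | h
    · refine fin D₁ (by nlinarith) ?_
      calc e ^ 2 = e * e := sq e
        _ ≤ (D₁ * a) * (σ ^ 2 * b) := by gcongr
        _ = _ := by ring
    · refine fin D₁ (by nlinarith) ?_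
      calc e ^ 2 = e * e := sq e
        _ ≤ (D₁ * b) * (σ ^ 2 * a) := by gcongr
        _ = _ := by ring
    · rcases le_or_gt (a * b) (σ ^ (2 * k)) with h' | h'
      · refine fin (D₁ ^ 2) (by nlinarith) ?_
        calc e ^ 2 ≤ (D₁ * s) ^ 2 := by gcongr
          _ = D₁ ^ 2 * s ^ 2 := by ring
          _ ≤ D₁ ^ 2 * (σ ^ 2 * (a * b)) := by gcongr; exact sq_rpow_le hk hσ hab h'
          _ = _ := by ring
      · refine fin 1 (by nlinarith) ?_
        calc e ^ 2 ≤ (σ ^ (k + 1)) ^ 2 := by gcongr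
          _ = σ ^ 2 * σ ^ (2 * k) := by ring
          _ ≤ σ ^ 2 * (a * b) := by gcongr
          _ = _ := by ring

end EvenCycles

namespace EvenCycles

/-! ### A bilinear bound -/

variable {n : ℕ}

/-- The elements of `A` at which the value of `f` is between `2 ^ a` and `2 ^ (a + 1)`. -/
def level (A : Finset (Fin n)) (f : Fin n → ℕ) (a : ℕ) : Finset (Fin n) :=
  A.filter fun u => f u ≠ 0 ∧ Nat.log 2 (f u) = a

theorem le_sum_level {A : Finset (Fin n)} {f : Fin n → ℕ} {N : ℕ} {u : Fin n} (hu : u ∈ A)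
    (hf : f u < 2 ^ N) :
    (f u : ℝ) ≤ ∑ a ∈ Finset.range N, if u ∈ level A f a then (2 : ℝ) ^ (a + 1) else 0 := by
  have hnn : ∀ a ∈ Finset.range N, 0 ≤ if u ∈ level A f a then (2 : ℝ) ^ (a + 1) else 0 :=
    fun a _ => by split_ifs <;> positivity
  by_cases h0 : f u = 0
  · rw [h0, Nat.cast_zero]; exact Finset.sum_nonneg hnn
  · have hlog : Nat.log 2 (f u) ∈ Finset.range N := by
      rw [Finset.mem_range]
      exact Nat.log_lt_of_lt_pow h0 hf
    refine le_trans ?_ (Finset.single_le_sum hnn hlog)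
    rw [if_pos (show u ∈ level A f (Nat.log 2 (f u)) from Finset.mem_filter.2 ⟨hu, h0, rfl⟩)]
    exact_mod_cast (Nat.lt_pow_succ_log_self (by norm_num) (f u)).le

/-- The Cauchy–Schwarz inequality for the sum over the `N` levels of a function. -/
theorem sum_sqrt_card_level_le (A : Finset (Fin n)) (f : Fin n → ℕ) (N : ℕ) :
    ∑ a ∈ Finset.range N, (2 : ℝ) ^ a * √((level A f a).card) ≤ √N * √(∑ u ∈ A, (f u : ℝ) ^ 2) := by
  rw [← Real.sqrt_mul (Nat.cast_nonneg _)]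
  refine Real.le_sqrt_of_sq_le (sq_sum_le_card_mul_sum_sq.trans ?_)
  rw [Finset.card_range]
  refine mul_le_mul_of_nonneg_left ?_ (Nat.cast_nonneg _)
  have hlev : ∀ a, ((2 : ℝ) ^ a * √((level A f a).card)) ^ 2 ≤ ∑ u ∈ level A f a, (f u : ℝ) ^ 2 := by
    intro a
    rw [mul_pow, Real.sq_sqrt (Nat.cast_nonneg _), mul_comm, ← nsmul_eq_mul]
    refine Finset.card_nsmul_le_sum _ _ _ fun u hu => ?_
    obtain ⟨-, h0, rfl⟩ := Finset.mem_filter.1 hu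
    gcongr
    exact_mod_cast Nat.pow_log_le_self 2 h0
  refine (Finset.sum_le_sum fun a _ => hlev a).trans ?_
  rw [← Finset.sum_biUnion]
  · refine Finset.sum_le_sum_of_subset_of_nonneg (fun u hu => ?_) fun u _ _ => by positivity
    obtain ⟨a, -, h⟩ := Finset.mem_biUnion.1 hu
    exact (Finset.mem_filter.1 h).1
  · intro a _ b _ hab
    refine Finset.disjoint_left.2 fun u hu hu' => hab ?_
    rw [← (Finset.mem_filter.1 hu).2.2, ← (Finset.mem_filter.1 hu').2.2]

open Classical in
theorem cast_edgesBetween (G : SimpleGraph (Fin n)) (A B : Finset (Fin n)) :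
    (edgesBetween G A B : ℝ) = ∑ u ∈ A, ∑ v ∈ B, if G.Adj u v then 1 else 0 := by
  rw [edgesBetween, Finset.card_filter, Nat.cast_sum, Finset.sum_product]
  simp

open Classical in
/-- If there are at most `q √(|A'| |B'|)` edges between any subsets of `A` and `B`, then the bilinear
form of the edges between `A` and `B` has norm at most `4 q N` on functions with values below
`2 ^ N`, by a decomposition of the functions into `N` dyadic levels. -/
theorem sum_adj_mul_le {G : SimpleGraph (Fin n)} {A B : Finset (Fin n)} {q : ℝ} (hq : 0 ≤ q)
    (hAB : ∀ A' ⊆ A, ∀ B' ⊆ B, (edgesBetween G A' B' : ℝ) ^ 2 ≤ q ^ 2 * (A'.card * B'.card))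
    {f g : Fin n → ℕ} {N : ℕ} (hf : ∀ u ∈ A, f u < 2 ^ N) (hg : ∀ v ∈ B, g v < 2 ^ N) :
    ∑ u ∈ A, ∑ v ∈ B, (if G.Adj u v then (f u : ℝ) * g v else 0) ≤
      4 * q * N * (√(∑ u ∈ A, (f u : ℝ) ^ 2) * √(∑ v ∈ B, (g v : ℝ) ^ 2)) := by
  have he : ∀ a b, (edgesBetween G (level A f a) (level B g b) : ℝ) ≤
      q * (√((level A f a).card) * √((level B g b).card)) := by
    intro a b
    refine le_of_sq_le_sq ?_ (by positivity)
    rw [mul_pow, mul_pow, Real.sq_sqrt (Nat.cast_nonneg _), Real.sq_sqrt (Nat.cast_nonneg _)]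
    exact hAB _ (Finset.filter_subset _ _) _ (Finset.filter_subset _ _)
  calc ∑ u ∈ A, ∑ v ∈ B, (if G.Adj u v then (f u : ℝ) * g v else 0)
      ≤ ∑ u ∈ A, ∑ v ∈ B, ∑ a ∈ Finset.range N, ∑ b ∈ Finset.range N,
          (2 : ℝ) ^ (a + 1) * 2 ^ (b + 1) * (if u ∈ level A f a then if v ∈ level B g b then
            if G.Adj u v then 1 else 0 else 0 else 0) := by
        refine Finset.sum_le_sum fun u hu => Finset.sum_le_sum fun v hv => ?_
        split_ifs with hadj
        · refine (mul_le_mul (le_sum_level hu (hf u hu)) (le_sum_level hv (hg v hv))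
            (Nat.cast_nonneg _) (Finset.sum_nonneg fun a _ => by split_ifs <;> positivity)).trans_eq ?_
          rw [Finset.sum_mul_sum]
          refine Finset.sum_congr rfl fun a _ => Finset.sum_congr rfl fun b _ => ?_
          split_ifs <;> simp
        · simp
    _ = ∑ a ∈ Finset.range N, ∑ b ∈ Finset.range N,
          (2 : ℝ) ^ (a + 1) * 2 ^ (b + 1) * edgesBetween G (level A f a) (level B g b) := by
        rw [Finset.sum_congr rfl fun u _ => Finset.sum_comm, Finset.sum_comm]
        refine Finset.sum_congr rfl fun a _ => ?_
        rw [Finset.sum_congr rfl fun u _ => Finset.sum_comm, Finset.sum_comm]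
        refine Finset.sum_congr rfl fun b _ => ?_
        simp_rw [← Finset.mul_sum]
        rw [cast_edgesBetween]
        congr 1
        rw [level, Finset.sum_filter]
        refine Finset.sum_congr rfl fun u hu => ?_
        simp only [Finset.mem_filter, hu, true_and]
        split_ifs with h
        · rw [level, Finset.sum_filter]
          refine Finset.sum_congr rfl fun v hv => ?_
          simp only [Finset.mem_filter, hv, true_and]
        · simp
    _ ≤ ∑ a ∈ Finset.range N, ∑ b ∈ Finset.range N, (2 : ℝ) ^ (a + 1) * 2 ^ (b + 1) *
          (q * (√((level A f a).card) * √((level B g b).card))) := by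
        gcongr with a _ b _
        exact he a b
    _ = 4 * q * ((∑ a ∈ Finset.range N, (2 : ℝ) ^ a * √((level A f a).card)) *
          ∑ b ∈ Finset.range N, (2 : ℝ) ^ b * √((level B g b).card)) := by
        rw [Finset.sum_mul_sum, Finset.mul_sum]
        refine Finset.sum_congr rfl fun a _ => ?_
        rw [Finset.mul_sum]
        refine Finset.sum_congr rfl fun b _ => ?_
        ring
    _ ≤ 4 * q * ((√N * √(∑ u ∈ A, (f u : ℝ) ^ 2)) * (√N * √(∑ v ∈ B, (g v : ℝ) ^ 2))) := by
        gcongr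
        · exact sum_sqrt_card_level_le A f N
        · exact sum_sqrt_card_level_le B g N
    _ = 4 * q * (√N * √N) * (√(∑ u ∈ A, (f u : ℝ) ^ 2) * √(∑ v ∈ B, (g v : ℝ) ^ 2)) := by ring
    _ = _ := by rw [Real.mul_self_sqrt (Nat.cast_nonneg _)]

open Classical in
/-- A function on `A` that is bounded by the sums of `g` over the neighbours in `B` has norm at most
`4 q N` times that of `g`. -/
theorem sum_sq_le_of_le_sum_adj {G : SimpleGraph (Fin n)} {A B : Finset (Fin n)} {q : ℝ} (hq : 0 ≤ q)
    (hAB : ∀ A' ⊆ A, ∀ B' ⊆ B, (edgesBetween G A' B' : ℝ) ^ 2 ≤ q ^ 2 * (A'.card * B'.card))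
    {f g : Fin n → ℕ} {N : ℕ} (hf : ∀ u ∈ A, f u < 2 ^ N) (hg : ∀ v ∈ B, g v < 2 ^ N)
    (h : ∀ u ∈ A, f u ≤ ∑ v ∈ B, if G.Adj u v then g v else 0) :
    ∑ u ∈ A, (f u : ℝ) ^ 2 ≤ (4 * q * N) ^ 2 * ∑ v ∈ B, (g v : ℝ) ^ 2 := by
  set F := ∑ u ∈ A, (f u : ℝ) ^ 2 with hF
  set S := ∑ v ∈ B, (g v : ℝ) ^ 2 with hS
  have hF0 : 0 ≤ F := Finset.sum_nonneg fun u _ => by positivity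
  have hS0 : 0 ≤ S := Finset.sum_nonneg fun u _ => by positivity
  have h1 : F ≤ 4 * q * N * (√F * √S) := by
    refine le_trans (Finset.sum_le_sum fun u hu => ?_) (sum_adj_mul_le hq hAB hf hg)
    rw [sq]
    calc (f u : ℝ) * f u ≤ f u * (∑ v ∈ B, if G.Adj u v then g v else 0 : ℕ) := by
          gcongr; exact h u hu
      _ = _ := by
          rw [Nat.cast_sum, Finset.mul_sum]
          refine Finset.sum_congr rfl fun v _ => ?_
          split_ifs <;> simp
  rcases hF0.eq_or_lt with h0 | h0
  · rw [← h0]; positivity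
  · have hs : 0 < √F := Real.sqrt_pos.2 h0
    have h2 : √F ≤ 4 * q * N * √S := by
      have : √F * √F ≤ √F * (4 * q * N * √S) := by
        rw [Real.mul_self_sqrt hF0]; linarith
      exact le_of_mul_le_mul_left this hs
    calc F = √F ^ 2 := (Real.sq_sqrt hF0).symm
      _ ≤ (4 * q * N * √S) ^ 2 := by gcongr
      _ = _ := by rw [mul_pow, Real.sq_sqrt hS0]

end EvenCycles

namespace EvenCycles

/-! ### The total size of the layers -/

variable {n : ℕ} {G : SimpleGraph (Fin n)} {L : List (Fin n × Fin n)}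

theorem sum_length_nbOf (L : List (Fin n × Fin n)) :
    ∑ v : Fin n, (nbOf L v).length = 2 * L.length := by
  induction L with
  | nil => simp [nbOf]
  | cons e L ih =>
    have h1 : ∀ v : Fin n, (nbOf (e :: L) v).length =
        ((if e.1 = v then 1 else 0) + if e.2 = v then 1 else 0) + (nbOf L v).length := by
      intro v
      simp only [nbOf, List.flatMap_cons, List.length_append, Fin.val_inj]
      split_ifs <;> simp
    simp only [h1, Finset.sum_add_distrib, ih, Finset.sum_ite_eq, Finset.mem_univ, if_true,
      List.length_cons]
    ring

open Classical in
theorem card_adj_le (hL : IsEdgeList G L) (v : Fin n) (B : Finset (Fin n)) :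
    (B.filter fun u => G.Adj v u).card ≤ (nbOf L v).length := by
  rw [← Finset.card_map Fin.valEmbedding]
  refine (Finset.card_le_card fun x hx => ?_).trans (List.toFinset_card_le (nbOf L v))
  obtain ⟨u, hu, rfl⟩ := Finset.mem_map.1 hx
  rw [List.mem_toFinset]
  exact (mem_nbOf_iff_adj hL).2 (Finset.mem_filter.1 hu).2

theorem edgesBetween_comm (A B : Finset (Fin n)) : edgesBetween G A B = edgesBetween G B A := by
  classical
  unfold edgesBetween
  refine Finset.card_bij (fun e _ => e.swap) ?_ (fun _ _ _ _ h => Prod.swap_injective h) ?_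
  · rintro ⟨u, v⟩ h
    simp only [Finset.mem_filter, Finset.mem_product, Prod.fst_swap, Prod.snd_swap] at h ⊢
    exact ⟨h.1.symm, h.2.symm⟩
  · rintro ⟨u, v⟩ h
    simp only [Finset.mem_filter, Finset.mem_product] at h
    exact ⟨(v, u), by simp [h.1.1, h.1.2, h.2.symm], rfl⟩

theorem edgesBetween_le_sum (hL : IsEdgeList G L) (A B : Finset (Fin n)) :
    edgesBetween G A B ≤ ∑ v ∈ A, (nbOf L v).length := by
  classical
  rw [edgesBetween, Finset.card_filter, Finset.sum_product]
  refine Finset.sum_le_sum fun v _ => ?_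
  rw [← Finset.card_filter]
  exact card_adj_le hL v B

theorem edgesBetween_le_length (hL : IsEdgeList G L) {A B : Finset (Fin n)} (h : Disjoint A B) :
    edgesBetween G A B ≤ L.length := by
  classical
  rw [← ncard_edgeSet_between h]
  have hsub : (G.between (A : Set (Fin n)) B).edgeSet ⊆
      (((L.map fun e => s(e.1, e.2)).toFinset : Finset _) : Set (Sym2 (Fin n))) := by
    intro e
    induction e using Sym2.ind with
    | _ x y =>
    intro he
    rw [List.coe_toFinset]
    exact (hL.2 x y).2 he.1
  refine (Set.ncard_le_ncard hsub (Finset.finite_toSet _)).trans ?_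
  rw [Set.ncard_coe_finset]
  exact (List.toFinset_card_le _).trans (by simp)

/-- Between disjoint sets of vertices of degree at most `σ ^ 2`, there are at most `q √(|A| |B|)`
edges. -/
def CutBound (G : SimpleGraph (Fin n)) (L : List (Fin n × Fin n)) (σ q : ℝ) : Prop :=
  ∀ A B : Finset (Fin n), Disjoint A B → (∀ u ∈ A, ((nbOf L u).length : ℝ) ≤ σ ^ 2) →
    (∀ v ∈ B, ((nbOf L v).length : ℝ) ≤ σ ^ 2) →
    (edgesBetween G A B : ℝ) ^ 2 ≤ q ^ 2 * (A.card * B.card)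

/-- If there are few `2k`-cycles and few edges, the cut bound holds with a factor `O(σ)`. -/
theorem exists_cutBound {k : ℕ} (hk : 2 ≤ k) (hconj : SupersaturationConjecture k) :
    ∃ D : ℝ, 1 ≤ D ∧ ∀ (n : ℕ) (G : SimpleGraph (Fin n)) (L : List (Fin n × Fin n)),
      IsEdgeList G L → ∀ σ : ℝ, 1 ≤ σ → (cycleCount G (2 * k) : ℝ) ≤ σ ^ (2 * k) →
      (L.length : ℝ) ≤ σ ^ (k + 1) → CutBound G L σ (D * σ) := by
  obtain ⟨D, hD, h⟩ := exists_edgesBetween_le hk hconj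
  refine ⟨D, hD, fun n G L hL σ hσ ht hm A B hAB hA hB => ?_⟩
  have hsum : ∀ A B : Finset (Fin n), (∀ u ∈ A, ((nbOf L u).length : ℝ) ≤ σ ^ 2) →
      (edgesBetween G A B : ℝ) ≤ σ ^ 2 * A.card := by
    intro A B hA
    refine (Nat.cast_le.2 (edgesBetween_le_sum hL A B)).trans ?_
    rw [Nat.cast_sum, mul_comm, ← nsmul_eq_mul]
    exact Finset.sum_le_card_nsmul _ _ _ hA
  refine (h n G σ hσ ht A B hAB ?_ (hsum A B hA) ?_).trans ?_
  · exact (Nat.cast_le.2 (edgesBetween_le_length hL hAB)).trans hm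
  · rw [edgesBetween_comm]; exact hsum B A hB
  · rw [mul_pow]
    gcongr
    exact le_self_pow₀ hD (by norm_num)

/-- The conditions on the layers of a search from `x`: layer `j` has colour `d j`, and no degree
exceeds that of `x`. -/
structure Layered (L : List (Fin n × Fin n)) (k : ℕ) (col d : ℕ → ℕ) (ok : ℕ → ℕ → Prop) (x : ℕ) :
    Prop where
  start : col x = d 0
  ne_nil : nbOf L x ≠ []
  step : ∀ j, 1 ≤ j → j < k → ∀ u, ok j u → col u = d j ∧ (nbOf L u).length ≤ (nbOf L x).length

variable {k : ℕ} {col d : ℕ → ℕ} {ok : ℕ → ℕ → ℕ → Prop}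

theorem Layered.of_reach {okx : ℕ → ℕ → Prop} {x : ℕ} (hL : IsEdgeList G L)
    (h : Layered L k col d okx x) {j : ℕ} (hj : j < k) {u : ℕ} (hr : Reach (nbOf L) okx x j u) :
    col u = d j ∧ (nbOf L u).length ≤ (nbOf L x).length ∧ 1 ≤ (nbOf L u).length := by
  cases j with
  | zero =>
    rw [show u = x from hr]
    exact ⟨h.start, le_rfl, List.length_pos_iff.2 h.ne_nil⟩
  | succ j =>
    obtain ⟨h1, v, -, h2⟩ := hr
    obtain ⟨h3, h4⟩ := h.step (j + 1) (by omega) hj u h1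
    exact ⟨h3, h4, List.length_pos_iff.2 (List.ne_nil_of_mem (((arcData hL).symm _ _).1 h2))⟩

open Classical in
/-- The number of `x ∈ X` such that the search from `x` reaches `u` in layer `j`. -/
noncomputable def reachCount (L : List (Fin n × Fin n)) (ok : ℕ → ℕ → ℕ → Prop) (X : Finset (Fin n))
    (j : ℕ) (u : Fin n) : ℕ :=
  (X.filter fun x : Fin n => Reach (nbOf L) (ok x) x j u).card

/-- The vertices of degree at most `σ ^ 2` and with the colour of layer `j`. -/
noncomputable def lowLayer (L : List (Fin n × Fin n)) (σ : ℝ) (col d : ℕ → ℕ) (j : ℕ) :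
    Finset (Fin n) :=
  Finset.univ.filter fun u => col u = d j ∧ ((nbOf L u).length : ℝ) ≤ σ ^ 2

theorem layerCost_eq_sum (L : List (Fin n × Fin n)) (okx : ℕ → ℕ → Prop) (x j : ℕ)
    [DecidablePred fun u : Fin n => Reach (nbOf L) okx x j u] :
    layerCost n (nbOf L) okx x j =
      ∑ u : Fin n, if Reach (nbOf L) okx x j u then 1 + (nbOf L u).length else 0 := by
  classical
  rw [layerCost, Finset.sum_filter, ← Fin.sum_univ_eq_sum_range
    (fun u : ℕ => if Reach (nbOf L) okx x j u then 1 + (nbOf L u).length else 0) n]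
  exact Finset.sum_congr rfl fun u _ => by congr

/-- The total size of layer `j` of all searches, counted by the vertices that are reached. -/
theorem sum_layerCost (L : List (Fin n × Fin n)) (ok : ℕ → ℕ → ℕ → Prop) (X : Finset (Fin n))
    (j : ℕ) : ∑ x ∈ X, layerCost n (nbOf L) (ok x) x j =
      ∑ u : Fin n, reachCount L ok X j u * (1 + (nbOf L u).length) := by
  classical
  simp_rw [layerCost_eq_sum]
  rw [Finset.sum_comm]
  refine Finset.sum_congr rfl fun u _ => ?_
  rw [reachCount, Finset.card_filter, Finset.sum_mul]
  refine Finset.sum_congr rfl fun x _ => ?_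
  split_ifs <;> simp

section low

variable {σ q : ℝ} {N : ℕ} {X : Finset (Fin n)}

theorem card_le_of_layered (hX : ∀ x ∈ X, Layered L k col d (ok x) x) : X.card ≤ 2 * L.length := by
  rw [← sum_length_nbOf L]
  refine le_trans ?_ (Finset.sum_le_univ_sum_of_nonneg (s := X) fun v => Nat.zero_le _)
  rw [Finset.card_eq_sum_ones]
  exact Finset.sum_le_sum fun x hx => List.length_pos_iff.2 (hX x hx).ne_nil

open Classical in
theorem reachCount_lt (hX : ∀ x ∈ X, Layered L k col d (ok x) x) (hN : 2 * L.length < 2 ^ N) (j : ℕ)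
    (u : Fin n) : reachCount L ok X j u < 2 ^ N :=
  ((Finset.card_filter_le _ _).trans (card_le_of_layered hX)).trans_lt hN

theorem mem_lowLayer (hL : IsEdgeList G L) (hX : ∀ x ∈ X, Layered L k col d (ok x) x)
    (hlow : ∀ x ∈ X, ((nbOf L x).length : ℝ) ≤ σ ^ 2) {j : ℕ} (hj : j < k) {x : Fin n} (hx : x ∈ X)
    {u : Fin n} (hr : Reach (nbOf L) (ok x) x j u) : u ∈ lowLayer L σ col d j := by
  obtain ⟨h1, h2, -⟩ := (hX x hx).of_reach hL hj hr
  exact Finset.mem_filter.2 ⟨Finset.mem_univ _, h1, (Nat.cast_le.2 h2).trans (hlow x hx)⟩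

open Classical in
theorem reachCount_succ_le (hL : IsEdgeList G L) (hX : ∀ x ∈ X, Layered L k col d (ok x) x)
    (hlow : ∀ x ∈ X, ((nbOf L x).length : ℝ) ≤ σ ^ 2) {j : ℕ} (hj : j < k) (u : Fin n) :
    reachCount L ok X (j + 1) u ≤
      ∑ v ∈ lowLayer L σ col d j, if G.Adj u v then reachCount L ok X j v else 0 := by
  rw [← Finset.sum_filter]
  refine (Finset.card_le_card (t := ((lowLayer L σ col d j).filter fun v => G.Adj u v).biUnion
    fun v => X.filter fun x : Fin n => Reach (nbOf L) (ok x) x j v) fun x hx => ?_).trans Finset.card_biUnion_le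
  obtain ⟨hxX, -, v, hv, huv⟩ := Finset.mem_filter.1 hx
  obtain ⟨v, rfl⟩ : ∃ v' : Fin n, (v' : ℕ) = v := ⟨⟨v, (lt_of_mem_nbOf huv).2⟩, rfl⟩
  refine Finset.mem_biUnion.2 ⟨v, Finset.mem_filter.2 ⟨mem_lowLayer hL hX hlow hj hxX hv, ?_⟩,
    Finset.mem_filter.2 ⟨hxX, hv⟩⟩
  exact ((mem_nbOf_iff_adj hL).1 huv).symm

/-- The functions `reachCount` of successive layers grow in norm by at most the factor of the
bilinear bound. -/
theorem sum_sq_reachCount_le (hL : IsEdgeList G L) (hcut : CutBound G L σ q) (hq : 0 ≤ q)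
    (hd : ∀ j, j + 1 < k → d j ≠ d (j + 1)) (hX : ∀ x ∈ X, Layered L k col d (ok x) x)
    (hlow : ∀ x ∈ X, ((nbOf L x).length : ℝ) ≤ σ ^ 2) (hN : 2 * L.length < 2 ^ N) {j : ℕ}
    (hj : j < k) :
    ∑ u ∈ lowLayer L σ col d j, (reachCount L ok X j u : ℝ) ^ 2 ≤
      ((4 * q * N) ^ j) ^ 2 * X.card := by
  classical
  induction j with
  | zero =>
    have h0 : ∀ u, (reachCount L ok X 0 u : ℝ) ^ 2 = if u ∈ X then 1 else 0 := by
      intro u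
      have : X.filter (fun x : Fin n => Reach (nbOf L) (ok x) x 0 u) = X.filter fun x : Fin n => x = u := by
        refine Finset.filter_congr fun x _ => ?_
        rw [Reach, Fin.val_inj, eq_comm]
      rw [reachCount, this, Finset.filter_eq']
      split_ifs <;> simp
    rw [Finset.sum_congr rfl fun u _ => h0 u, Finset.sum_ite_mem]
    simpa using Finset.card_le_card (Finset.inter_subset_right (s₁ := lowLayer L σ col d 0) (s₂ := X))
  | succ j ih =>
    have hdis : Disjoint (lowLayer L σ col d (j + 1)) (lowLayer L σ col d j) := by
      refine Finset.disjoint_left.2 fun u h1 h2 => hd j hj ?_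
      rw [← (Finset.mem_filter.1 h1).2.1, ← (Finset.mem_filter.1 h2).2.1]
    refine (sum_sq_le_of_le_sum_adj (G := G) (N := N) hq (fun A hA B hB => ?_)
      (fun u _ => reachCount_lt hX hN _ u) (fun u _ => reachCount_lt hX hN _ u)
      fun u _ => reachCount_succ_le hL hX hlow (by omega) u).trans ?_
    · exact hcut A B (Disjoint.mono hA hB hdis) (fun u hu => (Finset.mem_filter.1 (hA hu)).2.2)
        fun v hv => (Finset.mem_filter.1 (hB hv)).2.2
    · calc (4 * q * N) ^ 2 * _ ≤ (4 * q * N) ^ 2 * (((4 * q * N) ^ j) ^ 2 * X.card) := by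
            gcongr; exact ih (by omega)
        _ = _ := by ring

/-- The total size of layer `j` of the searches from vertices with degree about `2 ^ e`: there are
`O(m / 2 ^ e)` such vertices, and no vertex reached has a degree above `2 ^ (e + 1)`, so the powers of
`2 ^ e` cancel in the Cauchy–Schwarz inequality. -/
theorem sum_layerCost_level_le (hL : IsEdgeList G L) (hcut : CutBound G L σ q) (hq : 0 ≤ q)
    (hd : ∀ j, j + 1 < k → d j ≠ d (j + 1)) (hX : ∀ x ∈ X, Layered L k col d (ok x) x)
    (hlow : ∀ x ∈ X, ((nbOf L x).length : ℝ) ≤ σ ^ 2) (hN : 2 * L.length < 2 ^ N) {j : ℕ}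
    (hj : j < k) {e : ℕ} (he : ∀ x ∈ X, Nat.log 2 (nbOf L x).length = e) :
    ((∑ x ∈ X, layerCost n (nbOf L) (ok x) x j : ℕ) : ℝ) ≤ 6 * L.length * (4 * q * N) ^ j := by
  classical
  set m := L.length
  set S := (lowLayer L σ col d j).filter fun u => reachCount L ok X j u ≠ 0 with hS
  have hsupp : ∀ u, reachCount L ok X j u ≠ 0 → u ∈ lowLayer L σ col d j ∧
      (nbOf L u).length ≤ 2 * 2 ^ e ∧ 1 ≤ (nbOf L u).length := by
    intro u hu
    obtain ⟨x, hx⟩ := Finset.card_ne_zero.1 hu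
    obtain ⟨hxX, hr⟩ := Finset.mem_filter.1 hx
    obtain ⟨-, h2, h3⟩ := (hX x hxX).of_reach hL hj hr
    refine ⟨mem_lowLayer hL hX hlow hj hxX hr, h2.trans ?_, h3⟩
    have := (Nat.lt_pow_succ_log_self (b := 2) (by norm_num) (nbOf L x).length).le
    rwa [he x hxX, pow_succ, mul_comm] at this
  have h1 : ((∑ x ∈ X, layerCost n (nbOf L) (ok x) x j : ℕ) : ℝ) =
      ∑ u ∈ S, (reachCount L ok X j u : ℝ) * (1 + (nbOf L u).length) := by
    rw [sum_layerCost, Nat.cast_sum]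
    refine (Finset.sum_subset (Finset.subset_univ S) fun u _ hu => ?_).symm.trans
      (Finset.sum_congr rfl fun u _ => by push_cast; ring)
    have : reachCount L ok X j u = 0 := by
      by_contra h
      exact hu (Finset.mem_filter.2 ⟨(hsupp u h).1, h⟩)
    rw [this]; simp
  have h2 : ∑ u ∈ S, (reachCount L ok X j u : ℝ) ^ 2 ≤ ((4 * q * N) ^ j) ^ 2 * X.card :=
    (Finset.sum_le_sum_of_subset_of_nonneg (Finset.filter_subset _ _) fun u _ _ => by positivity).trans
      (sum_sq_reachCount_le hL hcut hq hd hX hlow hN hj)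
  have h3 : ∑ u ∈ S, (1 + ((nbOf L u).length : ℝ)) ^ 2 ≤ 16 * 2 ^ e * (m : ℝ) := by
    have hu : ∀ u ∈ S, (1 + ((nbOf L u).length : ℝ)) ^ 2 ≤ 8 * 2 ^ e * ((nbOf L u).length : ℝ) := by
      intro u hu
      obtain ⟨-, h4, h5⟩ := hsupp u (Finset.mem_filter.1 hu).2
      have h4' : ((nbOf L u).length : ℝ) ≤ 2 * 2 ^ e := by exact_mod_cast h4
      have h5' : (1 : ℝ) ≤ (nbOf L u).length := by exact_mod_cast h5
      nlinarith
    have hsum : (∑ u : Fin n, ((nbOf L u).length : ℝ)) = 2 * m := by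
      exact_mod_cast sum_length_nbOf L
    calc _ ≤ ∑ u ∈ S, 8 * 2 ^ e * ((nbOf L u).length : ℝ) := Finset.sum_le_sum hu
      _ ≤ ∑ u : Fin n, 8 * 2 ^ e * ((nbOf L u).length : ℝ) :=
          Finset.sum_le_univ_sum_of_nonneg fun u => by positivity
      _ = 16 * 2 ^ e * m := by rw [← Finset.mul_sum, hsum]; ring
  have h4 : (X.card : ℝ) * 2 ^ e ≤ 2 * m := by
    have : X.card * 2 ^ e ≤ 2 * m := by
      rw [← sum_length_nbOf L]
      refine le_trans ?_ (Finset.sum_le_univ_sum_of_nonneg (s := X) fun v => Nat.zero_le _)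
      rw [← smul_eq_mul]
      refine Finset.card_nsmul_le_sum _ _ _ fun x hx => ?_
      rw [← he x hx]
      exact Nat.pow_log_le_self 2 (List.length_pos_iff.2 (hX x hx).ne_nil).ne'
    exact_mod_cast this
  rw [h1]
  refine le_of_sq_le_sq ((Finset.sum_mul_sq_le_sq_mul_sq S _ _).trans ?_) (by positivity)
  calc (∑ u ∈ S, (reachCount L ok X j u : ℝ) ^ 2) * ∑ u ∈ S, (1 + ((nbOf L u).length : ℝ)) ^ 2
      ≤ (((4 * q * N) ^ j) ^ 2 * X.card) * (16 * 2 ^ e * m) := by gcongr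
    _ = ((4 * q * N) ^ j) ^ 2 * 16 * m * (X.card * 2 ^ e) := by ring
    _ ≤ ((4 * q * N) ^ j) ^ 2 * 16 * m * (2 * m) := by gcongr
    _ ≤ (6 * m * (4 * q * N) ^ j) ^ 2 := by
        nlinarith [sq_nonneg ((4 * q * N) ^ j * m)]

end low

/-- The total size of layer `j` of the searches from the vertices in `X`. For the vertices of degree
more than `σ ^ 2`, of which there are few, the trivial bound is used. -/
theorem sum_layerCost_le {σ q : ℝ} {N : ℕ} {X : Finset (Fin n)} (hL : IsEdgeList G L)
    (hcut : CutBound G L σ q) (hq : 0 ≤ q) (hσ : 1 ≤ σ)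
    (hd : ∀ j, j + 1 < k → d j ≠ d (j + 1)) (hX : ∀ x ∈ X, Layered L k col d (ok x) x)
    (hN : 2 * L.length < 2 ^ N) {j : ℕ} (hj : j < k) :
    ((∑ x ∈ X, layerCost n (nbOf L) (ok x) x j : ℕ) : ℝ) ≤
      N * (6 * L.length * (4 * q * N) ^ j) + 8 * (L.length : ℝ) ^ 2 / σ ^ 2 := by
  classical
  rw [← Finset.sum_filter_add_sum_filter_not X fun x : Fin n => ((nbOf L x).length : ℝ) ≤ σ ^ 2, Nat.cast_add]
  refine add_le_add ?_ ?_
  · set Y := X.filter fun x : Fin n => ((nbOf L x).length : ℝ) ≤ σ ^ 2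
    have hmap : ∀ x ∈ Y, Nat.log 2 (nbOf L x).length ∈ Finset.range N := by
      intro x hx
      have hne := (hX x (Finset.mem_filter.1 hx).1).ne_nil
      exact Finset.mem_range.2 (Nat.log_lt_of_lt_pow (List.length_pos_iff.2 hne).ne'
        ((length_nbOf_le L x).trans_lt hN))
    rw [← Finset.sum_fiberwise_of_maps_to hmap, Nat.cast_sum]
    refine (Finset.sum_le_card_nsmul _ _ _ fun e _ => ?_).trans_eq (by
      rw [Finset.card_range, nsmul_eq_mul])
    exact sum_layerCost_level_le hL hcut hq hd
      (fun x hx => hX x (Finset.mem_filter.1 (Finset.mem_filter.1 hx).1).1)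
      (fun x hx => (Finset.mem_filter.1 (Finset.mem_filter.1 hx).1).2) hN hj
      fun x hx => (Finset.mem_filter.1 hx).2
  · set Y := X.filter fun x : Fin n => ¬ ((nbOf L x).length : ℝ) ≤ σ ^ 2
    set m := L.length
    have h1 : (Y.card : ℝ) * σ ^ 2 ≤ 2 * m := by
      have h2 : (Y.card : ℝ) * σ ^ 2 ≤ ∑ x ∈ Y, ((nbOf L x).length : ℝ) := by
        rw [← nsmul_eq_mul]
        exact Finset.card_nsmul_le_sum _ _ _ fun x hx => (not_le.1 (Finset.mem_filter.1 hx).2).le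
      refine h2.trans ((Finset.sum_le_univ_sum_of_nonneg fun v => by positivity).trans_eq ?_)
      exact_mod_cast sum_length_nbOf L
    have h2 : ∀ x ∈ Y, (layerCost n (nbOf L) (ok x) x j : ℝ) ≤ 4 * m := by
      intro x hx
      have : layerCost n (nbOf L) (ok x) x j ≤ 2 * ∑ u : Fin n, (nbOf L u).length := by
        rw [layerCost_eq_sum, Finset.mul_sum]
        refine Finset.sum_le_sum fun u _ => ?_
        split_ifs with hr
        · have := ((hX x (Finset.mem_filter.1 hx).1).of_reach hL hj hr).2.2
          omega
        · omega
      rw [sum_length_nbOf] at this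
      calc (layerCost n (nbOf L) (ok x) x j : ℝ) ≤ (2 * (2 * m) : ℕ) := Nat.cast_le.2 this
        _ = 4 * m := by push_cast; ring
    have hσ0 : 0 < σ ^ 2 := by positivity
    rw [Nat.cast_sum, le_div_iff₀ hσ0]
    calc (∑ x ∈ Y, (layerCost n (nbOf L) (ok x) x j : ℝ)) * σ ^ 2 ≤ (Y.card * (4 * m)) * σ ^ 2 := by
          gcongr
          rw [← nsmul_eq_mul]
          exact Finset.sum_le_card_nsmul _ _ _ h2
      _ = Y.card * σ ^ 2 * (4 * m) := by ring
      _ ≤ 2 * m * (4 * m) := by gcongr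
      _ = _ := by ring

end EvenCycles

namespace EvenCycles

open WordRAM Machine

/-! ### The total work -/

variable {n : ℕ} {G : SimpleGraph (Fin n)} {L : List (Fin n × Fin n)} {k N p : ℕ} {c : ℕ → ℕ}

/-- Both sides of a search proceed through colour classes, and no vertex has a larger degree than the
first one, since its key would be larger. -/
theorem layered_allowed {x : Fin n} (hx : IsStart L p c x) :
    Layered L k (fun u => rank (rlOf L) u % p) c (Allowed n (nbOf L) (rlOf L) p c x) x ∧
    Layered L k (fun u => rank (rlOf L) u % p) (fun j => if j = 0 then c 0 else c (2 * k - j))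
      (AllowedBack (nbOf L) (Allowed n (nbOf L) (rlOf L) p c x) k x) x := by
  have key : ∀ i u, Allowed n (nbOf L) (rlOf L) p c x i u → rank (rlOf L) u % p = c i ∧
      (nbOf L u).length ≤ (nbOf L x).length := by
    rintro i u ⟨h1, h2⟩
    refine ⟨h1, Nat.lt_succ_iff.1 (lt_of_mul_lt_mul_right (a := n) ?_ (Nat.zero_le _))⟩
    have := x.2
    unfold vkey at h2
    rw [Nat.succ_mul]
    omega
  refine ⟨⟨hx.2, hx.1, fun j _ _ u h => key j u h⟩, ⟨by simpa using hx.2, hx.1, fun j hj _ u h => ?_⟩⟩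
  simp only [if_neg (show j ≠ 0 by omega)]
  exact key _ u h.1

/-- The total work of the searches for one colouring. -/
theorem colouringWork_le {σ q : ℝ} {N₁ : ℕ} (hL : IsEdgeList G L) (hk : 2 ≤ k)
    (hcut : CutBound G L σ q) (hq : 1 ≤ q) (hσ : 1 ≤ σ) (hc : ((List.range (2 * k)).map c).Nodup)
    (hN : 2 * L.length < 2 ^ N₁) (hN₁ : 1 ≤ N₁) :
    (colouringWork G L k N p c : ℝ) ≤ 2 * k * (N₁ * (6 * L.length * (4 * q * N₁) ^ (k - 1)) +
      8 * (L.length : ℝ) ^ 2 / σ ^ 2) + (N + 1) * ((2 * k) ^ (2 * k) * cycleCount G (2 * k)) := by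
  classical
  have hinj : ∀ i j, i < 2 * k → j < 2 * k → i ≠ j → c i ≠ c j := fun i j hi hj hij h =>
    hij (List.inj_on_of_nodup_map hc (List.mem_range.2 hi) (List.mem_range.2 hj) h)
  set X : Finset (Fin n) := Finset.univ.filter fun x : Fin n => IsStart L p c x with hX
  have hXs : ∀ x ∈ X, IsStart L p c x := fun x hx => (Finset.mem_filter.1 hx).2
  set ok : ℕ → ℕ → ℕ → Prop := fun x => Allowed n (nbOf L) (rlOf L) p c x with hok
  set okB : ℕ → ℕ → ℕ → Prop := fun x => AllowedBack (nbOf L) (ok x) k x with hokB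
  set R : ℝ := N₁ * (6 * L.length * (4 * q * N₁) ^ (k - 1)) + 8 * (L.length : ℝ) ^ 2 / σ ^ 2 with hR
  have hN₁' : (1 : ℝ) ≤ N₁ := by exact_mod_cast hN₁
  have hj : ∀ j < k, (N₁ * (6 * L.length * (4 * q * N₁) ^ j) + 8 * (L.length : ℝ) ^ 2 / σ ^ 2) ≤ R := by
    intro j hj
    have : 1 ≤ 4 * q * N₁ := by nlinarith
    rw [hR]
    gcongr
    omega
  have h1 : ∀ j < k, ((∑ x ∈ X, layerCost n (nbOf L) (ok x) x j : ℕ) : ℝ) ≤ R := fun j hjk =>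
    (sum_layerCost_le hL hcut (by linarith) hσ (fun j hj => hinj _ _ (by omega) (by omega) (by omega))
      (fun x hx => (layered_allowed (hXs x hx)).1) hN hjk).trans (hj j hjk)
  have h2 : ∀ j < k, ((∑ x ∈ X, layerCost n (nbOf L) (okB x) x j : ℕ) : ℝ) ≤ R := fun j hjk =>
    (sum_layerCost_le hL hcut (by linarith) hσ (fun j hj => by
        simp only [if_neg (Nat.succ_ne_zero j)]
        split_ifs
        · exact hinj _ _ (by omega) (by omega) (by omega)
        · exact hinj _ _ (by omega) (by omega) (by omega))
      (fun x hx => (layered_allowed (hXs x hx)).2) hN hjk).trans (hj j hjk)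
  have h3 : ∑ x ∈ X, tupleCount G (2 * k) x ≤ (2 * k) ^ (2 * k) * cycleCount G (2 * k) := by
    refine le_trans ?_ (sum_tupleCount_le (G := G) (show 3 ≤ 2 * k by omega))
    rw [← Fin.sum_univ_eq_sum_range (fun x => tupleCount G (2 * k) x) n]
    exact Finset.sum_le_univ_sum_of_nonneg fun _ => Nat.zero_le _
  have h4 : colouringWork G L k N p c = ∑ j ∈ Finset.range k,
      (∑ x ∈ X, layerCost n (nbOf L) (ok x) x j + ∑ x ∈ X, layerCost n (nbOf L) (okB x) x j) +
      (N + 1) * ∑ x ∈ X, tupleCount G (2 * k) x := by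
    rw [colouringWork, Finset.sum_filter, ← Fin.sum_univ_eq_sum_range
      (fun x : ℕ => if IsStart L p c x then searchWork G L k N p c x else 0) n, ← Finset.sum_filter]
    simp only [searchWork, Finset.sum_add_distrib, Finset.mul_sum]
    rw [Finset.sum_comm, Finset.sum_comm (s := Finset.range k) (t := X), Finset.sum_comm (s := Finset.range k) (t := X)]
  rw [h4]
  push_cast
  refine add_le_add ?_ (mul_le_mul_of_nonneg_left (by exact_mod_cast h3) (by positivity))
  calc _ ≤ ∑ j ∈ Finset.range k, (R + R) := by
        refine Finset.sum_le_sum fun j hj => add_le_add ?_ ?_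
        · exact_mod_cast h1 j (Finset.mem_range.1 hj)
        · exact_mod_cast h2 j (Finset.mem_range.1 hj)
    _ = 2 * k * R := by
        rw [Finset.sum_const, Finset.card_range, nsmul_eq_mul]; ring

/-! ### The machine and the time bound -/

/-- The exponent in the bound `(m + 2) ^ searchExp k` for the powers `2 ^ p` of the moduli. -/
def searchExp (k : ℕ) : ℕ := 4 * (2 * k * (2 * k)) + 2

/-- The base of the addresses is this power of the input size. -/
def baseExp (k : ℕ) : ℕ := searchExp k * (2 * k * (2 * k)) + searchExp k + 4 * k + 11

/-- The machine on which the program runs. -/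
def machine (k w : ℕ) (L : List (Fin n × Fin n)) (hw : (n + L.length + 2) ^ (4 * baseExp k) ≤ 2 ^ w) :
    Machine where
  w := w
  B := (n + L.length + 2) ^ baseExp k
  len := 2 * L.length + 2
  inp i := (encodeInput L).getD i 0
  two_le := by
    calc 2 ≤ (n + L.length + 2) ^ 1 := by rw [pow_one]; omega
      _ ≤ _ := Nat.pow_le_pow_right (by omega) (by unfold baseExp; omega)
  len_le := by
    calc 2 * L.length + 2 ≤ 2 * (n + L.length + 2) := by omega
      _ ≤ (n + L.length + 2) ^ 2 := by rw [sq]; exact Nat.mul_le_mul_right _ (by omega)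
      _ ≤ _ := Nat.pow_le_pow_right (by omega) (by unfold baseExp; omega)
  pow_le := by rwa [← pow_mul, mul_comm]

/-- The base of the addresses exceeds all quantities that occur in a run: the product of the
differences of ranks, the moduli and the numbers of the searches. -/
theorem ambient (hk : 2 ≤ k) {w : ℕ} (hw : (n + L.length + 2) ^ (4 * baseExp k) ≤ 2 ^ w) :
    Ambient (machine k w L hw) L k ((L.length + 2) ^ 2) (Nat.log 2 ((L.length + 2) ^ searchExp k)) ∧
    (L.length + 2) ^ searchExp k + 1 < (machine k w L hw).B := by
  set K := searchExp k with hK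
  set m := L.length
  set s := n + m + 2 with hs
  set Y := (m + 2) ^ K with hY
  set N := Nat.log 2 Y with hN
  have hB : (machine k w L hw).B = s ^ baseExp k := rfl
  have hle : ∀ j, j ≤ baseExp k → s ^ j ≤ s ^ baseExp k := fun j hj => Nat.pow_le_pow_right (by omega) hj
  have hbase : baseExp k = K * (2 * k * (2 * k)) + K + 4 * k + 11 := rfl
  have hKk : K = 4 * (2 * k * (2 * k)) + 2 := rfl
  have h3 : s ^ 3 ≤ s ^ baseExp k := hle 3 (by omega)
  have hY0 : Y ≠ 0 := by positivity
  have hYs : Y ≤ s ^ K := Nat.pow_le_pow_left (by omega) _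
  have hsK : s ^ K * s ≤ s ^ baseExp k := by rw [← pow_succ]; exact hle _ (by omega)
  have hsK1 : 2 ≤ s ^ K := by
    calc 2 ≤ s ^ 1 := by rw [pow_one]; omega
      _ ≤ _ := Nat.pow_le_pow_right (by omega) (by omega)
  have hYB : Y + 1 < s ^ baseExp k := by nlinarith
  have hN1 : N + 1 ≤ s ^ K := by
    have h1 : N < 2 ^ N := Nat.lt_two_pow_self
    have h2 : 2 ^ N ≤ Y := Nat.pow_log_le_self 2 hY0
    omega
  refine ⟨⟨⟨rfl, fun _ => rfl⟩, ?_, ?_, ?_, Nat.one_le_pow _ _ (by omega), ?_, ?_, ?_, ?_, ?_⟩, hYB⟩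
  · refine lt_of_lt_of_le ?_ h3
    have : (n + 2) ^ 3 ≤ s ^ 3 := Nat.pow_le_pow_left (by omega) _
    nlinarith
  · calc 4 * k + 8 < 2 ^ (4 * k + 8) := Nat.lt_two_pow_self
      _ ≤ s ^ (4 * k + 8) := Nat.pow_le_pow_left (by omega) _
      _ ≤ _ := hle _ (by omega)
  · refine lt_of_lt_of_le ?_ h3
    have : s * 4 ≤ s * s ^ 2 := Nat.mul_le_mul_left _ (by nlinarith)
    have : s * s ^ 2 = s ^ 3 := by ring
    omega
  · nlinarith
  · rw [← pow_mul]
    calc (m + 2) ^ (2 * (2 * k * (2 * k))) ≤ Y := Nat.pow_le_pow_right (by omega) (by omega)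
      _ < _ := by rw [hB]; omega
  · refine lt_of_le_of_lt ?_ (Nat.lt_pow_succ_log_self (by norm_num) Y)
    rw [← pow_mul, ← pow_mul, hY, hKk, pow_add, mul_comm,
      show 2 * (2 * k * (2 * k) * 2) = 4 * (2 * k * (2 * k)) by ring]
    exact Nat.mul_le_mul_left _ (by nlinarith)
  · exact (Nat.log_le_self 2 Y).trans_lt (by rw [hB]; omega)
  · have h1 : (N + 1) ^ (2 * k * (2 * k)) ≤ s ^ (K * (2 * k * (2 * k))) := by
      rw [pow_mul s]; exact Nat.pow_le_pow_left hN1 _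
    have h2 : s ^ (K * (2 * k * (2 * k))) * s ^ 2 ≤ s ^ baseExp k := by
      rw [← pow_add]; exact hle _ (by omega)
    have h4 : 1 ≤ s ^ (K * (2 * k * (2 * k))) := Nat.one_le_pow _ _ (by omega)
    rw [hB]
    refine lt_of_lt_of_le ?_ h2
    have h5 : 2 * m + 1 + 2 < s ^ 2 := by nlinarith
    nlinarith [Nat.mul_le_mul_right (2 * m + 1) h1]

/-- The state of the machine at the beginning. -/
def initial : AState := ⟨fun _ => 0, fun _ _ _ => [], []⟩

theorem rep_init {M : Machine} (hM : Input M L) : M.Rep (State.init (encodeInput L)).mem initial.st where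
  input a _ := (hM.inp a).symm
  length_lt _ _ _ := by have := M.two_le; simp only [initial, List.length_nil]; omega
  count t r u ht _ _ _ := by
    have h1 := le_cell (B := M.B) (r := r) (u := u) (i := 0) (by have := M.two_le; omega) ht
    have h2 := M.len_le
    rw [hM.len, ← length_encodeInput] at h2
    exact List.getD_eq_default _ _ (h2.trans h1)
  item _ _ _ _ _ _ _ i hi := absurd hi (Nat.not_lt_zero i)

end EvenCycles

namespace EvenCycles

open WordRAM Machine

variable {n : ℕ} {G : SimpleGraph (Fin n)} {L : List (Fin n × Fin n)} {k : ℕ}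

/-- The bound for the moduli that the program tries. -/
def modulusBound (k m : ℕ) : ℕ := Nat.log 2 ((m + 2) ^ searchExp k)

/-- The run of the program on an edge list. -/
theorem exists_exec (hk : 2 ≤ k) (hL : IsEdgeList G L) {w : ℕ}
    (hw : (n + L.length + 2) ^ (4 * baseExp k) ≤ 2 ^ w) {Z : ℕ}
    (hZ : ∀ p, ∀ c : ℕ → ℕ, ((List.range (2 * k)).map c).Nodup →
      colouringWork G L k (modulusBound k L.length) p c ≤ Z) :
    ∃ T s, Exec w (mainP k (searchExp k) (baseExp k)) (State.init (encodeInput L)) T s ∧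
      ListsAllCycles G (2 * k) s.out ∧ T ≤ mainCost k (searchExp k) (baseExp k) *
        ((modulusBound k L.length + 1) ^ (2 * k + 1) * (1 + L.length + Z)) := by
  obtain ⟨hM, hY⟩ := ambient hk hw
  obtain ⟨b, hrun, hb⟩ := Tri.main (a := initial) hL hk hM rfl hY rfl (fun _ => rfl)
    (fun _ _ _ => rfl) rfl hZ
  obtain ⟨mem, T, hT, -, hx⟩ := hrun _ (rep_init hM.input)
  exact ⟨T, _, hx, hb.listsAllCycles (by omega), hT⟩

/-- The scale `σ` is the `2k`-th root of the quantity by which the time is bounded. -/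
theorem exists_scale (hk : 2 ≤ k) (m t : ℕ) : ∃ σ : ℝ, 1 ≤ σ ∧
    σ ^ (2 * k) = (m : ℝ) ^ ((2 * (k : ℝ)) / ((k : ℝ) + 1)) + t + 1 ∧ (m : ℝ) ≤ σ ^ (k + 1) := by
  set U : ℝ := (m : ℝ) ^ ((2 * (k : ℝ)) / ((k : ℝ) + 1)) with hU
  have hU0 : 0 ≤ U := Real.rpow_nonneg (Nat.cast_nonneg _) _
  set T : ℝ := U + t + 1 with hT
  have ht0 : (0 : ℝ) ≤ t := Nat.cast_nonneg _
  have hT1 : 1 ≤ T := by linarith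
  have hk0 : (0 : ℝ) < k := by exact_mod_cast (by omega : 0 < k)
  refine ⟨T ^ (((2 * k : ℕ) : ℝ)⁻¹), Real.one_le_rpow hT1 (by positivity),
    Real.rpow_inv_natCast_pow (by linarith) (by omega), ?_⟩
  calc (m : ℝ) = U ^ (((k : ℝ) + 1) / (2 * k)) := by
        rw [hU, ← Real.rpow_mul (Nat.cast_nonneg _)]
        rw [show (2 * (k : ℝ)) / (k + 1) * ((k + 1) / (2 * k)) = 1 by field_simp, Real.rpow_one]
    _ ≤ T ^ (((k : ℝ) + 1) / (2 * k)) :=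
        Real.rpow_le_rpow hU0 (by linarith) (by positivity)
    _ = (T ^ (((2 * k : ℕ) : ℝ)⁻¹)) ^ (k + 1) := by
        rw [← Real.rpow_natCast, ← Real.rpow_mul (by linarith)]
        congr 1
        push_cast
        field_simp

/-- The moduli are `O(log m)`. -/
theorem modulusBound_le (k m : ℕ) :
    ((modulusBound k m : ℝ) + 1) ≤ (searchExp k + 1) / Real.log 2 * Real.log (m + 2) := by
  have h2 : 0 < Real.log 2 := Real.log_pos (by norm_num)
  have hm : Real.log 2 ≤ Real.log (m + 2) :=
    Real.log_le_log (by norm_num) (by have : (0 : ℝ) ≤ m := Nat.cast_nonneg _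
                                      linarith)
  have h1 : (2 : ℝ) ^ modulusBound k m ≤ ((m : ℝ) + 2) ^ searchExp k := by
    have : 2 ^ modulusBound k m ≤ (m + 2) ^ searchExp k := Nat.pow_log_le_self 2 (by positivity)
    exact_mod_cast this
  have h3 := Real.log_le_log (by positivity) h1
  rw [Real.log_pow, Real.log_pow] at h3
  rw [div_mul_eq_mul_div, le_div_iff₀ h2]
  nlinarith

/-- The work for one colouring, in terms of the scale `σ`. -/
theorem exists_colouringWork_le (hk : 2 ≤ k) (hconj : SupersaturationConjecture k) :
    ∃ C : ℝ, 0 ≤ C ∧ ∀ (n : ℕ) (G : SimpleGraph (Fin n)) (L : List (Fin n × Fin n)),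
      IsEdgeList G L → ∀ σ : ℝ, 1 ≤ σ → (cycleCount G (2 * k) : ℝ) ≤ σ ^ (2 * k) →
      (L.length : ℝ) ≤ σ ^ (k + 1) → ∀ p, ∀ c : ℕ → ℕ, ((List.range (2 * k)).map c).Nodup →
      (colouringWork G L k (modulusBound k L.length) p c : ℝ) ≤
        C * ((modulusBound k L.length : ℝ) + 1) ^ k * σ ^ (2 * k) := by
  obtain ⟨D, hD, hcut⟩ := exists_cutBound hk hconj
  refine ⟨2 * k * (6 * (4 * D) ^ (k - 1) + 8) + (2 * k) ^ (2 * k), by positivity, ?_⟩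
  intro n G L hL σ hσ ht hm p c hc
  set m : ℝ := (L.length : ℝ) with hmd
  set N := modulusBound k L.length with hN
  set h : ℝ := (N : ℝ) + 1 with hh
  have hm0 : 0 ≤ m := Nat.cast_nonneg _
  have hh1 : 1 ≤ h := by rw [hh]; linarith [Nat.cast_nonneg (α := ℝ) N]
  have hlt : 2 * L.length < 2 ^ (N + 1) := by
    refine lt_of_le_of_lt ?_ (Nat.lt_pow_succ_log_self (by norm_num) _)
    calc 2 * L.length ≤ (L.length + 2) ^ 2 := by nlinarith
      _ ≤ (L.length + 2) ^ searchExp k := Nat.pow_le_pow_right (by omega) (by unfold searchExp; omega)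
  have hw := colouringWork_le (N := N) (p := p) hL hk (hcut n G L hL σ hσ ht hm)
    (one_le_mul_of_one_le_of_one_le hD hσ) hσ hc hlt (by omega)
  rw [Nat.cast_add, Nat.cast_one, ← hh, ← hmd] at hw
  clear_value h
  have h1 : m * σ ^ (k - 1) ≤ σ ^ (2 * k) := by
    calc m * σ ^ (k - 1) ≤ σ ^ (k + 1) * σ ^ (k - 1) := by gcongr
      _ = σ ^ (2 * k) := by rw [← pow_add]; congr 1; omega
  have h2 : m ^ 2 / σ ^ 2 ≤ σ ^ (2 * k) := by
    rw [div_le_iff₀ (by positivity)]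
    calc m ^ 2 ≤ (σ ^ (k + 1)) ^ 2 := by gcongr
      _ = _ := by ring
  have hhk : 1 ≤ h ^ k := one_le_pow₀ hh1
  have hhk' : h ≤ h ^ k := le_self_pow₀ hh1 (by omega)
  have hS : 0 ≤ σ ^ (2 * k) := by positivity
  have h3 : h * (6 * m * (4 * (D * σ) * h) ^ (k - 1)) ≤ 6 * (4 * D) ^ (k - 1) * (h ^ k * σ ^ (2 * k)) := by
    calc h * (6 * m * (4 * (D * σ) * h) ^ (k - 1))
        = 6 * (4 * D) ^ (k - 1) * (h ^ (k - 1) * h * (m * σ ^ (k - 1))) := by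
          rw [show 4 * (D * σ) * h = 4 * D * (σ * h) by ring, mul_pow, mul_pow]; ring
      _ ≤ 6 * (4 * D) ^ (k - 1) * (h ^ (k - 1) * h * σ ^ (2 * k)) := by gcongr
      _ = _ := by rw [← pow_succ, Nat.sub_add_cancel (by omega)]
  have h4 : 8 * m ^ 2 / σ ^ 2 ≤ 8 * (h ^ k * σ ^ (2 * k)) := by
    rw [mul_div_assoc]
    gcongr
    exact h2.trans (le_mul_of_one_le_left hS hhk)
  have h5 : h * ((2 * (k : ℝ)) ^ (2 * k) * cycleCount G (2 * k)) ≤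
      (2 * (k : ℝ)) ^ (2 * k) * (h ^ k * σ ^ (2 * k)) := by
    calc h * ((2 * (k : ℝ)) ^ (2 * k) * cycleCount G (2 * k))
        = (2 * (k : ℝ)) ^ (2 * k) * (h * cycleCount G (2 * k)) := by ring
      _ ≤ _ := by gcongr
  calc _ ≤ _ := hw
    _ ≤ 2 * k * (6 * (4 * D) ^ (k - 1) * (h ^ k * σ ^ (2 * k)) + 8 * (h ^ k * σ ^ (2 * k))) +
        (2 * (k : ℝ)) ^ (2 * k) * (h ^ k * σ ^ (2 * k)) := by gcongr
    _ = _ := by ring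

end EvenCycles

theorem mainTheorem7 (k : ℕ) (hk : 2 ≤ k)
    (hconj : EvenCycles.SupersaturationConjecture k) :
    ∃ (P : WordRAM.Program) (C : ℝ) (d q : ℕ),
      ∀ (n : ℕ) (G : SimpleGraph (Fin n)) (L : List (Fin n × Fin n)),
        EvenCycles.IsEdgeList G L →
        ∀ w : ℕ, (n + L.length + 2) ^ q ≤ 2 ^ w →
          ∃ (T : ℕ) (s : WordRAM.State),
            WordRAM.Exec w P (WordRAM.State.init (EvenCycles.encodeInput L)) T s ∧
            EvenCycles.ListsAllCycles G (2 * k) s.out ∧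
            (T : ℝ) ≤ C *
              ((L.length : ℝ) ^ ((2 * (k : ℝ)) / ((k : ℝ) + 1)) +
                (EvenCycles.cycleCount G (2 * k) : ℝ) + 1) *
              Real.log ((L.length : ℝ) + 2) ^ d := by
  obtain ⟨C, hC, hwork⟩ := EvenCycles.exists_colouringWork_le hk hconj
  set K := EvenCycles.searchExp k
  set A : ℝ := ((EvenCycles.mainCost k K (EvenCycles.baseExp k) : ℕ) : ℝ)
  set c : ℝ := (K + 1) / Real.log 2
  refine ⟨EvenCycles.mainP k K (EvenCycles.baseExp k), A * (2 + C) * c ^ (3 * k + 1), 3 * k + 1,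
    4 * EvenCycles.baseExp k, fun n G L hL w hw => ?_⟩
  obtain ⟨σ, hσ, hσT, hm⟩ := EvenCycles.exists_scale hk L.length (EvenCycles.cycleCount G (2 * k))
  rw [← hσT]
  have ht : (EvenCycles.cycleCount G (2 * k) : ℝ) ≤ σ ^ (2 * k) := by
    have : 0 ≤ (L.length : ℝ) ^ ((2 * (k : ℝ)) / ((k : ℝ) + 1)) := by positivity
    linarith
  set h : ℝ := (EvenCycles.modulusBound k L.length : ℝ) + 1
  have hh : 1 ≤ h := le_add_of_nonneg_left (Nat.cast_nonneg _)
  have hS : 0 ≤ C * h ^ k * σ ^ (2 * k) := by positivity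
  obtain ⟨T, s, hx, hls, hT⟩ := EvenCycles.exists_exec hk hL hw (Z := ⌊C * h ^ k * σ ^ (2 * k)⌋₊)
    fun p c hc => Nat.le_floor (hwork n G L hL σ hσ ht hm p c hc)
  refine ⟨T, s, hx, hls, ?_⟩
  have hm' : (L.length : ℝ) ≤ h ^ k * σ ^ (2 * k) :=
    hm.trans ((pow_le_pow_right₀ hσ (by omega)).trans
      (le_mul_of_one_le_left (by positivity) (one_le_pow₀ hh)))
  have h1 : 1 ≤ h ^ k * σ ^ (2 * k) :=
    one_le_mul_of_one_le_of_one_le (one_le_pow₀ hh) (one_le_pow₀ hσ)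
  calc (T : ℝ) ≤ A * (h ^ (2 * k + 1) * (1 + L.length + ⌊C * h ^ k * σ ^ (2 * k)⌋₊)) := by
        have := Nat.cast_le (α := ℝ).2 hT
        push_cast at this
        exact this
    _ ≤ A * (h ^ (2 * k + 1) * (h ^ k * σ ^ (2 * k) + h ^ k * σ ^ (2 * k) + C * h ^ k * σ ^ (2 * k))) := by
        gcongr
        exact Nat.floor_le hS
    _ = A * (2 + C) * σ ^ (2 * k) * h ^ (3 * k + 1) := by ring
    _ ≤ A * (2 + C) * σ ^ (2 * k) * (c * Real.log ((L.length : ℝ) + 2)) ^ (3 * k + 1) := by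
        gcongr
        exact EvenCycles.modulusBound_le k L.length
    _ = _ := by rw [mul_pow]; ring
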